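/- **Setting.** Let $(\mathcal X,d)$ be a metric space with a Borel measure $\mu$ for which all (open) balls have positive and finite measure, and suppose there are $C_1>1$ and $n>0$ with $$\mu(B(x,\lambda r))\le C_1\lambda^n\mu(B(x,r))\qquad\text{for all }x\in\mathcal X,\ r>0,\ \lambda>1 .$$ Write ⨍ for averages, $u_B=$ ⨍$_B\,u\,d\mu$, and let $u\in L^r_{\rm loc}(\mathcal X)$ mean that $u\in L^r(B)$ for every ball $B$. Functions are real-valued and measurable. For $s\in(0,\infty)$ and $p\in(0,\infty]$ put $p_*(s)=np/(n-ps)$ if $p<n/s$ and $p_*(s)=\infty$ if $p\ge n/s$. For $p,q\in(0,\infty]$ the homogeneous Besov space $\dot B^s_{p,q}(\mathcal X)$ consists of all $u\in L^p_{\rm loc}(\mathcal X)$ with $$\|u\|_{\dot B^s_{p,q}(\mathcal X)}=\Big(\int_0^\infty\Big(\int_{\mathcal X}\frac1{\mu(B(x,t))}\int_{B(x,t)}|u(x)-u(y)|^p\,d\mu(y)\,d\mu(x)\Big)^{q/p}\frac{dt}{t^{1+sq}}\Big)^{1/q}<\infty,$$ with the usual modification (suprema) when $p=\infty$ or $q=\infty$.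 For $\sigma\in(0,\infty)$, $\epsilon\in[0,s]$, $t>0$ and $x\in\mathcal X$ let, with $B=B(x,t)$, $$C^{s,\sigma}_t(u)(x)=t^{-s}\Big(\frac1{\mu(B)}\int_{B}|u(x)-u(y)|^\sigma d\mu(y)\Big)^{1/\sigma},\qquad A^{s,\sigma}_t(u)(x)=t^{-s}\Big(\frac1{\mu(B)}\int_{B}|u(y)-u_{B}|^\sigma d\mu(y)\Big)^{1/\sigma},$$ $$I^{s,\sigma}_t(u)(x)=t^{-s}\Big(\inf_{c\in\mathbb R}\frac1{\mu(B)}\int_{B}|u(y)-c|^\sigma d\mu(y)\Big)^{1/\sigma},\qquad S^{s,\epsilon,\sigma}_t(u)(x)=t^{\epsilon-s}\sup_{r\in(0,t]}r^{-\epsilon}\Big(\inf_{c\in\mathbb R}\frac1{\mu(B(x,r))}\int_{B(x,r)}|u(y)-c|^\sigma d\mu(y)\Big)^{1/\sigma}.$$ For $E$ equal to $C^{s,\sigma}$, $A^{s,\sigma}$, $I^{s,\sigma}$ or $S^{s,\epsilon,\sigma}$, let $\vec E\dot B_{p,q}(\mathcal X)$ be the set of all $u\in L^\sigma_{\rm loc}(\mathcal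 X)$ (for $A^{s,\sigma}$ also $u\in L^1_{\rm loc}(\mathcal X)$, so that the averages $u_B$ are defined) with $$\|u\|_{\vec E\dot B_{p,q}(\mathcal X)}=\Big(\int_0^\infty\|E_t(u)\|_{L^p(\mathcal X)}^q\,\frac{dt}t\Big)^{1/q}<\infty,$$ with a supremum over $t>0$ when $q=\infty$. Equality of two such spaces means that they consist of the same functions and that each norm is bounded by a constant, independent of the function, times the other. **Theorem 1.1.** Let $s\in(0,\infty)$ and $p,q\in(0,\infty]$; in (i)–(iv), $\sigma\in(0,\infty)$. (i) If $\sigma\le p$, then $\dot B^s_{p,q}(\mathcal X)=\vec C^{s,\sigma}\dot B_{p,q}(\mathcal X)$. (ii) If $\sigma<p_*(s)$, then $\dot B^s_{p,q}(\mathcal X)=\vec I^{s,\sigma}\dot B_{p,q}(\mathcal X)$. (iii) If $\epsilon\in[0,s)$ and $\sigma<p_*(s)$, then $\dot B^s_{p,q}(\mathcal X)=\vec S^{s,\epsilon,\sigma}\dot B_{p,q}(\mathcal X)$. (iv) If $p\in(n/(n+s),\infty]$ and $\sigma<p_*(s)$, then $\dot B^s_{p,q}(\mathcal X)=\vec A^{s,\sigma}\dot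 B_{p,q}(\mathcal X)$. Moreover, on $\mathbb R^n$, $n\ge1$, with the Euclidean distance and Lebesgue measure, the ranges of $\sigma$ and $\epsilon$ are optimal in the following sense. (v) Let $s\in(0,1)$, $p\in(0,n/s)$ and $\sigma\in(p_*(s),\infty)$. Then there is a function $u$ such that for all $q\in(0,\infty]$, $u\in\dot B^s_{p,q}(\mathbb R^n)$ but $u\notin L^\sigma_{\rm loc}(\mathbb R^n)$, and hence $u\notin\vec E\dot B_{p,q}(\mathbb R^n)$ for $\vec E=\vec A^{s,\sigma}$, $\vec I^{s,\sigma}$ and $\vec S^{s,\epsilon,\sigma}$ with any $\epsilon\in[0,s]$. (vi) Let $p\in(0,\infty)$, $\sigma\in(p,\infty)$ and $s\in(0,n/p-n/\sigma)\cap(0,1)$. Then there is a function $u$ such that for all $q\in(0,\infty]$, $u\in\dot B^s_{p,q}(\mathbb R^n)$ but $u\notin\vec C^{s,\sigma}\dot B_{p,q}(\mathbb R^n)$. (vii) Let $s\in(0,1)$ and $p\in(0,\infty)$. Then there is a function $u\in\dot B^s_{p,p}(\mathbb R^n)$ with $u\notin\vec S^{s,s,p}\dot B_{p,p}(\mathbb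 R^n)$. -/

import Mathlib

open MeasureTheory Set Metric
open scoped ENNReal

noncomputable section

namespace BesovMMS

/-- Standing assumptions on a metric space with a Borel measure: all balls have positive and finite
measure, and `μ` is doubling with constant `C₁` and exponent `n`. -/
structure IsDoubling {X : Type*} [MetricSpace X] [MeasurableSpace X] (μ : Measure X)
    (C₁ n : ℝ) : Prop where
  one_lt : 1 < C₁
  exponent_pos : 0 < n
  ball_pos : ∀ (x : X) (r : ℝ), 0 < r → 0 < μ (ball x r)
  ball_lt_top : ∀ (x : X) (r : ℝ), 0 < r → μ (ball x r) < ∞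
  doubling : ∀ (x : X) (r lam : ℝ), 0 < r → 1 < lam →
    μ (ball x (lam * r)) ≤ ENNReal.ofReal (C₁ * lam ^ n) * μ (ball x r)

/-- `p_*(s)`, equal to `n p / (n - p s)` if `p < n / s` and to `∞` otherwise. -/
def pStar (n s : ℝ) (p : ℝ≥0∞) : ℝ≥0∞ :=
  if p < ENNReal.ofReal (n / s) then ENNReal.ofReal (n * p.toReal / (n - p.toReal * s)) else ∞

/-- A collection of real functions on `X` together with its (quasi-)seminorm. -/
structure FunctionSpace (X : Type*) where
  carrier : Set (X → ℝ)
  seminorm : (X → ℝ) → ℝ≥0∞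

/-- `A ⊂ B` as function spaces: an inclusion of sets with a bound for the seminorms. -/
def FunctionSpace.Embeds {X : Type*} (A B : FunctionSpace X) : Prop :=
  ∃ K : ℝ, 0 < K ∧ ∀ u ∈ A.carrier, u ∈ B.carrier ∧ B.seminorm u ≤ ENNReal.ofReal K * A.seminorm u

/-- `A = B` as function spaces: the same functions, with equivalent seminorms. -/
def FunctionSpace.Equivalent {X : Type*} (A B : FunctionSpace X) : Prop :=
  A.Embeds B ∧ B.Embeds A

variable {X : Type*} [MetricSpace X] [MeasurableSpace X]

/-- `u ∈ L^p_loc`, that is, `u ∈ L^p(B)` for each ball `B`. -/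
def MemLpLoc (u : X → ℝ) (p : ℝ≥0∞) (μ : Measure X) : Prop :=
  ∀ (x : X) (r : ℝ), 0 < r → MemLp u p (μ.restrict (ball x r))

/-- The `L^p` size of the differences of `u` at distance less than `t`:
`(∫ ⨍_{B(x,t)} |u(x) - u(y)|^p dμ(y) dμ(x))^{1/p}`, with essential suprema when `p = ∞`. -/
def differenceModulus (u : X → ℝ) (p : ℝ≥0∞) (μ : Measure X) (t : ℝ) : ℝ≥0∞ :=
  if p = ∞ then
    essSup (fun x => essSup (fun y => ‖u x - u y‖ₑ) (μ.restrict (ball x t))) μ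
  else
    (∫⁻ x, ⨍⁻ y in ball x t, ‖u x - u y‖ₑ ^ p.toReal ∂μ ∂μ) ^ (1 / p.toReal)

/-- The seminorm of the homogeneous Besov space. -/
def besovNorm (s : ℝ) (p q : ℝ≥0∞) (μ : Measure X) (u : X → ℝ) : ℝ≥0∞ :=
  if q = ∞ then
    ⨆ t ∈ Ioi (0 : ℝ), ENNReal.ofReal (t ^ (-s)) * differenceModulus u p μ t
  else
    (∫⁻ t in Ioi (0 : ℝ), differenceModulus u p μ t ^ q.toReal *
      ENNReal.ofReal (t ^ (-(1 + s * q.toReal)))) ^ (1 / q.toReal)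

/-- The homogeneous Besov space. -/
def besovSpace (s : ℝ) (p q : ℝ≥0∞) (μ : Measure X) : FunctionSpace X where
  carrier := {u | MemLpLoc u p μ ∧ besovNorm s p q μ u < ∞}
  seminorm := besovNorm s p q μ

/-- `inf_c ⨍_{B(x,t)} |u(y) - c|^σ dμ(y)`. -/
def bestConst (σ : ℝ) (μ : Measure X) (u : X → ℝ) (t : ℝ) (x : X) : ℝ≥0∞ :=
  ⨅ c : ℝ, ⨍⁻ y in ball x t, ‖u y - c‖ₑ ^ σ ∂μ

/-- The functional `C^{s,σ}_t(u)(x)`. -/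
def functionalC (s σ : ℝ) (μ : Measure X) (u : X → ℝ) (t : ℝ) (x : X) : ℝ≥0∞ :=
  ENNReal.ofReal (t ^ (-s)) * (⨍⁻ y in ball x t, ‖u x - u y‖ₑ ^ σ ∂μ) ^ (1 / σ)

/-- The functional `A^{s,σ}_t(u)(x)`. -/
def functionalA (s σ : ℝ) (μ : Measure X) (u : X → ℝ) (t : ℝ) (x : X) : ℝ≥0∞ :=
  ENNReal.ofReal (t ^ (-s)) *
    (⨍⁻ y in ball x t, ‖u y - ⨍ z in ball x t, u z ∂μ‖ₑ ^ σ ∂μ) ^ (1 / σ)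

/-- The functional `I^{s,σ}_t(u)(x)`. -/
def functionalI (s σ : ℝ) (μ : Measure X) (u : X → ℝ) (t : ℝ) (x : X) : ℝ≥0∞ :=
  ENNReal.ofReal (t ^ (-s)) * bestConst σ μ u t x ^ (1 / σ)

/-- The functional `S^{s,ε,σ}_t(u)(x)`. -/
def functionalS (s ε σ : ℝ) (μ : Measure X) (u : X → ℝ) (t : ℝ) (x : X) : ℝ≥0∞ :=
  ENNReal.ofReal (t ^ (ε - s)) *
    ⨆ r ∈ Ioc (0 : ℝ) t, ENNReal.ofReal (r ^ (-ε)) * bestConst σ μ u r x ^ (1 / σ)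

/-- `(∫_0^∞ ‖E(·,t)‖_{L^p}^q dt/t)^{1/q}`, with a supremum over `t` when `q = ∞`. -/
def besovTypeNorm (p q : ℝ≥0∞) (μ : Measure X) (E : ℝ → X → ℝ≥0∞) : ℝ≥0∞ :=
  if q = ∞ then
    ⨆ t ∈ Ioi (0 : ℝ), eLpNorm (E t) p μ
  else
    (∫⁻ t in Ioi (0 : ℝ), eLpNorm (E t) p μ ^ q.toReal * ENNReal.ofReal t⁻¹) ^ (1 / q.toReal)

/-- The space of Besov type given by pointwise differences. -/
def spaceC (s σ : ℝ) (p q : ℝ≥0∞) (μ : Measure X) : FunctionSpace X where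
  carrier := {u | MemLpLoc u (ENNReal.ofReal σ) μ ∧ besovTypeNorm p q μ (functionalC s σ μ u) < ∞}
  seminorm := fun u => besovTypeNorm p q μ (functionalC s σ μ u)

/-- The space of Besov type given by mean oscillations. Local integrability, which for `1 ≤ σ`
follows from the first condition, is what gives the averages of `u` a meaning. -/
def spaceA (s σ : ℝ) (p q : ℝ≥0∞) (μ : Measure X) : FunctionSpace X where
  carrier := {u | MemLpLoc u (ENNReal.ofReal σ) μ ∧ MemLpLoc u 1 μ ∧
    besovTypeNorm p q μ (functionalA s σ μ u) < ∞}
  seminorm := fun u => besovTypeNorm p q μ (functionalA s σ μ u)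

/-- The space of Besov type given by best-constant oscillations. -/
def spaceI (s σ : ℝ) (p q : ℝ≥0∞) (μ : Measure X) : FunctionSpace X where
  carrier := {u | MemLpLoc u (ENNReal.ofReal σ) μ ∧ besovTypeNorm p q μ (functionalI s σ μ u) < ∞}
  seminorm := fun u => besovTypeNorm p q μ (functionalI s σ μ u)

/-- The space of Besov type given by the suprema of oscillations over smaller radii. -/
def spaceS (s ε σ : ℝ) (p q : ℝ≥0∞) (μ : Measure X) : FunctionSpace X where
  carrier := {u | MemLpLoc u (ENNReal.ofReal σ) μ ∧
    besovTypeNorm p q μ (functionalS s ε σ μ u) < ∞}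
  seminorm := fun u => besovTypeNorm p q μ (functionalS s ε σ μ u)

end BesovMMS

end

open BesovMMS

namespace BesovMMS

/-! ### Topological and measure-theoretic consequences of doubling -/

open Filter Topology

/-! Every space is compared with the one built on the double oscillation D_σ(x,r), the average of
|u(y) - u(z)|^σ over y, z in B(x,r) (`doubleOsc`). It is equivalent to inf_c ⨍ |u - c|^σ, but it is
visibly measurable in (x,r) and passes to comparable larger balls at the cost of a doubling
constant.

Oscillations control differences, for every order σ. By Jensen σ ≤ 1 may be assumed, and then |a -
b|^σ is a metric. Telescoping over the balls B(x,r/2^j) and Lebesgue differentiation give ⨍_{B(x,r)}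
|u(x) - u|^σ ≤ K ∑_j D_σ(x,r/2^j) almost everywhere (`ae_pointOsc_le_tsum`). Taking L^p norms leaves
a series over dyadic scales with weights 2^(δj), δ > 0 as small as desired. The weight t^(-s)
supplies decay in j, so a discrete Hardy inequality (`exists_scaleNorm_weighted_le`) sums it for all
p and q at once.

Differences control oscillations when σ < p_*(s). For σ ≤ p this is Jensen. To raise the order from
σ₀ ≤ min(p,1) to τ > p, the oscillation at scale t/2^j is bounded pointwise by its L^p average over
a ball of radius comparable to t, with loss 2^(nj); only the surplus power pays this loss. The
result is a series with growth 2^(n(1 - p/τ)j) (`exists_oscNorm_le`), and Hardy's inequality applies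
exactly when n(1 - p/τ) < sp, that is, τ < p_*(s).

The functional S is dominated by a dyadic series with growth 2^(εj), harmless for ε < s. Mean values
are nearly optimal constants for orders at least 1, and p > n/(n+s) means p_*(s) > 1, so such an
order is available for A.

For optimality, a truncated |x|^(-n/σ) is not in L^σ near 0, but is a Besov function when n/σ < n/p
- s. For ε = s a cone function has S bounded below on a fixed ball for all large t, and ∫ dt/t
diverges. -/

theorem IsDoubling.sigmaFinite {X : Type*} [MetricSpace X] [MeasurableSpace X] {μ : Measure X}
    {C₁ n : ℝ} (hμ : IsDoubling μ C₁ n) : SigmaFinite μ := by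
  rcases isEmpty_or_nonempty X with h | ⟨⟨x⟩⟩
  · rw [Measure.eq_zero_of_isEmpty μ]; infer_instance
  · refine ⟨⟨⟨fun k => ball x (k + 1), fun _ => trivial, fun k => ?_, ?_⟩⟩⟩
    · exact hμ.ball_lt_top x _ (by positivity)
    · refine eq_univ_of_forall fun y => mem_iUnion.2 ?_
      obtain ⟨k, hk⟩ := exists_nat_gt (dist y x)
      exact ⟨k, by rw [mem_ball]; linarith⟩

/-- A maximal ε-separated set carries disjoint balls of radius ε/2 and positive measure; a σ-finite
measure allows only countably many, and maximality gives density. -/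
theorem IsDoubling.secondCountableTopology {X : Type*} [MetricSpace X] [MeasurableSpace X]
    [OpensMeasurableSpace X] {μ : Measure X} {C₁ n : ℝ} (hμ : IsDoubling μ C₁ n) :
    SecondCountableTopology X := by
  have := hμ.sigmaFinite
  refine Metric.secondCountable_of_almost_dense_set fun ε hε => ?_
  obtain ⟨N, hN⟩ : ∃ N, Maximal (fun N : Set X => N.Pairwise fun x y => ε ≤ dist x y) N := by
    refine zorn_subset _ fun c hc hchain => ⟨⋃₀ c, ?_, fun s hs => subset_sUnion_of_mem hs⟩
    exact (pairwise_sUnion hchain.directedOn).2 hc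
  refine ⟨N, ?_, fun x => ?_⟩
  · have hd : Pairwise (Function.onFun Disjoint fun i : N => ball (i : X) (ε / 2)) := by
      intro i j hij
      refine ball_disjoint_ball ?_
      have := hN.prop i.2 j.2 (fun h => hij (Subtype.ext h))
      linarith
    have := Measure.countable_meas_pos_of_disjoint_iUnion (μ := μ)
      (fun i : N => measurableSet_ball (x := (i : X)) (ε := ε / 2)) hd
    have hu : {i : N | 0 < μ (ball (i : X) (ε / 2))} = univ :=
      eq_univ_of_forall fun i => hμ.ball_pos _ _ (by positivity)
    rw [hu, countable_univ_iff] at this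
    exact countable_coe_iff.1 this
  · by_contra! h
    have hx : x ∉ N := fun hx => by have := h x hx; simp at this; linarith
    have hins : (insert x N).Pairwise fun x y => ε ≤ dist x y := by
      exact pairwise_insert.2 ⟨hN.prop, fun y hy _ => ⟨(h y hy).le, dist_comm x y ▸ (h y hy).le⟩⟩
    exact hx (hN.le_of_ge hins (subset_insert x N) (mem_insert x N))

theorem IsDoubling.isLocallyFiniteMeasure {X : Type*} [MetricSpace X] [MeasurableSpace X]
    {μ : Measure X} {C₁ n : ℝ} (hμ : IsDoubling μ C₁ n) : IsLocallyFiniteMeasure μ :=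
  ⟨fun x => ⟨ball x 1, ball_mem_nhds x one_pos, hμ.ball_lt_top x 1 one_pos⟩⟩

/-- This opens the way to Lebesgue differentiation. The factor 3 instead of 2 absorbs the passage
from closed to open balls. -/
theorem IsDoubling.isUnifLocDoublingMeasure {X : Type*} [MetricSpace X] [MeasurableSpace X]
    {μ : Measure X} {C₁ n : ℝ} (hμ : IsDoubling μ C₁ n) : IsUnifLocDoublingMeasure μ := by
  refine ⟨(C₁ * 3 ^ n).toNNReal, ?_⟩
  filter_upwards [self_mem_nhdsWithin] with r hr x
  calc μ (closedBall x (2 * r)) ≤ μ (ball x (3 * r)) :=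
        measure_mono (closedBall_subset_ball (by have : 0 < r := hr; linarith))
    _ ≤ _ := hμ.doubling x r 3 hr (by norm_num)
    _ ≤ _ := by
        gcongr
        · rfl
        · exact ball_subset_closedBall

/-! ### Averages over comparable balls -/

section Average

variable {X : Type*} [MetricSpace X] [MeasurableSpace X] {μ : Measure X} {C₁ n : ℝ}

theorem IsDoubling.ball_ne_zero (hμ : IsDoubling μ C₁ n) (x : X) {r : ℝ} (hr : 0 < r) :
    μ (ball x r) ≠ 0 := (hμ.ball_pos x r hr).ne'

theorem IsDoubling.ball_ne_top (hμ : IsDoubling μ C₁ n) (x : X) {r : ℝ} (hr : 0 < r) :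
    μ (ball x r) ≠ ∞ := (hμ.ball_lt_top x r hr).ne

theorem laverage_mono {α : Type*} [MeasurableSpace α] {ν : Measure α} {f g : α → ℝ≥0∞}
    (h : ∀ x, f x ≤ g x) : ⨍⁻ x, f x ∂ν ≤ ⨍⁻ x, g x ∂ν :=
  lintegral_mono h

theorem setLAverage_mono_on {α : Type*} [MeasurableSpace α] {ν : Measure α} {f g : α → ℝ≥0∞}
    {s : Set α} (hs : MeasurableSet s) (h : ∀ x ∈ s, f x ≤ g x) :
    ⨍⁻ x in s, f x ∂ν ≤ ⨍⁻ x in s, g x ∂ν :=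
  laverage_mono_ae ((ae_restrict_iff' hs).2 (Eventually.of_forall h))

theorem laverage_const_mul {α : Type*} [MeasurableSpace α] {ν : Measure α} {f : α → ℝ≥0∞}
    {K : ℝ≥0∞} (hK : K ≠ ∞) : ⨍⁻ x, K * f x ∂ν = K * ⨍⁻ x, f x ∂ν :=
  lintegral_const_mul' _ _ hK

theorem laverage_add_left {α : Type*} [MeasurableSpace α] {ν : Measure α} {f g : α → ℝ≥0∞}
    (hf : Measurable f) : ⨍⁻ x, (f x + g x) ∂ν = ⨍⁻ x, f x ∂ν + ⨍⁻ x, g x ∂ν :=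
  lintegral_add_left hf _

theorem IsDoubling.laverage_ball_const (hμ : IsDoubling μ C₁ n) (x : X) {r : ℝ} (hr : 0 < r)
    (c : ℝ≥0∞) : ⨍⁻ _ in ball x r, c ∂μ = c :=
  setLAverage_const (hμ.ball_ne_zero x hr) (hμ.ball_ne_top x hr) c

/-- The factor by which averages over comparable balls may differ. -/
noncomputable def doublingFactor (C₁ n lam : ℝ) : ℝ≥0∞ := ENNReal.ofReal (C₁ * lam ^ n)

theorem doublingFactor_ne_top (C₁ n lam : ℝ) : doublingFactor C₁ n lam ≠ ∞ := ENNReal.ofReal_ne_top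

theorem IsDoubling.one_le_doublingFactor (hμ : IsDoubling μ C₁ n) {lam : ℝ} (h : 1 ≤ lam) :
    1 ≤ doublingFactor C₁ n lam := by
  rw [doublingFactor, ENNReal.one_le_ofReal]
  exact one_le_mul_of_one_le_of_one_le hμ.one_lt.le (Real.one_le_rpow h hμ.exponent_pos.le)

/-- Averages over a smaller ball are controlled by averages over a comparable larger set. -/
theorem IsDoubling.laverage_le (hμ : IsDoubling μ C₁ n) {x : X} {r lam : ℝ} {s : Set X}
    (hr : 0 < r) (hlam : 1 < lam) (h1 : ball x r ⊆ s) (h2 : s ⊆ ball x (lam * r))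
    (f : X → ℝ≥0∞) :
    ⨍⁻ z in ball x r, f z ∂μ ≤ doublingFactor C₁ n lam * ⨍⁻ z in s, f z ∂μ := by
  rw [setLAverage_eq, setLAverage_eq, ENNReal.div_eq_inv_mul, ENNReal.div_eq_inv_mul, ← mul_assoc]
  have h3 : μ s ≤ doublingFactor C₁ n lam * μ (ball x r) :=
    (measure_mono h2).trans (hμ.doubling x r lam hr hlam)
  have hs0 : μ s ≠ 0 := fun h => hμ.ball_ne_zero x hr (measure_mono_null h1 h)
  have hst : μ s ≠ ∞ := ne_top_of_le_ne_top
    (hμ.ball_ne_top x (mul_pos (one_pos.trans hlam) hr)) (measure_mono h2)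
  gcongr
  rw [← div_eq_mul_inv, ENNReal.le_div_iff_mul_le (Or.inl hs0) (Or.inl hst),
    ← ENNReal.div_eq_inv_mul]
  exact ENNReal.div_le_of_le_mul h3

end Average

/-! ### Measurability of averages in centre and radius -/

section Measurability

variable {X : Type*} [MetricSpace X] [MeasurableSpace X] [BorelSpace X]
  [SecondCountableTopology X] {μ : Measure X} [SFinite μ]
  {α : Type*} [MeasurableSpace α]

/-- The moving ball is a section of one measurable subset of the product, so Tonelli applies to
numerator and denominator. -/
theorem measurable_laverage_ball {c : α → X} {r : α → ℝ} (hc : Measurable c) (hr : Measurable r)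
    {f : α → X → ℝ≥0∞} (hf : Measurable (Function.uncurry f)) :
    Measurable fun a => ⨍⁻ y in ball (c a) (r a), f a y ∂μ := by
  have hset : MeasurableSet {q : α × X | dist q.2 (c q.1) < r q.1} :=
    measurableSet_lt (by fun_prop) (by fun_prop)
  have hint : ∀ g : α → X → ℝ≥0∞, Measurable (Function.uncurry g) →
      Measurable fun a => ∫⁻ y in ball (c a) (r a), g a y ∂μ := by
    intro g hg
    have : (fun a => ∫⁻ y in ball (c a) (r a), g a y ∂μ) = fun a => ∫⁻ y,
        ({q : α × X | dist q.2 (c q.1) < r q.1}.indicator (Function.uncurry g)) (a, y) ∂μ := by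
      funext a
      rw [← lintegral_indicator measurableSet_ball]
      rfl
    rw [this]
    exact (hg.indicator hset).lintegral_prod_right'
  have h1 : Measurable fun a => μ (ball (c a) (r a)) := by
    simpa using hint (fun _ _ => 1) measurable_const
  simp only [setLAverage_eq]
  exact (hint f hf).div h1

end Measurability

/-! ### Powers of sums and series -/

section Elementary

theorem rpow_add_le_two_rpow {e : ℝ} (he : 0 ≤ e) (a b : ℝ≥0∞) :
    (a + b) ^ e ≤ 2 ^ e * (a ^ e + b ^ e) := by
  have : a + b ≤ 2 * max a b := by
    rw [two_mul]; exact add_le_add (le_max_left _ _) (le_max_right _ _)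
  calc (a + b) ^ e ≤ (2 * max a b) ^ e := by gcongr
    _ = 2 ^ e * (max a b) ^ e := ENNReal.mul_rpow_of_nonneg _ _ he
    _ ≤ _ := by
      gcongr
      rcases le_total a b with h | h
      · rw [max_eq_right h]; exact le_add_self
      · rw [max_eq_left h]; exact le_self_add

theorem two_rpow_ne_top (e : ℝ) : (2 : ℝ≥0∞) ^ e ≠ ∞ :=
  ENNReal.rpow_ne_top_of_ne_zero two_ne_zero ENNReal.ofNat_ne_top

theorem two_rpow_add (a b : ℝ) : (2 : ℝ≥0∞) ^ (a + b) = 2 ^ a * 2 ^ b :=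
  ENNReal.rpow_add a b two_ne_zero ENNReal.ofNat_ne_top

theorem tsum_two_rpow_ne_top {δ : ℝ} (hδ : 0 < δ) : ∑' j : ℕ, (2 : ℝ≥0∞) ^ (-(δ * j)) ≠ ∞ := by
  have : ∀ j : ℕ, (2 : ℝ≥0∞) ^ (-(δ * j)) = ((2 : ℝ≥0∞) ^ (-δ)) ^ j := fun j => by
    rw [← ENNReal.rpow_natCast, ← ENNReal.rpow_mul, neg_mul]
  simp only [this, ENNReal.tsum_geometric]
  refine ENNReal.inv_ne_top.2 (tsub_pos_of_lt ?_).ne'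
  exact ENNReal.rpow_lt_one_of_one_lt_of_neg ENNReal.one_lt_two (by linarith)

/-- Powers of series are controlled by the series of powers, at the price of a small geometric
factor. -/
theorem exists_tsum_rpow_le {a δ : ℝ} (ha : 0 < a) (hδ : 0 < δ) :
    ∃ K : ℝ≥0∞, K ≠ ∞ ∧ ∀ f : ℕ → ℝ≥0∞,
      (∑' j, f j) ^ a ≤ K * ∑' j : ℕ, 2 ^ (δ * j) * f j ^ a := by
  refine ⟨(∑' j : ℕ, (2 : ℝ≥0∞) ^ (-(δ / a * j))) ^ a,
    ENNReal.rpow_ne_top_of_nonneg ha.le (tsum_two_rpow_ne_top (by positivity)), fun f => ?_⟩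
  set S := ∑' j : ℕ, (2 : ℝ≥0∞) ^ (δ * j) * f j ^ a with hS
  -- Each term is bounded by the whole sum S; the weight 2^(δj) becomes geometric decay, so
  -- summation costs a constant for a ≤ 1 and a ≥ 1 alike.
  have hj : ∀ j : ℕ, f j ≤ 2 ^ (-(δ / a * j)) * S ^ (1 / a) := fun j => by
    have h1 : 2 ^ (δ * j) * f j ^ a ≤ S := ENNReal.le_tsum j
    have h2 : (2 ^ (δ * j) * f j ^ a) ^ (1 / a) ≤ S ^ (1 / a) := by gcongr
    rw [ENNReal.mul_rpow_of_nonneg _ _ (by positivity), ← ENNReal.rpow_mul, ← ENNReal.rpow_mul,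
      mul_one_div_cancel ha.ne', ENNReal.rpow_one] at h2
    calc f j = 2 ^ (-(δ / a * j)) * (2 ^ (δ * j * (1 / a)) * f j) := by
          rw [← mul_assoc, ← two_rpow_add]
          have : -(δ / a * j) + δ * j * (1 / a) = 0 := by ring
          rw [this, ENNReal.rpow_zero, one_mul]
      _ ≤ _ := by gcongr
  calc (∑' j, f j) ^ a ≤ (∑' j : ℕ, 2 ^ (-(δ / a * j)) * S ^ (1 / a)) ^ a := by
        gcongr; exact hj _
    _ = _ := by
        rw [ENNReal.tsum_mul_right, ENNReal.mul_rpow_of_nonneg _ _ ha.le, ← ENNReal.rpow_mul,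
          one_div_mul_cancel ha.ne', ENNReal.rpow_one]

end Elementary

/-! ### Oscillations, telescoping and Lebesgue points -/

section Oscillation

variable {X : Type*} [MetricSpace X] [MeasurableSpace X]

/-- The average of `|u(x) - u(y)|^σ` over `y ∈ B(x,r)`. -/
noncomputable def pointOsc (σ : ℝ) (μ : Measure X) (u : X → ℝ) (x : X) (r : ℝ) : ℝ≥0∞ :=
  ⨍⁻ y in ball x r, ‖u x - u y‖ₑ ^ σ ∂μ

/-- The average of `|u(y) - u(z)|^σ` over `y, z ∈ B(x,r)`. -/
noncomputable def doubleOsc (σ : ℝ) (μ : Measure X) (u : X → ℝ) (x : X) (r : ℝ) : ℝ≥0∞ :=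
  ⨍⁻ y in ball x r, ⨍⁻ z in ball x r, ‖u y - u z‖ₑ ^ σ ∂μ ∂μ

theorem enorm_sub_rpow_le {σ : ℝ} (h0 : 0 ≤ σ) (a b c : ℝ) :
    ‖a - b‖ₑ ^ σ ≤ 2 ^ σ * (‖a - c‖ₑ ^ σ + ‖c - b‖ₑ ^ σ) := by
  refine le_trans ?_ (rpow_add_le_two_rpow h0 _ _)
  gcongr
  rw [show a - b = (a - c) + (c - b) by ring]
  exact enorm_add_le _ _

/-- Constant one is what lets the telescoping over arbitrarily many scales work without accumulating
factors. -/
theorem enorm_sub_rpow_le_add {σ : ℝ} (h0 : 0 ≤ σ) (h1 : σ ≤ 1) (a b c : ℝ) :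
    ‖a - b‖ₑ ^ σ ≤ ‖a - c‖ₑ ^ σ + ‖c - b‖ₑ ^ σ := by
  refine le_trans ?_ (ENNReal.rpow_add_le_add_rpow _ _ h0 h1)
  gcongr
  rw [show a - b = (a - c) + (c - b) by ring]
  exact enorm_add_le _ _

theorem enorm_sub_comm (a b : ℝ) : ‖a - b‖ₑ = ‖b - a‖ₑ := by
  rw [← enorm_neg, neg_sub]

variable {μ : Measure X} {C₁ n : ℝ} {u : X → ℝ} {σ : ℝ}

section

variable [BorelSpace X] [SecondCountableTopology X] [SFinite μ]

theorem measurable_pointOsc (hu : Measurable u) (σ : ℝ) :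
    Measurable fun q : X × ℝ => pointOsc σ μ u q.1 q.2 :=
  measurable_laverage_ball measurable_fst measurable_snd (by fun_prop)

theorem measurable_doubleOsc (hu : Measurable u) (σ : ℝ) :
    Measurable fun q : X × ℝ => doubleOsc σ μ u q.1 q.2 := by
  refine measurable_laverage_ball (c := Prod.fst) (r := Prod.snd)
    (f := fun (q : X × ℝ) y => ⨍⁻ z in ball q.1 q.2, ‖u y - u z‖ₑ ^ σ ∂μ)
    measurable_fst measurable_snd ?_
  exact measurable_laverage_ball (c := fun q : (X × ℝ) × X => q.1.1)
    (r := fun q : (X × ℝ) × X => q.1.2) (f := fun q z => ‖u q.2 - u z‖ₑ ^ σ)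
    (by fun_prop) (by fun_prop) (by fun_prop)

end

theorem bestConst_le_pointOsc (σ : ℝ) (u : X → ℝ) (x : X) (r : ℝ) :
    bestConst σ μ u r x ≤ pointOsc σ μ u x r := by
  refine (iInf_le _ (u x)).trans (le_of_eq ?_)
  simp only [pointOsc, enorm_sub_comm]

/-- Each value u(y) competes in the infimum; average over y. -/
theorem IsDoubling.bestConst_le_doubleOsc (hμ : IsDoubling μ C₁ n) (σ : ℝ) (u : X → ℝ) (x : X)
    {r : ℝ} (hr : 0 < r) : bestConst σ μ u r x ≤ doubleOsc σ μ u x r := by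
  rw [← hμ.laverage_ball_const x hr (bestConst σ μ u r x)]
  refine laverage_mono fun y => (iInf_le _ (u y)).trans (le_of_eq ?_)
  simp only [enorm_sub_comm]

/-- Insert c between u(y) and u(z). Together with the converse bound this allows the infimum to be
replaced by a manifestly measurable quantity. -/
theorem IsDoubling.doubleOsc_le_bestConst (hμ : IsDoubling μ C₁ n) (hσ : 0 ≤ σ)
    (hu : Measurable u) (x : X) {r : ℝ} (hr : 0 < r) :
    doubleOsc σ μ u x r ≤ 2 ^ (σ + 1) * bestConst σ μ u r x := by
  rw [bestConst, ENNReal.mul_iInf_of_ne (by simp) (two_rpow_ne_top _)]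
  refine le_iInf fun c => ?_
  have hin : ∀ y, ⨍⁻ z in ball x r, ‖u y - u z‖ₑ ^ σ ∂μ ≤
      2 ^ σ * (‖u y - c‖ₑ ^ σ + ⨍⁻ z in ball x r, ‖u z - c‖ₑ ^ σ ∂μ) := fun y => by
    calc ⨍⁻ z in ball x r, ‖u y - u z‖ₑ ^ σ ∂μ
        ≤ ⨍⁻ z in ball x r, 2 ^ σ * (‖u y - c‖ₑ ^ σ + ‖u z - c‖ₑ ^ σ) ∂μ :=
          laverage_mono fun z => by
            rw [enorm_sub_comm (u z) c]; exact enorm_sub_rpow_le hσ _ _ _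
      _ = _ := by
          rw [laverage_const_mul (two_rpow_ne_top _), laverage_add_left measurable_const,
            hμ.laverage_ball_const x hr]
  calc doubleOsc σ μ u x r ≤ ⨍⁻ y in ball x r,
        2 ^ σ * (‖u y - c‖ₑ ^ σ + ⨍⁻ z in ball x r, ‖u z - c‖ₑ ^ σ ∂μ) ∂μ := laverage_mono hin
    _ = 2 ^ (σ + 1) * ⨍⁻ z in ball x r, ‖u z - c‖ₑ ^ σ ∂μ := by
        rw [laverage_const_mul (two_rpow_ne_top _), laverage_add_left (by fun_prop),
          hμ.laverage_ball_const x hr, two_rpow_add, ENNReal.rpow_one, mul_assoc, two_mul]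

/-- The comparison of averages is used once in each variable, hence the square. -/
theorem IsDoubling.doubleOsc_le_doubleOsc (hμ : IsDoubling μ C₁ n) (σ : ℝ) (u : X → ℝ) {x y : X}
    {r R lam : ℝ} (hr : 0 < r) (hlam : 1 < lam) (h1 : ball x r ⊆ ball y R)
    (h2 : ball y R ⊆ ball x (lam * r)) :
    doubleOsc σ μ u x r ≤ doublingFactor C₁ n lam ^ 2 * doubleOsc σ μ u y R := by
  have hK := doublingFactor_ne_top C₁ n lam
  calc doubleOsc σ μ u x r
      ≤ ⨍⁻ y' in ball x r, doublingFactor C₁ n lam *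
          ⨍⁻ z in ball y R, ‖u y' - u z‖ₑ ^ σ ∂μ ∂μ :=
        laverage_mono fun y' => hμ.laverage_le hr hlam h1 h2 _
    _ ≤ doublingFactor C₁ n lam * (doublingFactor C₁ n lam * doubleOsc σ μ u y R) := by
        rw [laverage_const_mul hK]
        gcongr
        exact hμ.laverage_le hr hlam h1 h2 _
    _ = _ := by rw [sq, mul_assoc]

theorem IsDoubling.pointOsc_mono (hμ : IsDoubling μ C₁ n) (σ : ℝ) (u : X → ℝ) (x : X)
    {r lam : ℝ} (hr : 0 < r) (hlam : 1 < lam) :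
    pointOsc σ μ u x r ≤ doublingFactor C₁ n lam * pointOsc σ μ u x (lam * r) :=
  hμ.laverage_le hr hlam (ball_subset_ball (by nlinarith)) Subset.rfl _

/-- One telescoping step: go from u(x) to u(y) through u(z), averaged over z in the half ball. -/
theorem IsDoubling.pointOsc_le_half (hμ : IsDoubling μ C₁ n) (h0 : 0 ≤ σ) (h1 : σ ≤ 1)
    (hu : Measurable u) (x : X) {r : ℝ} (hr : 0 < r) :
    pointOsc σ μ u x r ≤
      pointOsc σ μ u x (r / 2) + doublingFactor C₁ n 2 * doubleOsc σ μ u x r := by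
  calc pointOsc σ μ u x r
      = ⨍⁻ y in ball x r, ⨍⁻ _ in ball x (r / 2), ‖u x - u y‖ₑ ^ σ ∂μ ∂μ := by
        simp only [hμ.laverage_ball_const x (half_pos hr)]; rfl
    _ ≤ ⨍⁻ y in ball x r, (pointOsc σ μ u x (r / 2) +
          doublingFactor C₁ n 2 * ⨍⁻ z in ball x r, ‖u y - u z‖ₑ ^ σ ∂μ) ∂μ := by
        refine laverage_mono fun y => ?_
        calc ⨍⁻ _ in ball x (r / 2), ‖u x - u y‖ₑ ^ σ ∂μ
            ≤ ⨍⁻ z in ball x (r / 2), (‖u x - u z‖ₑ ^ σ + ‖u y - u z‖ₑ ^ σ) ∂μ :=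
              laverage_mono fun z => by
                rw [enorm_sub_comm (u y)]; exact enorm_sub_rpow_le_add h0 h1 _ _ _
          _ ≤ _ := by
              rw [laverage_add_left (by fun_prop)]
              gcongr
              · exact le_rfl
              · exact hμ.laverage_le (half_pos hr) one_lt_two (ball_subset_ball (by linarith))
                  (ball_subset_ball (by linarith)) _
    _ = _ := by
        rw [laverage_add_left measurable_const, hμ.laverage_ball_const x hr,
          laverage_const_mul (doublingFactor_ne_top _ _ _)]; rfl

theorem IsDoubling.pointOsc_le_sum (hμ : IsDoubling μ C₁ n) (h0 : 0 ≤ σ) (h1 : σ ≤ 1)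
    (hu : Measurable u) (x : X) {r : ℝ} (hr : 0 < r) (N : ℕ) :
    pointOsc σ μ u x r ≤ pointOsc σ μ u x (r / 2 ^ N) +
      doublingFactor C₁ n 2 * ∑ j ∈ Finset.range N, doubleOsc σ μ u x (r / 2 ^ j) := by
  induction N with
  | zero => simp
  | succ N ih =>
    refine ih.trans ?_
    have := hμ.pointOsc_le_half h0 h1 hu x (r := r / 2 ^ N) (by positivity)
    rw [Finset.sum_range_succ, mul_add, pow_succ, ← div_div,
      add_comm (doublingFactor C₁ n 2 * _), ← add_assoc]
    gcongr

theorem IsDoubling.locallyIntegrable_abs_sub_rpow (hμ : IsDoubling μ C₁ n) (hσ : 0 < σ)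
    (hloc : MemLpLoc u (ENNReal.ofReal σ) μ) (q : ℝ) :
    LocallyIntegrable (fun y => |u y - q| ^ σ) μ := by
  intro x
  refine ⟨ball x 1, ball_mem_nhds x one_pos, ?_⟩
  have : IsFiniteMeasure (μ.restrict (ball x 1)) :=
    isFiniteMeasure_restrict.2 (hμ.ball_ne_top x one_pos)
  have h := ((hloc x 1 one_pos).sub (memLp_const q)).integrable_norm_rpow
    (by simpa using hσ) ENNReal.ofReal_ne_top
  rw [ENNReal.toReal_ofReal hσ.le] at h
  exact h

/-- Lebesgue's differentiation theorem for `σ`-th powers. -/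
theorem IsDoubling.ae_tendsto_pointOsc [BorelSpace X] (hμ : IsDoubling μ C₁ n) (hσ : 0 < σ)
    (h1 : σ ≤ 1) (hloc : MemLpLoc u (ENNReal.ofReal σ) μ) :
    ∀ᵐ x ∂μ, ∀ r : ℝ, 0 < r →
      Tendsto (fun N : ℕ => pointOsc σ μ u x (r / 2 ^ N)) atTop (𝓝 0) := by
  have := hμ.secondCountableTopology
  have := hμ.isLocallyFiniteMeasure
  have := hμ.isUnifLocDoublingMeasure
  -- For σ < 1 the function u need not be locally integrable, so |u - q|^σ is differentiated, for
  -- all rational q simultaneously.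
  have key := ae_all_iff.2 fun q : ℚ => IsUnifLocDoublingMeasure.ae_tendsto_average μ
    (hμ.locallyIntegrable_abs_sub_rpow hσ hloc q) 1
  filter_upwards [key] with x hx r hr
  set K := doublingFactor C₁ n 2
  have hK : K ≠ ∞ := doublingFactor_ne_top _ _ _
  rw [ENNReal.tendsto_nhds_zero]
  intro ε hε
  have hrN : ∀ N : ℕ, 0 < r / 2 ^ N := fun N => by positivity
  -- The differentiation theorem concerns closed balls; K is the doubling cost of passing to them
  -- from open ones.
  have hbound : ∀ (q : ℚ) (N : ℕ), pointOsc σ μ u x (r / 2 ^ N) ≤ ENNReal.ofReal (|u x - q| ^ σ) +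
      K * ENNReal.ofReal (⨍ y in closedBall x (r / 2 ^ N), |u y - q| ^ σ ∂μ) := by
    intro q N
    have hint : IntegrableOn (fun y => |u y - q| ^ σ) (closedBall x (r / 2 ^ N)) μ := by
      have hs : closedBall x (r / 2 ^ N) ⊆ ball x (r / 2 ^ N + 1) :=
        closedBall_subset_ball (by linarith)
      refine IntegrableOn.mono_set ?_ hs
      have : IsFiniteMeasure (μ.restrict (ball x (r / 2 ^ N + 1))) :=
        isFiniteMeasure_restrict.2 (hμ.ball_ne_top x (by have := hrN N; linarith))
      have h := ((hloc x (r / 2 ^ N + 1) (by have := hrN N; linarith)).sub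
        (memLp_const (q : ℝ))).integrable_norm_rpow (by simpa using hσ) ENNReal.ofReal_ne_top
      rw [ENNReal.toReal_ofReal hσ.le] at h
      exact h
    have he : ∀ a : ℝ, ENNReal.ofReal (|a| ^ σ) = ‖a‖ₑ ^ σ := fun a => by
      rw [← ENNReal.ofReal_rpow_of_nonneg (abs_nonneg a) hσ.le, ← Real.norm_eq_abs,
        ofReal_norm]
    rw [ofReal_setAverage hint (Eventually.of_forall fun y => by positivity)]
    calc pointOsc σ μ u x (r / 2 ^ N)
        ≤ ⨍⁻ y in ball x (r / 2 ^ N), (‖u x - q‖ₑ ^ σ + ‖u y - q‖ₑ ^ σ) ∂μ :=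
          laverage_mono fun y => by
            rw [enorm_sub_comm (u y)]; exact enorm_sub_rpow_le_add hσ.le h1 _ _ _
      _ = ‖u x - q‖ₑ ^ σ + ⨍⁻ y in ball x (r / 2 ^ N), ‖u y - q‖ₑ ^ σ ∂μ := by
          rw [laverage_add_left measurable_const, hμ.laverage_ball_const x (hrN N)]
      _ ≤ _ := by
          have := hμ.laverage_le (hrN N) one_lt_two (s := closedBall x (r / 2 ^ N))
            ball_subset_closedBall (closedBall_subset_ball (by linarith [hrN N]))
            (fun y => ‖u y - q‖ₑ ^ σ)
          rw [setLAverage_eq] at this ⊢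
          simp only [he]
          gcongr
          rw [setLAverage_eq] at this
          exact this
  -- The bound above tends to (1 + K)|u(x) - q|^σ, which is below ε for q close to u(x).
  obtain ⟨q, hq⟩ : ∃ q : ℚ, ENNReal.ofReal (|u x - q| ^ σ) +
      K * ENNReal.ofReal (|u x - q| ^ σ) < ε := by
    have hc : Tendsto (fun y : ℝ => ENNReal.ofReal (|u x - y| ^ σ) +
        K * ENNReal.ofReal (|u x - y| ^ σ)) (𝓝 (u x)) (𝓝 (0 + K * 0)) := by
      have h0 : Tendsto (fun y : ℝ => ENNReal.ofReal (|u x - y| ^ σ)) (𝓝 (u x)) (𝓝 0) := by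
        have : Continuous fun y : ℝ => ENNReal.ofReal (|u x - y| ^ σ) :=
          ENNReal.continuous_ofReal.comp
            ((continuous_abs.comp (continuous_const.sub continuous_id)).rpow_const
              fun _ => Or.inr hσ.le)
        simpa [hσ.ne'] using this.tendsto (u x)
      exact h0.add (ENNReal.Tendsto.const_mul h0 (Or.inr hK))
    simp only [mul_zero, add_zero] at hc
    have hev := hc.eventually_lt_const hε
    obtain ⟨y, hy⟩ := Rat.denseRange_cast.exists_mem_open
      (isOpen_interior (s := {y : ℝ | ENNReal.ofReal (|u x - y| ^ σ) +
        K * ENNReal.ofReal (|u x - y| ^ σ) < ε})) ⟨u x, mem_interior_iff_mem_nhds.2 hev⟩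
    exact ⟨y, (interior_subset hy :)⟩
  have hlim := hx q (l := atTop) (fun _ : ℕ => x) (fun N => r / 2 ^ N)
    (tendsto_nhdsWithin_iff.2 ⟨by
      simpa [div_eq_mul_inv] using (tendsto_inv_atTop_zero.comp
        (tendsto_pow_atTop_atTop_of_one_lt (one_lt_two (α := ℝ)))).const_mul r,
      Eventually.of_forall fun N => hrN N⟩)
    (Eventually.of_forall fun N => by
      rw [one_mul]; exact mem_closedBall_self (hrN N).le)
  have hlim2 : Tendsto (fun N : ℕ => ENNReal.ofReal (|u x - q| ^ σ) +
      K * ENNReal.ofReal (⨍ y in closedBall x (r / 2 ^ N), |u y - q| ^ σ ∂μ)) atTop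
      (𝓝 (ENNReal.ofReal (|u x - q| ^ σ) + K * ENNReal.ofReal (|u x - q| ^ σ))) :=
    tendsto_const_nhds.add (ENNReal.Tendsto.const_mul
      ((ENNReal.continuous_ofReal.tendsto _).comp hlim) (Or.inr hK))
  filter_upwards [hlim2.eventually_lt_const hq] with N hN
  exact (hbound q N).trans hN.le

theorem IsDoubling.ae_pointOsc_le_tsum [BorelSpace X] (hμ : IsDoubling μ C₁ n) (hσ : 0 < σ)
    (h1 : σ ≤ 1) (hu : Measurable u) (hloc : MemLpLoc u (ENNReal.ofReal σ) μ) :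
    ∀ᵐ x ∂μ, ∀ r : ℝ, 0 < r →
      pointOsc σ μ u x r ≤ doublingFactor C₁ n 2 * ∑' j : ℕ, doubleOsc σ μ u x (r / 2 ^ j) := by
  filter_upwards [hμ.ae_tendsto_pointOsc hσ h1 hloc] with x hx r hr
  have h2 : Tendsto (fun N : ℕ => pointOsc σ μ u x (r / 2 ^ N) +
      doublingFactor C₁ n 2 * ∑' j : ℕ, doubleOsc σ μ u x (r / 2 ^ j)) atTop
      (𝓝 (0 + doublingFactor C₁ n 2 * ∑' j : ℕ, doubleOsc σ μ u x (r / 2 ^ j))) :=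
    (hx r hr).add tendsto_const_nhds
  rw [zero_add] at h2
  refine ge_of_tendsto' h2 fun N => (hμ.pointOsc_le_sum hσ.le h1 hu x hr N).trans ?_
  gcongr
  exact ENNReal.sum_le_tsum _

/-- Average the triangle inequality through u(z) over z in B(x,t); the factor comes from B(x,t) ⊂
B(y,2t) ⊂ B(x,3t). -/
theorem IsDoubling.enorm_sub_rpow_le_pointOsc (hμ : IsDoubling μ C₁ n) (h0 : 0 ≤ σ) (h1 : σ ≤ 1)
    (hu : Measurable u) {x y : X} {t : ℝ} (hxy : dist x y < t) :
    ‖u x - u y‖ₑ ^ σ ≤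
      pointOsc σ μ u x t + doublingFactor C₁ n 3 * pointOsc σ μ u y (2 * t) := by
  have ht : 0 < t := dist_nonneg.trans_lt hxy
  rw [← hμ.laverage_ball_const x ht (‖u x - u y‖ₑ ^ σ)]
  calc ⨍⁻ _ in ball x t, ‖u x - u y‖ₑ ^ σ ∂μ
      ≤ ⨍⁻ z in ball x t, (‖u x - u z‖ₑ ^ σ + ‖u y - u z‖ₑ ^ σ) ∂μ :=
        laverage_mono fun z => by
          rw [enorm_sub_comm (u y)]; exact enorm_sub_rpow_le_add h0 h1 _ _ _
    _ ≤ _ := by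
        rw [laverage_add_left (by fun_prop)]
        gcongr
        · exact le_rfl
        · exact hμ.laverage_le ht (by norm_num) (ball_subset_ball' (by linarith))
            (ball_subset_ball' (by rw [dist_comm]; linarith)) _

end Oscillation

/-! ### Averaging on L¹ and Hardy's inequality in the scale -/

section Norms

variable {X : Type*} [MetricSpace X] [MeasurableSpace X] {μ : Measure X} {C₁ n : ℝ}

/-- By Tonelli, G(z) is multiplied by ∫_{B(z,t)} μ(B(x,t))⁻¹ dμ(x), and μ(B(x,t)) is comparable to
μ(B(z,t)) there. -/
theorem IsDoubling.lintegral_laverage_le [BorelSpace X] (hμ : IsDoubling μ C₁ n) {t : ℝ}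
    (ht : 0 < t) {G : X → ℝ≥0∞} (hG : Measurable G) :
    ∫⁻ x, ⨍⁻ z in ball x t, G z ∂μ ∂μ ≤ doublingFactor C₁ n 2 * ∫⁻ x, G x ∂μ := by
  have := hμ.secondCountableTopology
  have := hμ.sigmaFinite
  have hm : Measurable fun x => (μ (ball x t))⁻¹ := by
    have hset : MeasurableSet {q : X × X | dist q.2 q.1 < t} :=
      measurableSet_lt (by fun_prop) (by fun_prop)
    exact (measurable_measure_prodMk_left (ν := μ) hset).inv
  have hset : MeasurableSet {q : X × X | dist q.2 q.1 < t} :=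
    measurableSet_lt (by fun_prop) (by fun_prop)
  have hswap : ∫⁻ x, ⨍⁻ z in ball x t, G z ∂μ ∂μ =
      ∫⁻ z, ∫⁻ x in ball z t, (μ (ball x t))⁻¹ * G z ∂μ ∂μ := by
    have e1 : ∀ x, ⨍⁻ z in ball x t, G z ∂μ = ∫⁻ z,
        {q : X × X | dist q.2 q.1 < t}.indicator (fun q => (μ (ball q.1 t))⁻¹ * G q.2) (x, z) ∂μ := by
      intro x
      rw [setLAverage_eq, ENNReal.div_eq_inv_mul, ← lintegral_const_mul _ hG,
        ← lintegral_indicator measurableSet_ball]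
      rfl
    simp_rw [e1]
    rw [lintegral_lintegral_swap]
    · refine lintegral_congr fun z => ?_
      rw [← lintegral_indicator measurableSet_ball]
      refine lintegral_congr fun x => ?_
      simp only [indicator, mem_ofPred_eq, mem_ball, dist_comm]
    · exact (((hm.comp measurable_fst).mul (hG.comp measurable_snd)).indicator hset).aemeasurable
  rw [hswap, ← lintegral_const_mul _ hG]
  refine lintegral_mono fun z => ?_
  have hz : ∀ x ∈ ball z t,
      (μ (ball x t))⁻¹ * G z ≤ doublingFactor C₁ n 2 * (μ (ball z t))⁻¹ * G z := by
    intro x hx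
    gcongr
    have h1 : μ (ball z t) ≤ doublingFactor C₁ n 2 * μ (ball x t) :=
      (measure_mono (ball_subset_ball' (by rw [dist_comm]; linarith [mem_ball.1 hx]))).trans
        (hμ.doubling x t 2 ht one_lt_two)
    rw [← div_eq_mul_inv, ENNReal.le_div_iff_mul_le (Or.inl (hμ.ball_ne_zero z ht))
      (Or.inl (hμ.ball_ne_top z ht)), ← ENNReal.div_eq_inv_mul]
    exact ENNReal.div_le_of_le_mul h1
  refine (setLIntegral_mono measurable_const hz).trans (le_of_eq ?_)
  rw [lintegral_const, Measure.restrict_apply_univ, mul_right_comm, mul_assoc _ (μ (ball z t))⁻¹,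
    ENNReal.inv_mul_cancel (hμ.ball_ne_zero z ht) (hμ.ball_ne_top z ht), mul_one]

/-- The quasi-norm `(∫_0^∞ φ(t)^q dt/t)^{1/q}`. -/
noncomputable def scaleNorm (q : ℝ≥0∞) (φ : ℝ → ℝ≥0∞) : ℝ≥0∞ :=
  if q = ∞ then ⨆ t ∈ Ioi (0 : ℝ), φ t
  else (∫⁻ t in Ioi (0 : ℝ), φ t ^ q.toReal * ENNReal.ofReal t⁻¹) ^ (1 / q.toReal)

theorem scaleNorm_mono {q : ℝ≥0∞} {φ ψ : ℝ → ℝ≥0∞} (h : ∀ t, 0 < t → φ t ≤ ψ t) :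
    scaleNorm q φ ≤ scaleNorm q ψ := by
  unfold scaleNorm
  split_ifs
  · exact iSup₂_mono h
  · gcongr ?_ ^ _
    refine lintegral_mono_ae ((ae_restrict_iff' measurableSet_Ioi).2
      (Eventually.of_forall fun t ht => ?_))
    gcongr
    exact h t ht

/-- Dilation invariance of dt/t; multiplication by c is a measurable equivalence, so f may be
arbitrary. -/
theorem setLIntegral_Ioi_comp_mul_inv {f : ℝ → ℝ≥0∞} {c : ℝ} (hc : 0 < c) :
    ∫⁻ t in Ioi (0 : ℝ), f (c * t) * ENNReal.ofReal t⁻¹ =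
      ∫⁻ t in Ioi (0 : ℝ), f t * ENNReal.ofReal t⁻¹ := by
  have h1 := (MeasurableEquiv.mulLeft₀ c hc.ne').measurableEmbedding
  have h2 := h1.lintegral_map (μ := volume)
    ((Ioi (0 : ℝ)).indicator fun t => f t * ENNReal.ofReal t⁻¹)
  rw [MeasurableEquiv.coe_mulLeft₀, Real.map_volume_mul_left hc.ne', lintegral_smul_measure,
    lintegral_indicator measurableSet_Ioi] at h2
  have h3 : ∀ t, (Ioi (0 : ℝ)).indicator (fun t => f t * ENNReal.ofReal t⁻¹) (c * t) =
      ENNReal.ofReal c⁻¹ * (Ioi (0 : ℝ)).indicator (fun t => f (c * t) * ENNReal.ofReal t⁻¹) t := by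
    intro t
    by_cases ht : 0 < t
    · have : 0 < c * t := mul_pos hc ht
      rw [indicator_of_mem (by exact this), indicator_of_mem (by exact ht), mul_inv,
        ENNReal.ofReal_mul (inv_pos.2 hc).le]
      ring
    · have : ¬ 0 < c * t := fun h => ht (pos_of_mul_pos_right h hc.le)
      rw [indicator_of_notMem (by exact this), indicator_of_notMem (by exact ht), mul_zero]
  simp_rw [h3] at h2
  rw [lintegral_const_mul' _ _ ENNReal.ofReal_ne_top, lintegral_indicator measurableSet_Ioi,
    abs_of_pos (inv_pos.2 hc), smul_eq_mul] at h2
  exact ((ENNReal.mul_right_inj (by simpa using hc) ENNReal.ofReal_ne_top).1 h2).symm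

/-- A discrete Hardy inequality. -/
theorem exists_scaleNorm_le {q : ℝ≥0∞} (hq : 0 < q) {a η c : ℝ} (ha : 0 < a) (hη : 0 < η)
    (hc : 0 < c) {K : ℝ≥0∞} (hK : K ≠ ∞) :
    ∃ K' : ℝ≥0∞, K' ≠ ∞ ∧ ∀ φ ψ : ℝ → ℝ≥0∞, Measurable ψ →
      (∀ t, 0 < t → φ t ^ a ≤ K * ∑' j : ℕ, 2 ^ (-(η * j)) * ψ (c * t / 2 ^ j) ^ a) →
      scaleNorm q φ ≤ K' * scaleNorm q ψ := by
  by_cases hqt : q = ∞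
  · refine ⟨(K * ∑' j : ℕ, (2 : ℝ≥0∞) ^ (-(η * j))) ^ (1 / a),
      ENNReal.rpow_ne_top_of_nonneg (by positivity)
        (ENNReal.mul_ne_top hK (tsum_two_rpow_ne_top hη)), fun φ ψ _ h => ?_⟩
    simp only [scaleNorm, hqt, if_true]
    refine iSup₂_le fun t ht => ?_
    set S := ⨆ t ∈ Ioi (0 : ℝ), ψ t
    have h1 : φ t ^ a ≤ (K * ∑' j : ℕ, (2 : ℝ≥0∞) ^ (-(η * j))) * S ^ a := by
      refine (h t ht).trans ?_
      rw [mul_assoc, ← ENNReal.tsum_mul_right]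
      gcongr with j
      exact le_iSup₂ (f := fun t (_ : t ∈ Ioi (0 : ℝ)) => ψ t) (c * t / 2 ^ j)
        (by have : 0 < t := ht; exact mem_Ioi.2 (by positivity))
    calc φ t = (φ t ^ a) ^ (1 / a) := by
          rw [← ENNReal.rpow_mul, mul_one_div_cancel ha.ne', ENNReal.rpow_one]
      _ ≤ ((K * ∑' j : ℕ, (2 : ℝ≥0∞) ^ (-(η * j))) * S ^ a) ^ (1 / a) := by gcongr
      _ = _ := by
          rw [ENNReal.mul_rpow_of_nonneg _ _ (by positivity), ← ENNReal.rpow_mul,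
            mul_one_div_cancel ha.ne', ENNReal.rpow_one]
  · have hq' : 0 < q.toReal := ENNReal.toReal_pos hq.ne' hqt
    set b := q.toReal with hb
    have hba : 0 < b / a := by positivity
    -- Half of the decay 2^(-η(b/a)j) pays for moving the power b/a inside the series; the other
    -- half makes the series T converge.
    obtain ⟨M, hM, hM2⟩ := exists_tsum_rpow_le (a := b / a) (δ := η * (b / a) / 2) hba
      (by positivity)
    set T := ∑' j : ℕ, (2 : ℝ≥0∞) ^ (-(η * (b / a) / 2 * j))
    have hT : T ≠ ∞ := tsum_two_rpow_ne_top (by positivity)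
    have hKb : K ^ (b / a) ≠ ∞ := ENNReal.rpow_ne_top_of_nonneg hba.le hK
    refine ⟨(K ^ (b / a) * M * T) ^ (1 / b), ENNReal.rpow_ne_top_of_nonneg (by positivity)
        (ENNReal.mul_ne_top (ENNReal.mul_ne_top hKb hM) hT), fun φ ψ hψ h => ?_⟩
    simp only [scaleNorm, hqt, if_false]
    rw [← ENNReal.mul_rpow_of_nonneg _ _ (by positivity)]
    gcongr ?_ ^ _
    have hpt : ∀ t ∈ Ioi (0 : ℝ), φ t ^ b * ENNReal.ofReal t⁻¹ ≤ (K ^ (b / a) * M) *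
        ∑' j : ℕ, 2 ^ (-(η * (b / a) / 2 * j)) * (ψ (c / 2 ^ j * t) ^ b * ENNReal.ofReal t⁻¹) := by
      intro t ht
      calc φ t ^ b * ENNReal.ofReal t⁻¹ = (φ t ^ a) ^ (b / a) * ENNReal.ofReal t⁻¹ := by
            rw [← ENNReal.rpow_mul, mul_div_cancel₀ _ ha.ne']
        _ ≤ (K * ∑' j : ℕ, 2 ^ (-(η * j)) * ψ (c * t / 2 ^ j) ^ a) ^ (b / a) *
            ENNReal.ofReal t⁻¹ := by gcongr; exact h t ht
        _ ≤ (K ^ (b / a) * (M * ∑' j : ℕ, 2 ^ (η * (b / a) / 2 * j) *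
            (2 ^ (-(η * j)) * ψ (c * t / 2 ^ j) ^ a) ^ (b / a))) * ENNReal.ofReal t⁻¹ := by
            rw [ENNReal.mul_rpow_of_nonneg _ _ hba.le]
            gcongr
            exact hM2 _
        _ = _ := by
            rw [← mul_assoc, mul_assoc _ _ (ENNReal.ofReal t⁻¹), ← ENNReal.tsum_mul_right]
            congr 1
            refine tsum_congr fun j => ?_
            rw [ENNReal.mul_rpow_of_nonneg _ _ hba.le, ← ENNReal.rpow_mul, ← ENNReal.rpow_mul,
              mul_div_cancel₀ _ ha.ne', ← mul_assoc, ← mul_assoc, ← two_rpow_add,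
              div_mul_eq_mul_div c]
            congr 3
            ring
    calc ∫⁻ t in Ioi (0 : ℝ), φ t ^ b * ENNReal.ofReal t⁻¹
        ≤ ∫⁻ t in Ioi (0 : ℝ), (K ^ (b / a) * M) * ∑' j : ℕ, 2 ^ (-(η * (b / a) / 2 * j)) *
            (ψ (c / 2 ^ j * t) ^ b * ENNReal.ofReal t⁻¹) :=
          lintegral_mono_ae ((ae_restrict_iff' measurableSet_Ioi).2 (Eventually.of_forall hpt))
      _ = _ := by
          rw [lintegral_const_mul' _ _ (ENNReal.mul_ne_top hKb hM), lintegral_tsum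
            (fun j => by fun_prop), mul_assoc (K ^ (b / a) * M), ← ENNReal.tsum_mul_right]
          congr 1
          refine tsum_congr fun j => ?_
          rw [lintegral_const_mul' _ _ (two_rpow_ne_top _),
            setLIntegral_Ioi_comp_mul_inv (f := fun t => ψ t ^ b) (by positivity)]

end Norms

/-! ### L^p quasi-norms of series for all p -/

section LpNorms

variable {X : Type*} [MeasurableSpace X] {μ : Measure X}

theorem eLpNorm_eq_lintegral {p : ℝ≥0∞} (hp : p ≠ 0) (hpt : p ≠ ∞) (f : X → ℝ≥0∞) :
    eLpNorm f p μ = (∫⁻ x, f x ^ p.toReal ∂μ) ^ (1 / p.toReal) := by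
  rw [eLpNorm_eq_lintegral_rpow_enorm_toReal hp hpt]; rfl

theorem eLpNorm_rpow_eq_lintegral {p : ℝ≥0∞} (hp : p ≠ 0) (hpt : p ≠ ∞) (f : X → ℝ≥0∞) :
    eLpNorm f p μ ^ p.toReal = ∫⁻ x, f x ^ p.toReal ∂μ := by
  have : 0 < p.toReal := ENNReal.toReal_pos hp hpt
  rw [eLpNorm_eq_lintegral hp hpt, ← ENNReal.rpow_mul, one_div_mul_cancel this.ne',
    ENNReal.rpow_one]

theorem eLpNorm_le_of_ae_le {p : ℝ≥0∞} {f g : X → ℝ≥0∞} (h : ∀ᵐ x ∂μ, f x ≤ g x) :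
    eLpNorm f p μ ≤ eLpNorm g p μ :=
  eLpNorm_mono_enorm_ae h

theorem eLpNorm_const_mul_ennreal {p : ℝ≥0∞} (hp : p ≠ 0) {K : ℝ≥0∞} (hK : K ≠ ∞)
    (f : X → ℝ≥0∞) : eLpNorm (fun x => K * f x) p μ = K * eLpNorm f p μ := by
  by_cases hpt : p = ∞
  · subst hpt
    simp only [eLpNorm_exponent_top, eLpNormEssSup, enorm_eq_self]
    exact ENNReal.essSup_const_mul
  · have hp' : 0 < p.toReal := ENNReal.toReal_pos hp hpt
    rw [eLpNorm_eq_lintegral hp hpt, eLpNorm_eq_lintegral hp hpt]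
    simp_rw [ENNReal.mul_rpow_of_nonneg _ _ hp'.le]
    rw [lintegral_const_mul' _ _ (ENNReal.rpow_ne_top_of_nonneg hp'.le hK),
      ENNReal.mul_rpow_of_nonneg _ _ (by positivity), ← ENNReal.rpow_mul,
      mul_one_div_cancel hp'.ne', ENNReal.rpow_one]

/-- A substitute for the triangle inequality valid for all exponents `p`. -/
theorem exists_eLpNorm_tsum_le (X : Type*) [MeasurableSpace X] {p : ℝ≥0∞} (hp : p ≠ 0) :
    ∃ a : ℝ, 0 < a ∧ ∀ δ : ℝ, 0 < δ → ∃ K : ℝ≥0∞, K ≠ ∞ ∧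
      ∀ (μ : Measure X) (f : ℕ → X → ℝ≥0∞), (∀ j, Measurable (f j)) →
        eLpNorm (fun x => ∑' j, f j x) p μ ^ a ≤
          K * ∑' j : ℕ, 2 ^ (δ * j) * eLpNorm (f j) p μ ^ a := by
  by_cases hpt : p = ∞
  -- For p = ∞ plain countable subadditivity suffices, and the weights 2^(δj) ≥ 1 only help.
  · refine ⟨1, one_pos, fun δ hδ => ⟨1, ENNReal.one_ne_top, fun μ f hf => ?_⟩⟩
    subst hpt
    simp only [eLpNorm_exponent_top, eLpNormEssSup, enorm_eq_self, ENNReal.rpow_one, one_mul]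
    have h1 : ∀ᵐ x ∂μ, ∀ j, f j x ≤ essSup (f j) μ :=
      ae_all_iff.2 fun j => ENNReal.ae_le_essSup (f j)
    refine essSup_le_of_ae_le _ ?_
    filter_upwards [h1] with x hx
    refine ENNReal.tsum_le_tsum fun j => (hx j).trans ?_
    refine le_mul_of_one_le_left zero_le ?_
    rw [← ENNReal.rpow_zero (x := 2)]
    exact ENNReal.rpow_le_rpow_of_exponent_le (by norm_num) (by positivity)
  · have hp' : 0 < p.toReal := ENNReal.toReal_pos hp hpt
    -- With a = p the weighted series bound holds pointwise and can be integrated term by term, with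
    -- no distinction between p < 1 and p ≥ 1.
    refine ⟨p.toReal, hp', fun δ hδ => ?_⟩
    obtain ⟨K, hK, h⟩ := exists_tsum_rpow_le hp' hδ
    refine ⟨K, hK, fun μ f hf => ?_⟩
    simp only [eLpNorm_rpow_eq_lintegral hp hpt]
    calc ∫⁻ x, (∑' j, f j x) ^ p.toReal ∂μ
        ≤ ∫⁻ x, K * ∑' j : ℕ, 2 ^ (δ * j) * f j x ^ p.toReal ∂μ := lintegral_mono fun x => h _
      _ = _ := by
          rw [lintegral_const_mul' _ _ hK, lintegral_tsum (fun j => by fun_prop)]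
          simp_rw [lintegral_const_mul' _ _ (two_rpow_ne_top _)]

/-- For p = ∞, the essential supremum exceeds c exactly when {f(·,t) > c} has positive measure, a
measurable condition on t. -/
theorem measurable_eLpNorm_right [SFinite μ] {p : ℝ≥0∞} {f : X × ℝ → ℝ≥0∞}
    (hf : Measurable f) : Measurable fun t => eLpNorm (fun x => f (x, t)) p μ := by
  by_cases hp : p = 0
  · simp [hp]
  by_cases hpt : p = ∞
  · subst hpt
    simp only [eLpNorm_exponent_top, eLpNormEssSup, enorm_eq_self]
    refine measurable_of_Ioi fun c => ?_
    have : (fun t => essSup (fun x => f (x, t)) μ) ⁻¹' Ioi c =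
        {t | 0 < μ {x | c < f (x, t)}} := by
      ext t
      simp only [mem_preimage, mem_Ioi, mem_ofPred_eq, pos_iff_ne_zero]
      rw [← not_le, not_iff_comm, not_not]
      constructor
      · intro h
        refine essSup_le_of_ae_le _ ?_
        rw [EventuallyLE, ae_iff]
        simpa using h
      · intro h
        have := ENNReal.ae_le_essSup (μ := μ) fun x => f (x, t)
        have h2 : ∀ᵐ x ∂μ, f (x, t) ≤ c := this.mono fun x hx => hx.trans h
        simpa [ae_iff] using h2
    rw [this]
    have hs : MeasurableSet {q : X × ℝ | c < f q} := measurableSet_lt measurable_const hf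
    exact measurableSet_lt measurable_const (measurable_measure_prodMk_right hs)
  · simp only [eLpNorm_eq_lintegral hp hpt]
    exact (Measurable.lintegral_prod_left' (f := fun q : X × ℝ => f q ^ p.toReal)
      (hf.pow_const _)).pow_const _

end LpNorms

/-! ### From oscillations to differences and to the functional S -/

section Core

variable {X : Type*} [MetricSpace X] [MeasurableSpace X] {μ : Measure X} {C₁ n : ℝ}

theorem rpow_rpow_div {x : ℝ≥0∞} {σ τ : ℝ} (hσ : 0 < σ) : (x ^ σ) ^ (τ / σ) = x ^ τ := by
  rw [← ENNReal.rpow_mul, mul_div_cancel₀ _ hσ.ne']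

/-- The inequality of order σ ≤ 1 is raised to the power τ/σ, so oscillations of small order control
every power of the differences. -/
theorem IsDoubling.exists_enorm_sub_rpow_le (hμ : IsDoubling μ C₁ n) {σ τ : ℝ} (hσ : 0 < σ)
    (h1 : σ ≤ 1) (hτ : 0 ≤ τ) :
    ∃ K : ℝ≥0∞, K ≠ ∞ ∧ ∀ u : X → ℝ, Measurable u → ∀ (x y : X) (t : ℝ), dist x y < t →
      ‖u x - u y‖ₑ ^ τ ≤
        K * (pointOsc σ μ u x (2 * t) ^ (τ / σ) + pointOsc σ μ u y (2 * t) ^ (τ / σ)) := by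
  have he : 0 ≤ τ / σ := by positivity
  set L := doublingFactor C₁ n 2 + doublingFactor C₁ n 3
  have hL : L ≠ ∞ :=
    ENNReal.add_ne_top.2 ⟨doublingFactor_ne_top _ _ _, doublingFactor_ne_top _ _ _⟩
  refine ⟨L ^ (τ / σ) * 2 ^ (τ / σ), ENNReal.mul_ne_top (ENNReal.rpow_ne_top_of_nonneg he hL)
    (two_rpow_ne_top _), fun u hu x y t hxy => ?_⟩
  have ht : 0 < t := dist_nonneg.trans_lt hxy
  have h : ‖u x - u y‖ₑ ^ σ ≤ L * (pointOsc σ μ u x (2 * t) + pointOsc σ μ u y (2 * t)) := by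
    refine (hμ.enorm_sub_rpow_le_pointOsc hσ.le h1 hu hxy).trans ?_
    rw [mul_add]
    gcongr
    · exact (hμ.pointOsc_mono σ u x ht one_lt_two).trans (by gcongr; exact le_self_add)
    · exact le_add_self
  calc ‖u x - u y‖ₑ ^ τ = (‖u x - u y‖ₑ ^ σ) ^ (τ / σ) := (rpow_rpow_div hσ).symm
    _ ≤ (L * (pointOsc σ μ u x (2 * t) + pointOsc σ μ u y (2 * t))) ^ (τ / σ) := by gcongr
    _ ≤ _ := by
        rw [ENNReal.mul_rpow_of_nonneg _ _ he, mul_assoc]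
        gcongr
        exact rpow_add_le_two_rpow he _ _

/-- Since t^(-s) = c^s 2^(-sj) (ct/2^j)^(-s), the weight contributes decay 2^(-saj), which beats the
growth 2^(θj). All later restrictions on parameters come from θ < sa. -/
theorem exists_scaleNorm_weighted_le {q : ℝ≥0∞} (hq : 0 < q) {a s θ c : ℝ} (ha : 0 < a)
    (hθ : θ < s * a) (hc : 0 < c) {K : ℝ≥0∞} (hK : K ≠ ∞) :
    ∃ K' : ℝ≥0∞, K' ≠ ∞ ∧ ∀ φ ψ : ℝ → ℝ≥0∞, Measurable ψ →
      (∀ t, 0 < t → φ t ^ a ≤ K * ∑' j : ℕ, 2 ^ (θ * j) * ψ (c * t / 2 ^ j) ^ a) →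
      scaleNorm q (fun t => ENNReal.ofReal (t ^ (-s)) * φ t) ≤
        K' * scaleNorm q (fun t => ENNReal.ofReal (t ^ (-s)) * ψ t) := by
  obtain ⟨K', hK', h⟩ := exists_scaleNorm_le hq (η := s * a - θ) ha (sub_pos.2 hθ) hc
    (K := K * ENNReal.ofReal (c ^ s) ^ a) (ENNReal.mul_ne_top hK
      (ENNReal.rpow_ne_top_of_nonneg ha.le ENNReal.ofReal_ne_top))
  refine ⟨K', hK', fun φ ψ hψ hφ => h _ _ (by fun_prop) fun t ht => ?_⟩
  have hj : ∀ j : ℕ, ENNReal.ofReal (t ^ (-s)) = ENNReal.ofReal (c ^ s) *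
      (2 ^ (-(s * j)) * ENNReal.ofReal ((c * t / 2 ^ j) ^ (-s))) := by
    intro j
    have e2 : (2 : ℝ≥0∞) ^ (-(s * j)) = ENNReal.ofReal ((2 : ℝ) ^ (-(s * j))) := by
      rw [← ENNReal.ofReal_rpow_of_pos two_pos]; simp
    rw [e2, ← ENNReal.ofReal_mul (by positivity), ← ENNReal.ofReal_mul (by positivity)]
    congr 1
    rw [Real.div_rpow (by positivity) (by positivity), Real.mul_rpow hc.le ht.le,
      ← Real.rpow_natCast, ← Real.rpow_mul zero_le_two, Real.rpow_neg hc.le,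
      show (j : ℝ) * -s = -(s * j) by ring]
    have h1 := (Real.rpow_pos_of_pos hc s).ne'
    have h2 := (Real.rpow_pos_of_pos two_pos (-(s * j))).ne'
    field_simp
  calc (ENNReal.ofReal (t ^ (-s)) * φ t) ^ a
      ≤ ENNReal.ofReal (t ^ (-s)) ^ a *
        (K * ∑' j : ℕ, 2 ^ (θ * j) * ψ (c * t / 2 ^ j) ^ a) := by
        rw [ENNReal.mul_rpow_of_nonneg _ _ ha.le]
        gcongr
        exact hφ t ht
    _ = _ := by
        simp_rw [← ENNReal.tsum_mul_left]
        refine tsum_congr fun j => ?_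
        rw [hj j, ENNReal.mul_rpow_of_nonneg _ _ ha.le, ENNReal.mul_rpow_of_nonneg _ _ ha.le,
          ENNReal.mul_rpow_of_nonneg _ _ ha.le, ← ENNReal.rpow_mul,
          show -((s * a - θ) * j) = -(s * j) * a + θ * (j : ℝ) by ring, two_rpow_add]
        ring

/-- The `L^p` quasi-norm of the oscillation at scale `t`. -/
noncomputable def oscNorm (σ : ℝ) (p : ℝ≥0∞) (μ : Measure X) (u : X → ℝ) (t : ℝ) : ℝ≥0∞ :=
  eLpNorm (fun x => doubleOsc σ μ u x t ^ (1 / σ)) p μ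

theorem measurable_oscNorm [BorelSpace X] [SecondCountableTopology X] [SFinite μ] {u : X → ℝ}
    (hu : Measurable u) (σ : ℝ) (p : ℝ≥0∞) : Measurable (oscNorm σ p μ u) :=
  measurable_eLpNorm_right (f := fun q : X × ℝ => doubleOsc σ μ u q.1 q.2 ^ (1 / σ))
    ((measurable_doubleOsc hu σ).pow_const _)

variable [BorelSpace X]

/-- The telescoping series in L^p. Half of δ is spent on the power 1/σ of the series (divided by a
because a is applied later), half on the L^p quasi-norm. -/
theorem IsDoubling.exists_eLpNorm_pointOsc_le (hμ : IsDoubling μ C₁ n) {σ : ℝ} (hσ : 0 < σ)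
    (h1 : σ ≤ 1) {p : ℝ≥0∞} (hp : p ≠ 0) :
    ∃ a : ℝ, 0 < a ∧ ∀ δ : ℝ, 0 < δ → ∃ K : ℝ≥0∞, K ≠ ∞ ∧ ∀ u : X → ℝ, Measurable u →
      MemLpLoc u (ENNReal.ofReal σ) μ → ∀ r : ℝ, 0 < r →
        eLpNorm (fun x => pointOsc σ μ u x r ^ (1 / σ)) p μ ^ a ≤
          K * ∑' j : ℕ, 2 ^ (δ * j) * oscNorm σ p μ u (r / 2 ^ j) ^ a := by
  have := hμ.secondCountableTopology
  have := hμ.sigmaFinite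
  obtain ⟨a, ha, h⟩ := exists_eLpNorm_tsum_le X hp
  refine ⟨a, ha, fun δ hδ => ?_⟩
  obtain ⟨K, hK, hK2⟩ := h (δ / 2) (half_pos hδ)
  obtain ⟨M, hM, hM2⟩ := exists_tsum_rpow_le (a := 1 / σ) (δ := δ / 2 / a) (by positivity)
    (by positivity)
  set L := doublingFactor C₁ n 2 ^ (1 / σ) * M
  have hL : L ≠ ∞ := ENNReal.mul_ne_top
    (ENNReal.rpow_ne_top_of_nonneg (by positivity) (doublingFactor_ne_top _ _ _)) hM
  refine ⟨L ^ a * K, ENNReal.mul_ne_top (ENNReal.rpow_ne_top_of_nonneg ha.le hL) hK,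
    fun u hu hloc r hr => ?_⟩
  have hpt : ∀ᵐ x ∂μ, pointOsc σ μ u x r ^ (1 / σ) ≤ L * ∑' j : ℕ,
      2 ^ (δ / 2 / a * j) * doubleOsc σ μ u x (r / 2 ^ j) ^ (1 / σ) := by
    filter_upwards [hμ.ae_pointOsc_le_tsum hσ h1 hu hloc] with x hx
    calc pointOsc σ μ u x r ^ (1 / σ) ≤ (doublingFactor C₁ n 2 *
          ∑' j : ℕ, doubleOsc σ μ u x (r / 2 ^ j)) ^ (1 / σ) := by gcongr; exact hx r hr
      _ ≤ _ := by
          rw [ENNReal.mul_rpow_of_nonneg _ _ (by positivity), mul_assoc]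
          gcongr
          exact hM2 _
  have hmeas : ∀ j : ℕ, Measurable fun x => doubleOsc σ μ u x (r / 2 ^ j) ^ (1 / σ) := fun j =>
    ((measurable_doubleOsc hu σ).comp (measurable_id.prodMk measurable_const)).pow_const _
  calc _ ≤ (L * eLpNorm (fun x => ∑' j : ℕ,
        2 ^ (δ / 2 / a * j) * doubleOsc σ μ u x (r / 2 ^ j) ^ (1 / σ)) p μ) ^ a := by
        rw [← eLpNorm_const_mul_ennreal hp hL]
        gcongr
        exact eLpNorm_le_of_ae_le hpt
    _ ≤ L ^ a * (K * ∑' j : ℕ, 2 ^ (δ / 2 * j) * eLpNorm (fun x =>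
        2 ^ (δ / 2 / a * j) * doubleOsc σ μ u x (r / 2 ^ j) ^ (1 / σ)) p μ ^ a) := by
        rw [ENNReal.mul_rpow_of_nonneg _ _ ha.le]
        gcongr
        exact hK2 μ _ fun j => (hmeas j).const_mul _
    _ = _ := by
        rw [mul_assoc]
        congr 2
        refine tsum_congr fun j => ?_
        rw [eLpNorm_const_mul_ennreal hp (two_rpow_ne_top _), ENNReal.mul_rpow_of_nonneg _ _ ha.le,
          ← ENNReal.rpow_mul, ← mul_assoc, ← two_rpow_add]
        congr 2
        field_simp
        ring

/-- In the pointwise bound of the difference, the term at x integrates directly and the term at y by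
boundedness of averaging on L¹. -/
theorem IsDoubling.exists_differenceModulus_le (hμ : IsDoubling μ C₁ n) {σ : ℝ} (hσ : 0 < σ)
    (h1 : σ ≤ 1) {p : ℝ≥0∞} (hp : p ≠ 0) :
    ∃ K : ℝ≥0∞, K ≠ ∞ ∧ ∀ u : X → ℝ, Measurable u → ∀ t : ℝ, 0 < t →
      differenceModulus u p μ t ≤
        K * eLpNorm (fun x => pointOsc σ μ u x (2 * t) ^ (1 / σ)) p μ := by
  have := hμ.secondCountableTopology
  have := hμ.sigmaFinite
  by_cases hpt : p = ∞
  · subst hpt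
    obtain ⟨K, hK, h⟩ := hμ.exists_enorm_sub_rpow_le hσ h1 zero_le_one
    refine ⟨K * 2, ENNReal.mul_ne_top hK ENNReal.ofNat_ne_top, fun u hu t ht => ?_⟩
    simp only [differenceModulus, if_true, eLpNorm_exponent_top, eLpNormEssSup, enorm_eq_self]
    set S := essSup (fun x => pointOsc σ μ u x (2 * t) ^ (1 / σ)) μ
    have hS : ∀ᵐ x ∂μ, pointOsc σ μ u x (2 * t) ^ (1 / σ) ≤ S := ENNReal.ae_le_essSup _
    refine essSup_le_of_ae_le _ ?_
    filter_upwards [hS] with x hx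
    refine essSup_le_of_ae_le _ ?_
    filter_upwards [ae_restrict_of_ae hS, ae_restrict_mem measurableSet_ball] with y hy hyx
    have := h u hu x y t (by rw [dist_comm]; exact hyx)
    rw [ENNReal.rpow_one] at this
    refine this.trans ?_
    rw [mul_assoc, two_mul S]
    gcongr
  · have hP : 0 < p.toReal := ENNReal.toReal_pos hp hpt
    obtain ⟨K, hK, h⟩ := hμ.exists_enorm_sub_rpow_le hσ h1 hP.le
    set P := p.toReal with hPdef
    set L := K * (1 + doublingFactor C₁ n 2)
    have hL : L ≠ ∞ := ENNReal.mul_ne_top hK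
      (ENNReal.add_ne_top.2 ⟨ENNReal.one_ne_top, doublingFactor_ne_top _ _ _⟩)
    refine ⟨L ^ (1 / P), ENNReal.rpow_ne_top_of_nonneg (by positivity) hL, fun u hu t ht => ?_⟩
    have hm : Measurable fun x => pointOsc σ μ u x (2 * t) ^ (P / σ) :=
      ((measurable_pointOsc hu σ).comp (measurable_id.prodMk measurable_const)).pow_const _
    rw [differenceModulus, if_neg hpt, eLpNorm_eq_lintegral hp hpt,
      ← ENNReal.mul_rpow_of_nonneg _ _ (by positivity)]
    gcongr ?_ ^ _
    simp_rw [← ENNReal.rpow_mul, ← hPdef, div_mul_eq_mul_div, one_mul]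
    calc ∫⁻ x, ⨍⁻ y in ball x t, ‖u x - u y‖ₑ ^ P ∂μ ∂μ
        ≤ ∫⁻ x, ⨍⁻ y in ball x t, K * (pointOsc σ μ u x (2 * t) ^ (P / σ) +
            pointOsc σ μ u y (2 * t) ^ (P / σ)) ∂μ ∂μ := by
          refine lintegral_mono fun x => setLAverage_mono_on measurableSet_ball fun y hy => ?_
          exact h u hu x y t (by rw [dist_comm]; exact hy)
      _ = K * (∫⁻ x, pointOsc σ μ u x (2 * t) ^ (P / σ) ∂μ +
            ∫⁻ x, ⨍⁻ y in ball x t, pointOsc σ μ u y (2 * t) ^ (P / σ) ∂μ ∂μ) := by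
          rw [← lintegral_add_left hm, ← lintegral_const_mul' _ _ hK]
          refine lintegral_congr fun x => ?_
          rw [laverage_const_mul hK, laverage_add_left measurable_const,
            hμ.laverage_ball_const x ht]
      _ ≤ _ := by
          rw [mul_assoc, add_mul, one_mul]
          gcongr
          exact hμ.lintegral_laverage_le ht hm

/-- Besov norms are controlled by oscillations of small order. -/
theorem IsDoubling.exists_scaleNorm_differenceModulus_le (hμ : IsDoubling μ C₁ n) {σ s : ℝ}
    (hσ : 0 < σ) (h1 : σ ≤ 1) (hs : 0 < s) {p q : ℝ≥0∞} (hp : p ≠ 0) (hq : 0 < q) :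
    ∃ K : ℝ≥0∞, K ≠ ∞ ∧ ∀ u : X → ℝ, Measurable u → MemLpLoc u (ENNReal.ofReal σ) μ →
      scaleNorm q (fun t => ENNReal.ofReal (t ^ (-s)) * differenceModulus u p μ t) ≤
        K * scaleNorm q (fun t => ENNReal.ofReal (t ^ (-s)) * oscNorm σ p μ u t) := by
  have := hμ.secondCountableTopology
  have := hμ.sigmaFinite
  obtain ⟨a, ha, h⟩ := hμ.exists_eLpNorm_pointOsc_le hσ h1 hp
  -- Any growth strictly between 0 and sa would do.
  obtain ⟨K, hK, hK2⟩ := h (s * a / 2) (by positivity)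
  obtain ⟨M, hM, hM2⟩ := hμ.exists_differenceModulus_le hσ h1 hp
  obtain ⟨K', hK', h3⟩ := exists_scaleNorm_weighted_le hq (s := s) (θ := s * a / 2) (c := 2) ha
    (half_lt_self (by positivity)) two_pos
    (ENNReal.mul_ne_top (ENNReal.rpow_ne_top_of_nonneg ha.le hM) hK)
  refine ⟨K', hK', fun u hu hloc => h3 _ _ (measurable_oscNorm hu σ p) fun t ht => ?_⟩
  calc differenceModulus u p μ t ^ a
      ≤ (M * eLpNorm (fun x => pointOsc σ μ u x (2 * t) ^ (1 / σ)) p μ) ^ a := by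
        gcongr; exact hM2 u hu t ht
    _ ≤ _ := by
        rw [ENNReal.mul_rpow_of_nonneg _ _ ha.le, mul_assoc]
        gcongr
        exact hK2 u hu hloc _ (by positivity)

/-- The functional `S` is controlled by oscillations. -/
theorem IsDoubling.exists_scaleNorm_functionalS_le (hμ : IsDoubling μ C₁ n) {σ s ε : ℝ}
    (hσ : 0 < σ) (hε : 0 ≤ ε) (hεs : ε < s) {p q : ℝ≥0∞} (hp : p ≠ 0) (hq : 0 < q) :
    ∃ K : ℝ≥0∞, K ≠ ∞ ∧ ∀ u : X → ℝ, Measurable u →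
      scaleNorm q (fun t => eLpNorm (functionalS s ε σ μ u t) p μ) ≤
        K * scaleNorm q (fun t => ENNReal.ofReal (t ^ (-s)) * oscNorm σ p μ u t) := by
  have := hμ.secondCountableTopology
  have := hμ.sigmaFinite
  obtain ⟨a, ha, h⟩ := exists_eLpNorm_tsum_le X hp
  -- The total growth is then δ + εa = (s + ε)a/2 < sa; here ε < s is essential.
  set δ := (s - ε) * a / 2
  have hδ : 0 < δ := by have := sub_pos.2 hεs; positivity
  obtain ⟨K, hK, hK2⟩ := h δ hδ
  set L := (2 : ℝ≥0∞) ^ ε * (doublingFactor C₁ n 3 ^ 2) ^ (1 / σ)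
  have hL : L ≠ ∞ := ENNReal.mul_ne_top (two_rpow_ne_top _) (ENNReal.rpow_ne_top_of_nonneg
    (by positivity) (ENNReal.pow_ne_top (doublingFactor_ne_top _ _ _)))
  obtain ⟨K', hK', h3⟩ := exists_scaleNorm_weighted_le hq (s := s) (θ := δ + ε * a) (c := 1) ha
    (by simp only [δ]; nlinarith [sub_pos.2 hεs]) one_pos
    (ENNReal.mul_ne_top (ENNReal.rpow_ne_top_of_nonneg ha.le hL) hK)
  refine ⟨K', hK', fun u hu => ?_⟩
  set Φ : ℝ → X → ℝ≥0∞ := fun t x => ENNReal.ofReal (t ^ ε) *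
    ⨆ r ∈ Ioc (0 : ℝ) t, ENNReal.ofReal (r ^ (-ε)) * bestConst σ μ u r x ^ (1 / σ)
  have hΦ : ∀ t, 0 < t → eLpNorm (functionalS s ε σ μ u t) p μ =
      ENNReal.ofReal (t ^ (-s)) * eLpNorm (Φ t) p μ := by
    intro t ht
    rw [← eLpNorm_const_mul_ennreal hp ENNReal.ofReal_ne_top]
    congr 1
    funext x
    simp only [Φ, functionalS]
    rw [← mul_assoc, ← ENNReal.ofReal_mul (by positivity), ← Real.rpow_add ht, neg_add_eq_sub]
  refine (scaleNorm_mono fun t ht => (hΦ t ht).le).trans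
    (h3 (fun t => eLpNorm (Φ t) p μ) _ (measurable_oscNorm hu σ p) fun t ht => ?_)
  have hpt : ∀ x, Φ t x ≤ L * ∑' j : ℕ,
      2 ^ (ε * j) * doubleOsc σ μ u x (1 * t / 2 ^ j) ^ (1 / σ) := by
    intro x
    simp only [Φ]
    rw [ENNReal.mul_iSup]
    refine iSup_le fun r => ?_
    rw [ENNReal.mul_iSup]
    refine iSup_le fun hr => ?_
    -- With t/2^(j+1) < r ≤ t/2^j, the competitor r in the supremum is dominated by the single
    -- dyadic term j.
    obtain ⟨j, hj1, hj2⟩ := exists_nat_pow_near (x := t / r) (y := 2)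
      ((one_le_div hr.1).2 hr.2) one_lt_two
    rw [le_div_iff₀ hr.1] at hj1
    rw [div_lt_iff₀ hr.1, pow_succ] at hj2
    have h2j : (0 : ℝ) < 2 ^ j := by positivity
    have hrt : r ≤ t / 2 ^ j := by rw [le_div_iff₀ h2j]; linarith
    have htr : t / 2 ^ j ≤ 3 * r := by rw [div_le_iff₀ h2j]; nlinarith [hr.1]
    have hosc : bestConst σ μ u r x ≤
        doublingFactor C₁ n 3 ^ 2 * doubleOsc σ μ u x (t / 2 ^ j) :=
      (hμ.bestConst_le_doubleOsc σ u x hr.1).trans (hμ.doubleOsc_le_doubleOsc σ u hr.1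
        (by norm_num) (ball_subset_ball hrt) (ball_subset_ball htr))
    have hw : ENNReal.ofReal (t ^ ε) * ENNReal.ofReal (r ^ (-ε)) ≤ 2 ^ ε * 2 ^ (ε * j) := by
      rw [← ENNReal.ofReal_mul (by positivity), ← two_rpow_add,
        show (2 : ℝ≥0∞) = ENNReal.ofReal 2 by simp, ENNReal.ofReal_rpow_of_pos two_pos]
      refine ENNReal.ofReal_le_ofReal ?_
      rw [show ε + ε * j = (1 + j) * ε by ring, Real.rpow_mul zero_le_two,
        Real.rpow_neg hr.1.le, ← div_eq_mul_inv, ← Real.div_rpow ht.le hr.1.le]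
      refine Real.rpow_le_rpow (by have := hr.1; positivity) ?_ hε
      rw [div_le_iff₀ hr.1, add_comm, Real.rpow_add two_pos, Real.rpow_natCast, Real.rpow_one]
      exact hj2.le
    calc _ = (ENNReal.ofReal (t ^ ε) * ENNReal.ofReal (r ^ (-ε))) *
          bestConst σ μ u r x ^ (1 / σ) := by rw [mul_assoc]
      _ ≤ (2 ^ ε * 2 ^ (ε * j)) *
          (doublingFactor C₁ n 3 ^ 2 * doubleOsc σ μ u x (t / 2 ^ j)) ^ (1 / σ) := by gcongr
      _ = L * (2 ^ (ε * j) * doubleOsc σ μ u x (t / 2 ^ j) ^ (1 / σ)) := by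
          rw [ENNReal.mul_rpow_of_nonneg _ _ (by positivity)]; ring
      _ ≤ _ := by
          gcongr
          rw [one_mul]
          exact ENNReal.le_tsum
            (f := fun j : ℕ => 2 ^ (ε * j) * doubleOsc σ μ u x (t / 2 ^ j) ^ (1 / σ)) j
  have hmeas : ∀ j : ℕ, Measurable fun x => doubleOsc σ μ u x (1 * t / 2 ^ j) ^ (1 / σ) := fun j =>
    ((measurable_doubleOsc hu σ).comp (measurable_id.prodMk measurable_const)).pow_const _
  calc _ ≤ (L * eLpNorm (fun x => ∑' j : ℕ,
        2 ^ (ε * j) * doubleOsc σ μ u x (1 * t / 2 ^ j) ^ (1 / σ)) p μ) ^ a := by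
        rw [← eLpNorm_const_mul_ennreal hp hL]
        gcongr
        exact eLpNorm_le_of_ae_le (Eventually.of_forall hpt)
    _ ≤ L ^ a * (K * ∑' j : ℕ, 2 ^ (δ * j) * eLpNorm (fun x =>
        2 ^ (ε * j) * doubleOsc σ μ u x (1 * t / 2 ^ j) ^ (1 / σ)) p μ ^ a) := by
        rw [ENNReal.mul_rpow_of_nonneg _ _ ha.le]
        gcongr
        exact hK2 μ _ fun j => (hmeas j).const_mul _
    _ = _ := by
        rw [mul_assoc]
        congr 2
        refine tsum_congr fun j => ?_
        rw [eLpNorm_const_mul_ennreal hp (two_rpow_ne_top _), ENNReal.mul_rpow_of_nonneg _ _ ha.le,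
          ← ENNReal.rpow_mul, ← mul_assoc, ← two_rpow_add, oscNorm]
        congr 2
        ring

end Core

/-! ### A Sobolev-type gain in the order of oscillation -/

section Sobolev

variable {X : Type*} [MetricSpace X] [MeasurableSpace X] {μ : Measure X} {C₁ n : ℝ}

theorem doublingFactor_two_mul_two_pow (hμ : IsDoubling μ C₁ n) (j : ℕ) :
    doublingFactor C₁ n (2 * 2 ^ j) = doublingFactor C₁ n 2 * 2 ^ (n * j) := by
  have e2 : (2 : ℝ≥0∞) ^ (n * j) = ENNReal.ofReal ((2 : ℝ) ^ (n * j)) := by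
    rw [← ENNReal.ofReal_rpow_of_pos two_pos]; simp
  have := one_pos.trans hμ.one_lt
  rw [doublingFactor, doublingFactor, e2, ← ENNReal.ofReal_mul (by positivity),
    Real.mul_rpow zero_le_two (by positivity), ← Real.rpow_natCast 2 j,
    ← Real.rpow_mul zero_le_two, mul_comm (j : ℝ), mul_assoc]

theorem laverage_mul_const_of_measurable {α : Type*} [MeasurableSpace α] {ν : Measure α}
    {f : α → ℝ≥0∞} (hf : Measurable f) (c : ℝ≥0∞) :
    ⨍⁻ x, f x * c ∂ν = (⨍⁻ x, f x ∂ν) * c :=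
  lintegral_mul_const _ hf

variable [BorelSpace X]

/-- Split the power τ/σ into P/σ and (P/σ)(τ/P - 1). The first factor is averaged; the second is
replaced by a supremum, whose loss 2^(nj) is thus raised only to τ/P - 1. -/
theorem IsDoubling.exists_laverage_doubleOsc_rpow_le (hμ : IsDoubling μ C₁ n) {σ P τ : ℝ}
    (hσ : 0 < σ) (hP : 0 < P) (hPτ : P ≤ τ) :
    ∃ K : ℝ≥0∞, K ≠ ∞ ∧ ∀ u : X → ℝ, Measurable u → ∀ (w : X) (t : ℝ), 0 < t → ∀ j : ℕ,
      ⨍⁻ x in ball w t, doubleOsc σ μ u x (4 * t / 2 ^ j) ^ (τ / σ) ∂μ ≤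
        K * (2 ^ (n * (τ / P - 1) * j) *
          (⨍⁻ z in ball w (5 * t), doubleOsc σ μ u z (8 * t / 2 ^ j) ^ (P / σ) ∂μ) ^ (τ / P)) := by
  have := hμ.secondCountableTopology
  have := hμ.sigmaFinite
  have he : 0 ≤ τ / P - 1 := by rw [sub_nonneg, one_le_div hP]; exact hPτ
  have hPσ : 0 < P / σ := by positivity
  set L := (doublingFactor C₁ n 3 ^ 2) ^ (P / σ)
  have hL : L ≠ ∞ := ENNReal.rpow_ne_top_of_nonneg hPσ.le
    (ENNReal.pow_ne_top (doublingFactor_ne_top _ _ _))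
  set M := L * doublingFactor C₁ n 2
  have hM : M ≠ ∞ := ENNReal.mul_ne_top hL (doublingFactor_ne_top _ _ _)
  set N := L * doublingFactor C₁ n 5
  have hN : N ≠ ∞ := ENNReal.mul_ne_top hL (doublingFactor_ne_top _ _ _)
  refine ⟨N * M ^ (τ / P - 1), ENNReal.mul_ne_top hN (ENNReal.rpow_ne_top_of_nonneg he hM),
    fun u hu w t ht j => ?_⟩
  have h2j : (0 : ℝ) < 2 ^ j := by positivity
  have h1j : (1 : ℝ) ≤ 2 ^ j := one_le_pow₀ one_le_two
  set r := 4 * t / 2 ^ j with hr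
  have hr0 : 0 < r := by positivity
  have hr4 : r ≤ 4 * t := by rw [hr, div_le_iff₀ h2j]; nlinarith
  have hrj : 2 * 2 ^ j * r = 8 * t := by rw [hr]; field_simp; norm_num
  have h2r : 8 * t / 2 ^ j = 2 * r := by rw [hr]; ring
  rw [h2r]
  set A := ⨍⁻ z in ball w (5 * t), doubleOsc σ μ u z (2 * r) ^ (P / σ) ∂μ
  have hmeas : ∀ ρ e : ℝ, Measurable fun x => doubleOsc σ μ u x ρ ^ e := fun ρ e =>
    ((measurable_doubleOsc hu σ).comp (measurable_id.prodMk measurable_const)).pow_const _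
  have hstep : ∀ x z, dist z x < r →
      doubleOsc σ μ u x r ^ (P / σ) ≤ L * doubleOsc σ μ u z (2 * r) ^ (P / σ) := by
    intro x z hz
    rw [← ENNReal.mul_rpow_of_nonneg _ _ hPσ.le]
    gcongr
    exact hμ.doubleOsc_le_doubleOsc σ u hr0 (by norm_num)
      (ball_subset_ball' (by rw [dist_comm]; linarith)) (ball_subset_ball' (by linarith))
  -- The oscillation at radius r is bounded by that of radius 2r at every point of B(x,r), hence by
  -- an average over B(x,r). Enlarging to B(w,5t) ⊂ B(x,8t) costs the ratio 2·2^j of radii to the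
  -- power n.
  have hsup : ∀ x ∈ ball w t, doubleOsc σ μ u x r ^ (P / σ) ≤ M * (2 ^ (n * j) * A) := by
    intro x hx
    rw [mem_ball] at hx
    calc doubleOsc σ μ u x r ^ (P / σ)
        = ⨍⁻ _ in ball x r, doubleOsc σ μ u x r ^ (P / σ) ∂μ :=
          (hμ.laverage_ball_const x hr0 _).symm
      _ ≤ ⨍⁻ z in ball x r, L * doubleOsc σ μ u z (2 * r) ^ (P / σ) ∂μ :=
          setLAverage_mono_on measurableSet_ball fun z hz => hstep x z hz
      _ ≤ L * (doublingFactor C₁ n (2 * 2 ^ j) * A) := by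
          rw [laverage_const_mul hL]
          gcongr
          refine hμ.laverage_le hr0 (by linarith) (ball_subset_ball' (by linarith))
            (ball_subset_ball' ?_) _
          rw [hrj, dist_comm]; linarith
      _ = _ := by rw [doublingFactor_two_mul_two_pow hμ]; simp only [M]; ring
  have hsum : ⨍⁻ x in ball w t, doubleOsc σ μ u x r ^ (P / σ) ∂μ ≤ N * A := by
    calc _ ≤ ⨍⁻ x in ball w t, L * doubleOsc σ μ u x (2 * r) ^ (P / σ) ∂μ :=
          laverage_mono fun x => hstep x x (by rwa [dist_self])
      _ ≤ _ := by
          rw [laverage_const_mul hL, mul_assoc]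
          gcongr
          exact hμ.laverage_le ht (by norm_num) (ball_subset_ball (by linarith)) Subset.rfl _
  calc ⨍⁻ x in ball w t, doubleOsc σ μ u x r ^ (τ / σ) ∂μ
      ≤ ⨍⁻ x in ball w t, doubleOsc σ μ u x r ^ (P / σ) *
          (M * (2 ^ (n * j) * A)) ^ (τ / P - 1) ∂μ := by
        refine setLAverage_mono_on measurableSet_ball fun x hx => ?_
        have e : τ / σ = P / σ + P / σ * (τ / P - 1) := by field_simp; ring
        rw [e, ENNReal.rpow_add_of_nonneg _ _ hPσ.le (by positivity), ENNReal.rpow_mul]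
        gcongr
        exact hsup x hx
    _ ≤ N * A * (M * (2 ^ (n * j) * A)) ^ (τ / P - 1) := by
        rw [laverage_mul_const_of_measurable (hmeas _ _)]
        gcongr
    _ = _ := by
        have e : τ / P = 1 + (τ / P - 1) := by ring
        rw [ENNReal.mul_rpow_of_nonneg M _ he, ENNReal.mul_rpow_of_nonneg _ A he,
          ← ENNReal.rpow_mul 2]
        conv_rhs => rw [e, ENNReal.rpow_add_of_nonneg _ _ zero_le_one he, ENNReal.rpow_one]
        rw [show 1 + (τ / P - 1) - 1 = τ / P - 1 by ring,
          show n * (j : ℝ) * (τ / P - 1) = n * (τ / P - 1) * j by ring]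
        ring

/-- Two points of B(w,t) are less than 2t apart, so their difference is controlled by point
oscillations at radius 4t, which are expanded in the telescoping series. -/
theorem IsDoubling.exists_doubleOsc_le_laverage (hμ : IsDoubling μ C₁ n) {σ τ δ : ℝ}
    (hσ : 0 < σ) (h1 : σ ≤ 1) (hτ : 0 < τ) (hδ : 0 < δ) :
    ∃ K : ℝ≥0∞, K ≠ ∞ ∧ ∀ u : X → ℝ, Measurable u → MemLpLoc u (ENNReal.ofReal σ) μ →
      ∀ (w : X) (t : ℝ), 0 < t → doubleOsc τ μ u w t ≤ K * ∑' j : ℕ, 2 ^ (δ * j) *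
        ⨍⁻ x in ball w t, doubleOsc σ μ u x (4 * t / 2 ^ j) ^ (τ / σ) ∂μ := by
  have := hμ.secondCountableTopology
  have := hμ.sigmaFinite
  have he : 0 < τ / σ := by positivity
  obtain ⟨K, hK, hK2⟩ := hμ.exists_enorm_sub_rpow_le hσ h1 hτ.le
  obtain ⟨M, hM, hM2⟩ := exists_tsum_rpow_le he hδ
  set L := doublingFactor C₁ n 2 ^ (τ / σ) * M
  have hL : L ≠ ∞ := ENNReal.mul_ne_top
    (ENNReal.rpow_ne_top_of_nonneg he.le (doublingFactor_ne_top _ _ _)) hM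
  refine ⟨K * 2 * L, ENNReal.mul_ne_top (ENNReal.mul_ne_top hK ENNReal.ofNat_ne_top) hL,
    fun u hu hloc w t ht => ?_⟩
  set g : X → ℝ≥0∞ := fun x => pointOsc σ μ u x (2 * (2 * t)) ^ (τ / σ)
  have hg : Measurable g :=
    ((measurable_pointOsc hu σ).comp (measurable_id.prodMk measurable_const)).pow_const _
  have hmeas : ∀ ρ e : ℝ, Measurable fun x => doubleOsc σ μ u x ρ ^ e := fun ρ e =>
    ((measurable_doubleOsc hu σ).comp (measurable_id.prodMk measurable_const)).pow_const _
  have hgt : ∀ᵐ x ∂μ, g x ≤ L * ∑' j : ℕ, 2 ^ (δ * j) *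
      doubleOsc σ μ u x (4 * t / 2 ^ j) ^ (τ / σ) := by
    filter_upwards [hμ.ae_pointOsc_le_tsum hσ h1 hu hloc] with x hx
    calc g x ≤ (doublingFactor C₁ n 2 *
          ∑' j : ℕ, doubleOsc σ μ u x (4 * t / 2 ^ j)) ^ (τ / σ) := by
            simp only [g]
            gcongr
            rw [show 2 * (2 * t) = 4 * t by ring]
            exact hx _ (by positivity)
      _ ≤ _ := by
          rw [ENNReal.mul_rpow_of_nonneg _ _ he.le, mul_assoc]
          gcongr
          exact hM2 _
  calc doubleOsc τ μ u w t
      ≤ ⨍⁻ y in ball w t, ⨍⁻ z in ball w t, K * (g y + g z) ∂μ ∂μ := by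
        refine setLAverage_mono_on measurableSet_ball fun y hy =>
          setLAverage_mono_on measurableSet_ball fun z hz => hK2 u hu y z (2 * t) ?_
        have := dist_triangle_right y z w
        rw [mem_ball] at hy hz
        linarith
    _ = K * 2 * ⨍⁻ y in ball w t, g y ∂μ := by
        simp only [laverage_const_mul hK]
        have : ∀ y, ⨍⁻ z in ball w t, (g y + g z) ∂μ = g y + ⨍⁻ z in ball w t, g z ∂μ :=
          fun y => by rw [laverage_add_left measurable_const, hμ.laverage_ball_const w ht]
        simp only [this]
        rw [laverage_add_left hg, hμ.laverage_ball_const w ht, mul_assoc, two_mul]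
    _ ≤ K * 2 * ⨍⁻ x in ball w t, L * ∑' j : ℕ, 2 ^ (δ * j) *
          doubleOsc σ μ u x (4 * t / 2 ^ j) ^ (τ / σ) ∂μ := by
        gcongr
        exact hgt
    _ = _ := by
        rw [laverage_const_mul hL, ← mul_assoc]
        congr 1
        rw [laverage, lintegral_tsum fun j => ((hmeas _ _).const_mul _).aemeasurable]
        exact tsum_congr fun j => laverage_const_mul (two_rpow_ne_top _)

/-- A Sobolev-type inequality between oscillations of different orders. -/
theorem IsDoubling.exists_oscNorm_le (hμ : IsDoubling μ C₁ n) {σ τ δ : ℝ}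
    (hσ : 0 < σ) (h1 : σ ≤ 1) {p : ℝ≥0∞} (hp : p ≠ 0) (hpt : p ≠ ∞) (hpτ : p.toReal ≤ τ)
    (hδ : 0 < δ) :
    ∃ K : ℝ≥0∞, K ≠ ∞ ∧ ∀ u : X → ℝ, Measurable u → MemLpLoc u (ENNReal.ofReal σ) μ →
      ∀ t : ℝ, 0 < t → oscNorm τ p μ u t ^ p.toReal ≤ K * ∑' j : ℕ,
        2 ^ ((δ + n * (1 - p.toReal / τ)) * j) * oscNorm σ p μ u (8 * t / 2 ^ j) ^ p.toReal := by
  have := hμ.secondCountableTopology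
  have := hμ.sigmaFinite
  have hP : 0 < p.toReal := ENNReal.toReal_pos hp hpt
  have hτ : 0 < τ := hP.trans_le hpτ
  simp only [oscNorm, eLpNorm_rpow_eq_lintegral hp hpt, ← ENNReal.rpow_mul,
    div_mul_eq_mul_div, one_mul]
  set P := p.toReal
  have hPτ1 : P / τ ≤ 1 := (div_le_one hτ).2 hpτ
  have he : 0 < P / τ := by positivity
  obtain ⟨K, hK, hK2⟩ := hμ.exists_doubleOsc_le_laverage hσ h1 hτ (half_pos hδ)
  obtain ⟨L, hL, hL2⟩ := hμ.exists_laverage_doubleOsc_rpow_le hσ hP hpτ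
  obtain ⟨M, hM, hM2⟩ := exists_tsum_rpow_le he (half_pos hδ)
  have hKL : (K * L) ^ (P / τ) ≠ ∞ :=
    ENNReal.rpow_ne_top_of_nonneg he.le (ENNReal.mul_ne_top hK hL)
  have hKLM := ENNReal.mul_ne_top hKL hM
  refine ⟨(K * L) ^ (P / τ) * M * (doublingFactor C₁ n 5 * doublingFactor C₁ n 2),
    ENNReal.mul_ne_top hKLM (ENNReal.mul_ne_top (doublingFactor_ne_top _ _ _)
      (doublingFactor_ne_top _ _ _)), fun u hu hloc t ht => ?_⟩
  have hmeas : ∀ ρ e : ℝ, Measurable fun x => doubleOsc σ μ u x ρ ^ e := fun ρ e =>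
    ((measurable_doubleOsc hu σ).comp (measurable_id.prodMk measurable_const)).pow_const _
  set A : ℕ → X → ℝ≥0∞ := fun j w =>
    ⨍⁻ z in ball w (5 * t), doubleOsc σ μ u z (8 * t / 2 ^ j) ^ (P / σ) ∂μ
  have hA : ∀ j, Measurable (A j) := fun j =>
    measurable_laverage_ball (c := fun w : X => w) (r := fun _ => 5 * t)
      (f := fun _ z => doubleOsc σ μ u z (8 * t / 2 ^ j) ^ (P / σ)) measurable_id
      measurable_const ((hmeas _ _).comp measurable_snd)
  -- The power P/τ turns the loss 2^(n(τ/P - 1)j) into 2^(n(1 - P/τ)j) and makes A j enter linearly,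
  -- ready for integration in w.
  have hpt : ∀ w, doubleOsc τ μ u w t ^ (P / τ) ≤ ((K * L) ^ (P / τ) * M) * ∑' j : ℕ,
      2 ^ ((δ + n * (1 - P / τ)) * j) * A j w := by
    intro w
    calc doubleOsc τ μ u w t ^ (P / τ)
        ≤ (K * ∑' j : ℕ, 2 ^ (δ / 2 * j) *
            (L * (2 ^ (n * (τ / P - 1) * j) * A j w ^ (τ / P)))) ^ (P / τ) := by
          gcongr
          refine (hK2 u hu hloc w t ht).trans ?_
          gcongr
          exact hL2 u hu w t ht _
      _ = ((K * L) * ∑' j : ℕ, 2 ^ (δ / 2 * j) *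
            (2 ^ (n * (τ / P - 1) * j) * A j w ^ (τ / P))) ^ (P / τ) := by
          rw [mul_assoc, ← ENNReal.tsum_mul_left (a := L)]
          simp_rw [mul_left_comm L]
      _ ≤ (K * L) ^ (P / τ) * (M * ∑' j : ℕ, 2 ^ (δ / 2 * j) * (2 ^ (δ / 2 * j) *
            (2 ^ (n * (τ / P - 1) * j) * A j w ^ (τ / P))) ^ (P / τ)) := by
          rw [ENNReal.mul_rpow_of_nonneg _ _ he.le]
          gcongr
          exact hM2 _
      _ ≤ _ := by
          rw [mul_assoc]
          gcongr _ * (_ * ?_)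
          refine ENNReal.tsum_le_tsum fun j => ?_
          rw [ENNReal.mul_rpow_of_nonneg _ _ he.le, ENNReal.mul_rpow_of_nonneg _ _ he.le,
            ← ENNReal.rpow_mul, ← ENNReal.rpow_mul, ← ENNReal.rpow_mul,
            show τ / P * (P / τ) = 1 by field_simp, ENNReal.rpow_one, ← mul_assoc, ← mul_assoc,
            ← two_rpow_add, ← two_rpow_add]
          gcongr
          · norm_num
          · have h3 : n * (τ / P - 1) * j * (P / τ) = n * (1 - P / τ) * j := by field_simp
            have h4 : δ / 2 * j * (P / τ) ≤ δ / 2 * j :=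
              mul_le_of_le_one_right (by positivity) hPτ1
            rw [h3]; linarith
  calc ∫⁻ w, doubleOsc τ μ u w t ^ (P / τ) ∂μ
      ≤ ∫⁻ w, ((K * L) ^ (P / τ) * M) * ∑' j : ℕ,
          2 ^ ((δ + n * (1 - P / τ)) * j) * A j w ∂μ := lintegral_mono hpt
    _ = ((K * L) ^ (P / τ) * M) * ∑' j : ℕ,
          2 ^ ((δ + n * (1 - P / τ)) * j) * ∫⁻ w, A j w ∂μ := by
        rw [lintegral_const_mul' _ _ hKLM,
          lintegral_tsum fun j => ((hA j).const_mul _).aemeasurable]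
        simp_rw [lintegral_const_mul' _ _ (two_rpow_ne_top _)]
    _ ≤ ((K * L) ^ (P / τ) * M) * ∑' j : ℕ, 2 ^ ((δ + n * (1 - P / τ)) * j) *
          (doublingFactor C₁ n 5 * doublingFactor C₁ n 2 *
            ∫⁻ z, doubleOsc σ μ u z (8 * t / 2 ^ j) ^ (P / σ) ∂μ) := by
        gcongr with j
        refine (hμ.lintegral_laverage_le (by positivity) (hmeas _ _)).trans ?_
        gcongr
        exact le_mul_of_one_le_left zero_le (hμ.one_le_doublingFactor (by norm_num))
    _ = _ := by
        simp_rw [mul_left_comm _ (doublingFactor C₁ n 5 * doublingFactor C₁ n 2)]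
        rw [ENNReal.tsum_mul_left, ← mul_assoc]

/-- Hardy's inequality with growth θ at the midpoint between the Sobolev loss n(1 - p/τ) and the
available decay sp. -/
theorem IsDoubling.exists_scaleNorm_oscNorm_le (hμ : IsDoubling μ C₁ n) {σ τ s : ℝ}
    (hσ : 0 < σ) (h1 : σ ≤ 1) {p q : ℝ≥0∞} (hp : p ≠ 0) (hpt : p ≠ ∞) (hpτ : p.toReal ≤ τ)
    (hq : 0 < q) (hτs : n * (1 - p.toReal / τ) < s * p.toReal) :
    ∃ K : ℝ≥0∞, K ≠ ∞ ∧ ∀ u : X → ℝ, Measurable u → MemLpLoc u (ENNReal.ofReal σ) μ →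
      scaleNorm q (fun t => ENNReal.ofReal (t ^ (-s)) * oscNorm τ p μ u t) ≤
        K * scaleNorm q (fun t => ENNReal.ofReal (t ^ (-s)) * oscNorm σ p μ u t) := by
  have := hμ.secondCountableTopology
  have := hμ.sigmaFinite
  have hP : 0 < p.toReal := ENNReal.toReal_pos hp hpt
  obtain ⟨K, hK, h⟩ := hμ.exists_oscNorm_le hσ h1 hp hpt hpτ
    (δ := (s * p.toReal - n * (1 - p.toReal / τ)) / 2) (by linarith)
  obtain ⟨K', hK', h3⟩ := exists_scaleNorm_weighted_le hq (s := s) (c := 8)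
    (θ := (s * p.toReal - n * (1 - p.toReal / τ)) / 2 + n * (1 - p.toReal / τ)) hP
    (by linarith) (by norm_num) hK
  exact ⟨K', hK', fun u hu hloc => h3 _ _ (measurable_oscNorm hu σ p) (h u hu hloc)⟩

end Sobolev

/-! ### Comparison of the function spaces -/

section Spaces

variable {X : Type*}

theorem FunctionSpace.embeds_of_le {A B : FunctionSpace X} {K : ℝ≥0∞} (hK : K ≠ ∞)
    (hA : ∀ u ∈ A.carrier, A.seminorm u < ∞)
    (h : ∀ u ∈ A.carrier, (B.seminorm u < ∞ → u ∈ B.carrier) ∧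
      B.seminorm u ≤ K * A.seminorm u) : A.Embeds B := by
  refine ⟨K.toReal + 1, by positivity, fun u hu => ⟨(h u hu).1 ?_, (h u hu).2.trans ?_⟩⟩
  · exact (h u hu).2.trans_lt (ENNReal.mul_lt_top hK.lt_top (hA u hu))
  · gcongr
    exact (ENNReal.le_ofReal_iff_toReal_le hK (by positivity)).2 (by linarith)

theorem FunctionSpace.Embeds.trans {A B C : FunctionSpace X} (h1 : A.Embeds B)
    (h2 : B.Embeds C) : A.Embeds C := by
  obtain ⟨K, hK, h⟩ := h1
  obtain ⟨L, hL, h'⟩ := h2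
  refine ⟨L * K, mul_pos hL hK, fun u hu => ⟨(h' u (h u hu).1).1, ?_⟩⟩
  refine (h' u (h u hu).1).2.trans ?_
  rw [ENNReal.ofReal_mul hL.le, mul_assoc]
  gcongr
  exact (h u hu).2

theorem besovTypeNorm_mono [MeasurableSpace X] {μ : Measure X} {p q : ℝ≥0∞}
    {E F : ℝ → X → ℝ≥0∞}
    (h : ∀ t, 0 < t → ∀ x, E t x ≤ F t x) :
    besovTypeNorm p q μ E ≤ besovTypeNorm p q μ F :=
  scaleNorm_mono fun t ht => eLpNorm_le_of_ae_le (Eventually.of_forall (h t ht))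

variable [MetricSpace X] [MeasurableSpace X] {μ : Measure X} {C₁ n : ℝ} {u v : X → ℝ}

/-- Every member of the spaces thus has a measurable representative; with the congruence lemmas
below, estimates are needed only for measurable functions. -/
theorem MemLpLoc.aestronglyMeasurable {r : ℝ≥0∞} (hu : MemLpLoc u r μ) :
    AEStronglyMeasurable u μ := by
  rcases isEmpty_or_nonempty X with h | ⟨⟨x⟩⟩
  · rw [Measure.eq_zero_of_isEmpty μ]; exact aestronglyMeasurable_zero_measure u
  · have hU : ⋃ k : ℕ, ball x (k + 1) = univ := by
      refine eq_univ_of_forall fun y => mem_iUnion.2 ?_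
      obtain ⟨k, hk⟩ := exists_nat_gt (dist y x)
      exact ⟨k, by rw [mem_ball]; linarith⟩
    rw [← Measure.restrict_univ (μ := μ), ← hU, aestronglyMeasurable_iUnion_iff]
    exact fun k => (hu x (k + 1) (by positivity)).1

theorem MemLpLoc.congr {r : ℝ≥0∞} (hu : MemLpLoc u r μ) (h : u =ᵐ[μ] v) : MemLpLoc v r μ :=
  fun x ρ hρ => (memLp_congr_ae (ae_restrict_of_ae h)).1 (hu x ρ hρ)

theorem MemLpLoc.mono_exponent (hμ : IsDoubling μ C₁ n) {r r' : ℝ≥0∞} (hu : MemLpLoc u r μ)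
    (h : r' ≤ r) : MemLpLoc u r' μ := fun x ρ hρ => by
  have : IsFiniteMeasure (μ.restrict (ball x ρ)) :=
    isFiniteMeasure_restrict.2 (hμ.ball_ne_top x hρ)
  exact (hu x ρ hρ).mono_exponent h

theorem differenceModulus_congr (h : u =ᵐ[μ] v) (p : ℝ≥0∞) (t : ℝ) :
    differenceModulus u p μ t = differenceModulus v p μ t := by
  unfold differenceModulus
  split_ifs
  · refine essSup_congr_ae ?_
    filter_upwards [h] with x hx
    refine essSup_congr_ae ?_
    filter_upwards [ae_restrict_of_ae h] with y hy
    rw [hx, hy]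
  · congr 1
    refine lintegral_congr_ae ?_
    filter_upwards [h] with x hx
    refine laverage_congr ?_
    filter_upwards [ae_restrict_of_ae h] with y hy
    rw [hx, hy]

theorem besovNorm_congr (h : u =ᵐ[μ] v) (s : ℝ) (p q : ℝ≥0∞) :
    besovNorm s p q μ u = besovNorm s p q μ v := by
  simp only [besovNorm, differenceModulus_congr h]

theorem bestConst_congr (h : u =ᵐ[μ] v) (σ : ℝ) : bestConst σ μ u = bestConst σ μ v := by
  funext t x
  refine iInf_congr fun c => laverage_congr ?_
  filter_upwards [ae_restrict_of_ae h] with y hy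
  rw [hy]

theorem functionalI_congr (h : u =ᵐ[μ] v) (s σ : ℝ) :
    functionalI s σ μ u = functionalI s σ μ v := by
  unfold functionalI
  rw [bestConst_congr h]

theorem functionalS_congr (h : u =ᵐ[μ] v) (s ε σ : ℝ) :
    functionalS s ε σ μ u = functionalS s ε σ μ v := by
  unfold functionalS
  rw [bestConst_congr h]

theorem functionalA_congr (h : u =ᵐ[μ] v) (s σ : ℝ) :
    functionalA s σ μ u = functionalA s σ μ v := by
  funext t x
  have h1 : ⨍ z in ball x t, u z ∂μ = ⨍ z in ball x t, v z ∂μ :=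
    average_congr (ae_restrict_of_ae h)
  unfold functionalA
  rw [h1]
  congr 2
  refine laverage_congr ?_
  filter_upwards [ae_restrict_of_ae h] with y hy
  rw [hy]

/-- The functional C involves the value u(x), so unlike the others it is invariant only after taking
the L^p norm. -/
theorem besovTypeNorm_functionalC_congr (h : u =ᵐ[μ] v) (s σ : ℝ) (p q : ℝ≥0∞) :
    besovTypeNorm p q μ (functionalC s σ μ u) = besovTypeNorm p q μ (functionalC s σ μ v) := by
  have : ∀ t, eLpNorm (functionalC s σ μ u t) p μ = eLpNorm (functionalC s σ μ v t) p μ := by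
    intro t
    refine eLpNorm_congr_ae ?_
    filter_upwards [h] with x hx
    unfold functionalC
    congr 2
    refine laverage_congr ?_
    filter_upwards [ae_restrict_of_ae h] with y hy
    rw [hx, hy]
  simp only [besovTypeNorm, this]

theorem besovNorm_eq_scaleNorm (s : ℝ) (p q : ℝ≥0∞) (u : X → ℝ) :
    besovNorm s p q μ u =
      scaleNorm q fun t => ENNReal.ofReal (t ^ (-s)) * differenceModulus u p μ t := by
  unfold besovNorm scaleNorm
  split_ifs
  · rfl
  · congr 1
    refine setLIntegral_congr_fun measurableSet_Ioi fun t (ht : 0 < t) => ?_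
    rw [ENNReal.mul_rpow_of_nonneg _ _ ENNReal.toReal_nonneg,
      ENNReal.ofReal_rpow_of_nonneg (by positivity) ENNReal.toReal_nonneg, ← Real.rpow_mul ht.le,
      mul_right_comm, ← ENNReal.ofReal_mul (by positivity), mul_comm (differenceModulus u p μ t ^ _),
      ← Real.rpow_neg_one t, ← Real.rpow_add ht]
    congr 3
    ring

theorem scaleNorm_const_mul_le {q : ℝ≥0∞} (hq : 0 < q) {K : ℝ≥0∞} (hK : K ≠ ∞)
    (φ : ℝ → ℝ≥0∞) : scaleNorm q (fun t => K * φ t) ≤ K * scaleNorm q φ := by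
  unfold scaleNorm
  split_ifs with hqt
  · exact iSup₂_le fun t ht =>
      mul_le_mul' le_rfl (le_iSup₂ (f := fun t (_ : t ∈ Ioi (0 : ℝ)) => φ t) t ht)
  · have hq' : 0 < q.toReal := ENNReal.toReal_pos hq.ne' hqt
    simp_rw [ENNReal.mul_rpow_of_nonneg _ _ hq'.le, mul_assoc]
    rw [lintegral_const_mul' _ _ (ENNReal.rpow_ne_top_of_nonneg hq'.le hK),
      ENNReal.mul_rpow_of_nonneg _ _ (by positivity), ← ENNReal.rpow_mul,
      mul_one_div_cancel hq'.ne', ENNReal.rpow_one]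

theorem functionalI_le_functionalC (s : ℝ) {σ : ℝ} (hσ : 0 < σ) (t : ℝ) (x : X) :
    functionalI s σ μ u t x ≤ functionalC s σ μ u t x := by
  unfold functionalI functionalC
  gcongr
  exact bestConst_le_pointOsc σ u x t

theorem functionalI_le_functionalA (s : ℝ) {σ : ℝ} (hσ : 0 < σ) (t : ℝ) (x : X) :
    functionalI s σ μ u t x ≤ functionalA s σ μ u t x := by
  unfold functionalI functionalA
  gcongr
  exact iInf_le _ _

theorem functionalI_le_functionalS (s ε σ : ℝ) {t : ℝ} (ht : 0 < t) (x : X) :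
    functionalI s σ μ u t x ≤ functionalS s ε σ μ u t x := by
  unfold functionalI functionalS
  calc _ = ENNReal.ofReal (t ^ (ε - s)) *
        (ENNReal.ofReal (t ^ (-ε)) * bestConst σ μ u t x ^ (1 / σ)) := by
        rw [← mul_assoc, ← ENNReal.ofReal_mul (by positivity), ← Real.rpow_add ht]
        congr 3
        ring
    _ ≤ _ := by
        gcongr
        exact le_iSup₂ (f := fun r (_ : r ∈ Ioc (0 : ℝ) t) =>
          ENNReal.ofReal (r ^ (-ε)) * bestConst σ μ u r x ^ (1 / σ)) t ⟨ht, le_rfl⟩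

theorem IsDoubling.laverage_rpow_le (hμ : IsDoubling μ C₁ n) {θ : ℝ} (h0 : 0 < θ) (h1 : θ ≤ 1)
    {g : X → ℝ≥0∞} (hg : Measurable g) (x : X) {r : ℝ} (hr : 0 < r) :
    ⨍⁻ y in ball x r, g y ^ θ ∂μ ≤ (⨍⁻ y in ball x r, g y ∂μ) ^ θ := by
  have : IsFiniteMeasure (μ.restrict (ball x r)) :=
    isFiniteMeasure_restrict.2 (hμ.ball_ne_top x hr)
  have : NeZero (μ.restrict (ball x r)) := ⟨by simpa using hμ.ball_ne_zero x hr⟩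
  have h := eLpNorm'_le_eLpNorm'_of_exponent_le h0 h1
    (((μ.restrict (ball x r)) univ)⁻¹ • μ.restrict (ball x r)) (f := g) hg.aestronglyMeasurable
  simp only [eLpNorm', enorm_eq_self, ENNReal.rpow_one, div_one] at h
  calc ⨍⁻ y in ball x r, g y ^ θ ∂μ = ((⨍⁻ y in ball x r, g y ^ θ ∂μ) ^ (1 / θ)) ^ θ := by
        rw [← ENNReal.rpow_mul, one_div_mul_cancel h0.ne', ENNReal.rpow_one]
    _ ≤ _ := by gcongr; exact h

theorem IsDoubling.laverage_rpow_inv_mono (hμ : IsDoubling μ C₁ n) {a b : ℝ} (ha : 0 < a)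
    (hab : a ≤ b) {g : X → ℝ≥0∞} (hg : Measurable g) (x : X) {r : ℝ} (hr : 0 < r) :
    (⨍⁻ y in ball x r, g y ^ a ∂μ) ^ (1 / a) ≤ (⨍⁻ y in ball x r, g y ^ b ∂μ) ^ (1 / b) := by
  have hb := ha.trans_le hab
  have h := hμ.laverage_rpow_le (θ := a / b) (by positivity) ((div_le_one hb).2 hab)
    (hg.pow_const b) x hr
  simp_rw [rpow_rpow_div hb] at h
  calc _ ≤ ((⨍⁻ y in ball x r, g y ^ b ∂μ) ^ (a / b)) ^ (1 / a) := by gcongr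
    _ = _ := by rw [← ENNReal.rpow_mul]; congr 1; field_simp

theorem IsDoubling.functionalC_mono (hμ : IsDoubling μ C₁ n) (s : ℝ) {a b : ℝ} (ha : 0 < a)
    (hab : a ≤ b) (hu : Measurable u) {t : ℝ} (ht : 0 < t) (x : X) :
    functionalC s a μ u t x ≤ functionalC s b μ u t x := by
  refine mul_le_mul' le_rfl ?_
  exact hμ.laverage_rpow_inv_mono ha hab (g := fun y => ‖u x - u y‖ₑ) (by fun_prop) x ht

theorem IsDoubling.functionalA_mono (hμ : IsDoubling μ C₁ n) (s : ℝ) {a b : ℝ} (ha : 0 < a)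
    (hab : a ≤ b) (hu : Measurable u) {t : ℝ} (ht : 0 < t) (x : X) :
    functionalA s a μ u t x ≤ functionalA s b μ u t x := by
  refine mul_le_mul' le_rfl ?_
  exact hμ.laverage_rpow_inv_mono ha hab (g := fun y => ‖u y - ⨍ z in ball x t, u z ∂μ‖ₑ)
    (by fun_prop) x ht

/-- For σ ≥ 1, Jensen bounds |u_B - c|^σ by the average of |u - c|^σ, so the mean is an optimal
constant up to a factor. -/
theorem IsDoubling.functionalA_le_functionalI (hμ : IsDoubling μ C₁ n) (s : ℝ) {σ : ℝ}
    (hσ : 1 ≤ σ) (hu : Measurable u) (hloc : MemLpLoc u 1 μ) {t : ℝ} (ht : 0 < t) (x : X) :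
    functionalA s σ μ u t x ≤ (2 ^ (σ + 1)) ^ (1 / σ) * functionalI s σ μ u t x := by
  have hσ0 : 0 < σ := one_pos.trans_le hσ
  unfold functionalA functionalI
  rw [mul_left_comm, ← ENNReal.mul_rpow_of_nonneg _ _ (by positivity)]
  gcongr
  rw [bestConst, ENNReal.mul_iInf_of_ne (by simp) (two_rpow_ne_top _)]
  refine le_iInf fun c => ?_
  set m := ⨍ z in ball x t, u z ∂μ
  have : IsFiniteMeasure (μ.restrict (ball x t)) :=
    isFiniteMeasure_restrict.2 (hμ.ball_ne_top x ht)
  have : NeZero (μ.restrict (ball x t)) := ⟨by simpa using hμ.ball_ne_zero x ht⟩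
  have hm : ‖m - c‖ₑ ^ σ ≤ ⨍⁻ y in ball x t, ‖u y - c‖ₑ ^ σ ∂μ := by
    have h1 : m - c = ⨍ z in ball x t, (u z - c) ∂μ := by
      have hint : Integrable u (((μ.restrict (ball x t)) univ)⁻¹ • μ.restrict (ball x t)) :=
        (memLp_one_iff_integrable.1 (hloc x t ht)).to_average
      have hc : ⨍ _ in ball x t, c ∂μ = c := average_const _ c
      simp only [m, average] at hc ⊢
      rw [integral_sub hint (integrable_const c), hc]
    have h2 : ‖m - c‖ₑ ≤ ⨍⁻ y in ball x t, ‖u y - c‖ₑ ∂μ := by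
      rw [h1]; exact enorm_integral_le_lintegral_enorm _
    have h3 := hμ.laverage_rpow_inv_mono one_pos hσ (g := fun y => ‖u y - c‖ₑ) (by fun_prop) x ht
    simp only [ENNReal.rpow_one, div_one] at h3
    calc ‖m - c‖ₑ ^ σ ≤ ((⨍⁻ y in ball x t, ‖u y - c‖ₑ ^ σ ∂μ) ^ (1 / σ)) ^ σ := by
          gcongr; exact h2.trans h3
      _ = _ := by rw [← ENNReal.rpow_mul, one_div_mul_cancel hσ0.ne', ENNReal.rpow_one]
  calc ⨍⁻ y in ball x t, ‖u y - m‖ₑ ^ σ ∂μ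
      ≤ ⨍⁻ y in ball x t, 2 ^ σ * (‖u y - c‖ₑ ^ σ + ‖m - c‖ₑ ^ σ) ∂μ :=
        laverage_mono fun y => by
          rw [enorm_sub_comm m c]; exact enorm_sub_rpow_le hσ0.le _ _ _
    _ = 2 ^ σ * (⨍⁻ y in ball x t, ‖u y - c‖ₑ ^ σ ∂μ + ‖m - c‖ₑ ^ σ) := by
        rw [laverage_const_mul (two_rpow_ne_top _), laverage_add_left (by fun_prop),
          hμ.laverage_ball_const x ht]
    _ ≤ 2 ^ σ * (⨍⁻ y in ball x t, ‖u y - c‖ₑ ^ σ ∂μ + ⨍⁻ y in ball x t, ‖u y - c‖ₑ ^ σ ∂μ) := by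
        gcongr
    _ = _ := by rw [two_rpow_add, ENNReal.rpow_one, mul_assoc, two_mul]

/-- The seminorm measuring the oscillations of order `σ`. -/
noncomputable def oscSeminorm (s σ : ℝ) (p q : ℝ≥0∞) (μ : Measure X) (u : X → ℝ) : ℝ≥0∞ :=
  scaleNorm q fun t => ENNReal.ofReal (t ^ (-s)) * oscNorm σ p μ u t

theorem IsDoubling.functionalI_seminorm_le (hμ : IsDoubling μ C₁ n) (s : ℝ) {σ : ℝ} (hσ : 0 < σ)
    {p : ℝ≥0∞} (hp : p ≠ 0) (q : ℝ≥0∞) (u : X → ℝ) :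
    besovTypeNorm p q μ (functionalI s σ μ u) ≤ oscSeminorm s σ p q μ u := by
  refine scaleNorm_mono fun t ht => ?_
  rw [oscNorm, ← eLpNorm_const_mul_ennreal hp ENNReal.ofReal_ne_top]
  refine eLpNorm_le_of_ae_le (Eventually.of_forall fun x => ?_)
  unfold functionalI
  gcongr
  exact hμ.bestConst_le_doubleOsc σ u x ht

theorem IsDoubling.oscSeminorm_le_functionalI (hμ : IsDoubling μ C₁ n) (s : ℝ) {σ : ℝ}
    (hσ : 0 < σ) {p q : ℝ≥0∞} (hp : p ≠ 0) (hq : 0 < q) (hu : Measurable u) :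
    oscSeminorm s σ p q μ u ≤
      (2 ^ (σ + 1)) ^ (1 / σ) * besovTypeNorm p q μ (functionalI s σ μ u) := by
  have hK : ((2 : ℝ≥0∞) ^ (σ + 1)) ^ (1 / σ) ≠ ∞ :=
    ENNReal.rpow_ne_top_of_nonneg (by positivity) (two_rpow_ne_top _)
  refine le_trans (scaleNorm_mono fun t ht => ?_) (scaleNorm_const_mul_le hq hK _)
  rw [oscNorm, ← eLpNorm_const_mul_ennreal hp ENNReal.ofReal_ne_top,
    ← eLpNorm_const_mul_ennreal hp hK]
  refine eLpNorm_le_of_ae_le (Eventually.of_forall fun x => ?_)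
  unfold functionalI
  rw [mul_left_comm, ← ENNReal.mul_rpow_of_nonneg _ _ (by positivity)]
  gcongr
  exact hμ.doubleOsc_le_bestConst hσ.le hu x ht

theorem IsDoubling.exists_mem_ball_of_ae (hμ : IsDoubling μ C₁ n) {P : X → Prop}
    (h : ∀ᵐ x ∂μ, P x) (x : X) {r : ℝ} (hr : 0 < r) : ∃ y ∈ ball x r, P y := by
  by_contra! hc
  exact hμ.ball_ne_zero x hr (measure_mono_null (fun y hy => hc y hy) h)

/-- Otherwise φ = ∞ on a half-line. Finiteness at arbitrarily large scales is what yields local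
integrability on any given ball. -/
theorem exists_lt_top_of_scaleNorm_lt_top {q : ℝ≥0∞} (hq : 0 < q) {s : ℝ} {φ : ℝ → ℝ≥0∞}
    (h : scaleNorm q (fun t => ENNReal.ofReal (t ^ (-s)) * φ t) < ∞) (R : ℝ) :
    ∃ t, R < t ∧ 0 < t ∧ φ t < ∞ := by
  by_contra! hc
  have htop : ∀ t ∈ Ioi (max R 0), ENNReal.ofReal (t ^ (-s)) * φ t = ∞ := by
    intro t ht
    rw [mem_Ioi, max_lt_iff] at ht
    rw [top_le_iff.1 (hc t ht.1 ht.2), ENNReal.mul_top]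
    have := Real.rpow_pos_of_pos ht.2 (-s)
    simpa using this
  refine h.ne (top_le_iff.1 ?_)
  unfold scaleNorm
  split_ifs with hqt
  · have h0 : (0 : ℝ) < max R 0 + 1 := by positivity
    rw [← htop (max R 0 + 1) (by simp)]
    exact le_iSup₂ (f := fun t (_ : t ∈ Ioi (0 : ℝ)) => ENNReal.ofReal (t ^ (-s)) * φ t) _ h0
  · have hq' : 0 < q.toReal := ENNReal.toReal_pos hq.ne' hqt
    have : ∞ ≤ ∫⁻ t in Ioi (0 : ℝ),
        (ENNReal.ofReal (t ^ (-s)) * φ t) ^ q.toReal * ENNReal.ofReal t⁻¹ := by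
      calc ∞ = ∫⁻ _ in Ioi (max R 0), (∞ : ℝ≥0∞) := by simp
        _ ≤ ∫⁻ t in Ioi (max R 0),
            (ENNReal.ofReal (t ^ (-s)) * φ t) ^ q.toReal * ENNReal.ofReal t⁻¹ := by
            refine lintegral_mono_ae ((ae_restrict_iff' measurableSet_Ioi).2
              (Eventually.of_forall fun t ht => ?_))
            have ht' : 0 < t := (le_max_right _ _).trans_lt ht
            rw [htop t ht, ENNReal.top_rpow_of_pos hq', ENNReal.top_mul (by simpa using ht')]
        _ ≤ _ := lintegral_mono_set (Ioi_subset_Ioi (le_max_right _ _))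
    rw [top_le_iff.1 this, ENNReal.top_rpow_of_pos (by positivity)]

theorem functionalC_norm_eq {p : ℝ≥0∞} (hp : p ≠ 0) (hpt : p ≠ ∞) (s : ℝ) (u : X → ℝ) (t : ℝ) :
    eLpNorm (functionalC s p.toReal μ u t) p μ =
      ENNReal.ofReal (t ^ (-s)) * differenceModulus u p μ t := by
  have hP : 0 < p.toReal := ENNReal.toReal_pos hp hpt
  unfold functionalC
  rw [eLpNorm_const_mul_ennreal hp ENNReal.ofReal_ne_top, eLpNorm_eq_lintegral hp hpt,
    differenceModulus, if_neg hpt]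
  simp_rw [← ENNReal.rpow_mul, one_div_mul_cancel hP.ne', ENNReal.rpow_one]

/-- The condition σ < p_*(s) in the form used by Hardy's inequality. The maximum provides an order
at least p; if p ≥ n/s the left side is below n ≤ sp. -/
theorem sobolev_exponent_lt {n s σ : ℝ} (hn : 0 < n) (hs : 0 < s) {p : ℝ≥0∞} (hp : p ≠ 0)
    (hpt : p ≠ ∞) (hσ : ENNReal.ofReal σ < pStar n s p) :
    n * (1 - p.toReal / max σ p.toReal) < s * p.toReal := by
  have hP : 0 < p.toReal := ENNReal.toReal_pos hp hpt
  set P := p.toReal with hPdef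
  have hτ : 0 < max σ P := hP.trans_le (le_max_right _ _)
  by_cases h : p < ENNReal.ofReal (n / s)
  · rw [pStar, if_pos h, ← hPdef] at hσ
    have hPn : P < n / s := (ENNReal.lt_ofReal_iff_toReal_lt hpt).1 h
    have hd : 0 < n - P * s := by rw [lt_div_iff₀ hs] at hPn; linarith
    rw [ENNReal.ofReal_lt_ofReal_iff (by positivity), lt_div_iff₀ hd] at hσ
    rcases le_total σ P with h1 | h1
    · rw [max_eq_right h1, div_self hP.ne', sub_self, mul_zero]; positivity
    · have hσ0 : 0 < σ := hP.trans_le h1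
      rw [max_eq_left h1, one_sub_div hσ0.ne', ← mul_div_assoc, div_lt_iff₀ hσ0]
      linarith
  · have hPn : n / s ≤ P := by
      rw [not_lt, ENNReal.ofReal_le_iff_le_toReal hpt] at h; exact h
    rw [div_le_iff₀ hs] at hPn
    have : 0 < P / max σ P := by positivity
    nlinarith

/-- For p < n/s, np > n - ps rearranges to p > n/(n+s). -/
theorem one_lt_pStar {n s : ℝ} (hn : 0 < n) (hs : 0 < s) {p : ℝ≥0∞}
    (hp : ENNReal.ofReal (n / (n + s)) < p) : 1 < pStar n s p := by
  rw [pStar]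
  split_ifs with h
  · have hpt : p ≠ ∞ := h.ne_top
    have h1 : p.toReal < n / s := (ENNReal.lt_ofReal_iff_toReal_lt hpt).1 h
    have h2 : n / (n + s) < p.toReal := (ENNReal.ofReal_lt_iff_lt_toReal (by positivity) hpt).1 hp
    rw [lt_div_iff₀ hs] at h1
    rw [div_lt_iff₀ (by positivity)] at h2
    rw [ENNReal.one_lt_ofReal, one_lt_div (by linarith)]
    linarith
  · exact ENNReal.one_lt_top

theorem IsDoubling.functionalC_seminorm_le (hμ : IsDoubling μ C₁ n) (s : ℝ) {σ : ℝ} (hσ : 0 < σ)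
    {p : ℝ≥0∞} (hσp : ENNReal.ofReal σ ≤ p) (q : ℝ≥0∞) (hu : Measurable u) :
    besovTypeNorm p q μ (functionalC s σ μ u) ≤ besovNorm s p q μ u := by
  have hp : p ≠ 0 := fun h => by simp [h, hσ.not_ge] at hσp
  rw [besovNorm_eq_scaleNorm]
  refine scaleNorm_mono fun t ht => ?_
  by_cases hpt : p = ∞
  · subst hpt
    unfold functionalC
    rw [eLpNorm_const_mul_ennreal hp ENNReal.ofReal_ne_top]
    gcongr
    simp only [eLpNorm_exponent_top, eLpNormEssSup, enorm_eq_self, differenceModulus, if_true]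
    refine essSup_mono_ae (Eventually.of_forall fun x => ?_)
    set S := essSup (fun y => ‖u x - u y‖ₑ) (μ.restrict (ball x t))
    calc (⨍⁻ y in ball x t, ‖u x - u y‖ₑ ^ σ ∂μ) ^ (1 / σ)
        ≤ (⨍⁻ _ in ball x t, S ^ σ ∂μ) ^ (1 / σ) := by
          gcongr ?_ ^ _
          refine laverage_mono_ae ?_
          filter_upwards [ENNReal.ae_le_essSup fun y => ‖u x - u y‖ₑ] with y hy
          gcongr
      _ = S := by
          rw [hμ.laverage_ball_const x ht, ← ENNReal.rpow_mul, mul_one_div_cancel hσ.ne',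
            ENNReal.rpow_one]
  · rw [← functionalC_norm_eq hp hpt]
    refine eLpNorm_le_of_ae_le (Eventually.of_forall fun x => ?_)
    exact hμ.functionalC_mono s hσ ((ENNReal.ofReal_le_iff_le_toReal hpt).1 hσp) hu ht x

theorem IsDoubling.oscSeminorm_le_besovNorm_of_le (hμ : IsDoubling μ C₁ n) (s : ℝ) {σ : ℝ}
    (hσ : 0 < σ) {p q : ℝ≥0∞} (hσp : ENNReal.ofReal σ ≤ p) (hq : 0 < q) (hu : Measurable u) :
    oscSeminorm s σ p q μ u ≤ (2 ^ (σ + 1)) ^ (1 / σ) * besovNorm s p q μ u := by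
  have hp : p ≠ 0 := fun h => by simp [h, hσ.not_ge] at hσp
  refine (hμ.oscSeminorm_le_functionalI s hσ hp hq hu).trans ?_
  gcongr
  exact (besovTypeNorm_mono fun t _ x => functionalI_le_functionalC s hσ t x).trans
    (hμ.functionalC_seminorm_le s hσ hσp q hu)

variable {s σ : ℝ} {p q : ℝ≥0∞}

/-- Jensen raises σ to τ ≥ 1, where means are comparable to best constants and u is locally
integrable. -/
theorem IsDoubling.spaceI_embeds_spaceA (hμ : IsDoubling μ C₁ n) {τ : ℝ} (hσ : 0 < σ)
    (hστ : σ ≤ τ) (hτ : 1 ≤ τ) (hp : p ≠ 0) (hq : 0 < q) :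
    (spaceI s τ p q μ).Embeds (spaceA s σ p q μ) := by
  have hτ0 := one_pos.trans_le hτ
  have hK : ((2 : ℝ≥0∞) ^ (τ + 1)) ^ (1 / τ) ≠ ∞ :=
    ENNReal.rpow_ne_top_of_nonneg (by positivity) (two_rpow_ne_top _)
  refine FunctionSpace.embeds_of_le hK (fun u hu => hu.2) fun u hu => ?_
  have hloc : MemLpLoc u 1 μ := hu.1.mono_exponent hμ (by simpa using hτ)
  refine ⟨fun hfin => ⟨hu.1.mono_exponent hμ (ENNReal.ofReal_le_ofReal hστ), hloc, hfin⟩, ?_⟩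
  have hae := hu.1.aestronglyMeasurable
  obtain ⟨v, hv, huv⟩ := hae.aemeasurable
  simp only [spaceA, spaceI]
  rw [functionalA_congr huv, functionalI_congr huv]
  refine le_trans (scaleNorm_mono fun t ht => ?_) (scaleNorm_const_mul_le hq hK _)
  rw [← eLpNorm_const_mul_ennreal hp hK]
  refine eLpNorm_le_of_ae_le (Eventually.of_forall fun x => ?_)
  exact (hμ.functionalA_mono s hσ hστ hv ht x).trans
    (hμ.functionalA_le_functionalI s hτ hv (hloc.congr huv) ht x)

theorem spaceC_embeds_spaceI (hσ : 0 < σ) : (spaceC s σ p q μ).Embeds (spaceI s σ p q μ) :=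
  FunctionSpace.embeds_of_le ENNReal.one_ne_top (fun _ hu => hu.2) fun u hu =>
    ⟨fun hfin => ⟨hu.1, hfin⟩, by
      rw [one_mul]; exact besovTypeNorm_mono fun t _ x => functionalI_le_functionalC s hσ t x⟩

theorem spaceA_embeds_spaceI (hσ : 0 < σ) : (spaceA s σ p q μ).Embeds (spaceI s σ p q μ) :=
  FunctionSpace.embeds_of_le ENNReal.one_ne_top (fun _ hu => hu.2.2) fun u hu =>
    ⟨fun hfin => ⟨hu.1, hfin⟩, by
      rw [one_mul]; exact besovTypeNorm_mono fun t _ x => functionalI_le_functionalA s hσ t x⟩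

theorem spaceS_embeds_spaceI (ε : ℝ) : (spaceS s ε σ p q μ).Embeds (spaceI s σ p q μ) :=
  FunctionSpace.embeds_of_le ENNReal.one_ne_top (fun _ hu => hu.2) fun u hu =>
    ⟨fun hfin => ⟨hu.1, hfin⟩, by
      rw [one_mul]
      exact besovTypeNorm_mono fun t ht x => functionalI_le_functionalS s ε σ ht x⟩

variable [BorelSpace X]

theorem IsDoubling.doubleOsc_mono_exponent (hμ : IsDoubling μ C₁ n) {a b : ℝ} (ha : 0 < a)
    (hab : a ≤ b) (hu : Measurable u) {t : ℝ} (ht : 0 < t) (x : X) :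
    doubleOsc a μ u x t ^ (1 / a) ≤ doubleOsc b μ u x t ^ (1 / b) := by
  have := hμ.secondCountableTopology
  have := hμ.sigmaFinite
  have hb := ha.trans_le hab
  have hm : Measurable fun y => ⨍⁻ z in ball x t, ‖u y - u z‖ₑ ^ b ∂μ :=
    measurable_laverage_ball (c := fun _ : X => x) (r := fun _ => t)
      (f := fun y z => ‖u y - u z‖ₑ ^ b) measurable_const measurable_const (by fun_prop)
  calc doubleOsc a μ u x t ^ (1 / a)
      = (⨍⁻ y in ball x t, ((⨍⁻ z in ball x t, ‖u y - u z‖ₑ ^ a ∂μ) ^ (1 / a)) ^ a ∂μ) ^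
          (1 / a) := by
        simp_rw [← ENNReal.rpow_mul, one_div_mul_cancel ha.ne', ENNReal.rpow_one]; rfl
    _ ≤ (⨍⁻ y in ball x t, ((⨍⁻ z in ball x t, ‖u y - u z‖ₑ ^ b ∂μ) ^ (1 / b)) ^ a ∂μ) ^
          (1 / a) := by
        refine ENNReal.rpow_le_rpow (laverage_mono fun y => ENNReal.rpow_le_rpow ?_ ha.le)
          (by positivity)
        exact hμ.laverage_rpow_inv_mono ha hab (g := fun z => ‖u y - u z‖ₑ) (by fun_prop) x ht
    _ ≤ (⨍⁻ y in ball x t, ((⨍⁻ z in ball x t, ‖u y - u z‖ₑ ^ b ∂μ) ^ (1 / b)) ^ b ∂μ) ^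
          (1 / b) := hμ.laverage_rpow_inv_mono ha hab (hm.pow_const _) x ht
    _ = _ := by
        simp_rw [← ENNReal.rpow_mul, one_div_mul_cancel hb.ne', ENNReal.rpow_one]; rfl

theorem IsDoubling.oscSeminorm_mono (hμ : IsDoubling μ C₁ n) (s : ℝ) {a b : ℝ} (ha : 0 < a)
    (hab : a ≤ b) (p q : ℝ≥0∞) (hu : Measurable u) :
    oscSeminorm s a p q μ u ≤ oscSeminorm s b p q μ u :=
  scaleNorm_mono fun t ht => by
    gcongr
    exact eLpNorm_le_of_ae_le
      (Eventually.of_forall fun x => hμ.doubleOsc_mono_exponent ha hab hu ht x)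

/-- At some large scale t the oscillation is finite almost everywhere, hence at a point x of the
given ball; B(x,t) contains that ball and u - c is in L^τ there for some c. -/
theorem IsDoubling.memLpLoc_of_oscSeminorm_lt_top (hμ : IsDoubling μ C₁ n) {s τ : ℝ} (hτ : 0 < τ)
    {p q : ℝ≥0∞} (hp : p ≠ 0) (hq : 0 < q) (hu : Measurable u)
    (h : oscSeminorm s τ p q μ u < ∞) : MemLpLoc u (ENNReal.ofReal τ) μ := by
  have := hμ.secondCountableTopology
  have := hμ.sigmaFinite
  intro x₀ r hr
  obtain ⟨t, hrt, ht, hfin⟩ := exists_lt_top_of_scaleNorm_lt_top hq h (2 * r)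
  have hm : Measurable fun x => doubleOsc τ μ u x t ^ (1 / τ) :=
    ((measurable_doubleOsc hu τ).comp (measurable_id.prodMk measurable_const)).pow_const _
  have hae : ∀ᵐ x ∂μ, doubleOsc τ μ u x t ^ (1 / τ) < ∞ := by
    by_cases hpt : p = ∞
    · subst hpt
      filter_upwards [ENNReal.ae_le_essSup fun x => doubleOsc τ μ u x t ^ (1 / τ)] with x hx
      exact hx.trans_lt (by simpa [oscNorm, eLpNormEssSup] using hfin)
    · have hP := ENNReal.toReal_pos hp hpt
      have h2 := ENNReal.rpow_lt_top_of_nonneg hP.le hfin.ne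
      rw [oscNorm, eLpNorm_rpow_eq_lintegral hp hpt] at h2
      filter_upwards [ae_lt_top (hm.pow_const _) h2.ne] with x hx
      exact (ENNReal.rpow_lt_top_iff_of_pos hP).1 hx
  obtain ⟨x, hx, hxfin⟩ := hμ.exists_mem_ball_of_ae hae x₀ hr
  have hb : bestConst τ μ u t x < ∞ := (hμ.bestConst_le_doubleOsc τ u x ht).trans_lt
    ((ENNReal.rpow_lt_top_iff_of_pos (by positivity)).1 hxfin)
  obtain ⟨c, hc⟩ := iInf_lt_iff.1 hb
  have hfinm : IsFiniteMeasure (μ.restrict (ball x t)) :=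
    isFiniteMeasure_restrict.2 (hμ.ball_ne_top x ht)
  have hmem : MemLp (fun y => u y - c) (ENNReal.ofReal τ) (μ.restrict (ball x t)) := by
    refine ⟨(hu.sub_const c).aestronglyMeasurable, ?_⟩
    rw [eLpNorm_eq_lintegral_rpow_enorm_toReal (by simpa using hτ) ENNReal.ofReal_ne_top,
      ENNReal.toReal_ofReal hτ.le]
    refine ENNReal.rpow_lt_top_of_nonneg (by positivity) ?_
    rw [setLAverage_eq] at hc
    intro h
    rw [h, ENNReal.top_div_of_ne_top (hμ.ball_ne_top x ht)] at hc
    exact lt_irrefl _ hc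
  have hsub : ball x₀ r ⊆ ball x t :=
    ball_subset_ball' (by rw [dist_comm]; linarith [mem_ball.1 hx])
  have h3 : MemLp u (ENNReal.ofReal τ) (μ.restrict (ball x t)) := by
    have := hmem.add (memLp_const c)
    refine this.congr_norm hu.aestronglyMeasurable (Eventually.of_forall fun y => ?_)
    simp
  exact h3.mono_measure (Measure.restrict_mono hsub le_rfl)

/-- Besov norms are controlled by oscillations of any order. -/
theorem IsDoubling.exists_besovNorm_le_oscSeminorm (hμ : IsDoubling μ C₁ n) {σ s : ℝ}
    (hσ : 0 < σ) (hs : 0 < s) {p q : ℝ≥0∞} (hp : p ≠ 0) (hq : 0 < q) :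
    ∃ K : ℝ≥0∞, K ≠ ∞ ∧ ∀ u : X → ℝ, Measurable u → MemLpLoc u (ENNReal.ofReal σ) μ →
      besovNorm s p q μ u ≤ K * oscSeminorm s σ p q μ u := by
  -- Telescoping needs order at most 1; oscillations increase with the order.
  have h0 : 0 < min σ 1 := lt_min hσ one_pos
  obtain ⟨K, hK, h⟩ := hμ.exists_scaleNorm_differenceModulus_le h0 (min_le_right _ _) hs hp hq
  refine ⟨K, hK, fun u hu hloc => ?_⟩
  rw [besovNorm_eq_scaleNorm]
  refine (h u hu (hloc.mono_exponent hμ (ENNReal.ofReal_le_ofReal (min_le_left _ _)))).trans ?_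
  gcongr
  exact hμ.oscSeminorm_mono s h0 (min_le_left _ _) p q hu

/-- For finite p: Jensen gives the bound at order min(p,1), the Sobolev step raises it to max(σ,p),
and monotonicity returns to σ. -/
theorem IsDoubling.exists_oscSeminorm_le_besovNorm (hμ : IsDoubling μ C₁ n) {σ s : ℝ}
    (hσ : 0 < σ) (hs : 0 < s) {p q : ℝ≥0∞} (hp : p ≠ 0) (hq : 0 < q)
    (hσp : ENNReal.ofReal σ < pStar n s p) :
    ∃ K : ℝ≥0∞, K ≠ ∞ ∧ ∀ u : X → ℝ, Measurable u → MemLpLoc u p μ →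
      oscSeminorm s σ p q μ u ≤ K * besovNorm s p q μ u := by
  have hne : ∀ τ : ℝ, 0 < τ → ((2 : ℝ≥0∞) ^ (τ + 1)) ^ (1 / τ) ≠ ∞ := fun τ hτ =>
    ENNReal.rpow_ne_top_of_nonneg (by positivity) (two_rpow_ne_top _)
  by_cases hpt : p = ∞
  · subst hpt
    exact ⟨_, hne σ hσ, fun u hu _ => hμ.oscSeminorm_le_besovNorm_of_le s hσ le_top hq hu⟩
  · have hP : 0 < p.toReal := ENNReal.toReal_pos hp hpt
    have h0 : 0 < min p.toReal 1 := lt_min hP one_pos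
    have hle : ENNReal.ofReal (min p.toReal 1) ≤ p :=
      (ENNReal.ofReal_le_iff_le_toReal hpt).2 (min_le_left _ _)
    obtain ⟨K, hK, h⟩ := hμ.exists_scaleNorm_oscNorm_le (s := s) h0 (min_le_right _ _) hp hpt
      (le_max_right σ _) hq (sobolev_exponent_lt hμ.exponent_pos hs hp hpt hσp)
    refine ⟨_, ENNReal.mul_ne_top hK (hne _ h0), fun u hu hloc => ?_⟩
    refine (hμ.oscSeminorm_mono s hσ (le_max_left _ p.toReal) p q hu).trans
      ((h u hu (hloc.mono_exponent hμ hle)).trans ?_)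
    rw [mul_assoc]
    gcongr
    exact hμ.oscSeminorm_le_besovNorm_of_le s h0 hle hq hu

/-- For p < ∞ use oscillations of order p. For p = ∞, some point x of the ball has u(x) - u
essentially bounded on a larger ball. -/
theorem IsDoubling.memLpLoc_of_besovNorm_lt_top (hμ : IsDoubling μ C₁ n) {s : ℝ}
    {p q : ℝ≥0∞} (hp : p ≠ 0) (hq : 0 < q) (hu : Measurable u)
    (h : besovNorm s p q μ u < ∞) : MemLpLoc u p μ := by
  by_cases hpt : p = ∞
  · subst hpt
    intro x₀ r hr
    rw [besovNorm_eq_scaleNorm] at h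
    obtain ⟨t, hrt, ht, hfin⟩ := exists_lt_top_of_scaleNorm_lt_top hq h (2 * r)
    simp only [differenceModulus, if_true] at hfin
    obtain ⟨x, hx, hxfin⟩ := hμ.exists_mem_ball_of_ae (ENNReal.ae_le_essSup _) x₀ hr
    have hS := hxfin.trans_lt hfin
    set S := essSup (fun y => ‖u x - u y‖ₑ) (μ.restrict (ball x t))
    have hsub : ball x₀ r ⊆ ball x t :=
      ball_subset_ball' (by rw [dist_comm]; linarith [mem_ball.1 hx])
    have h3 : MemLp u ∞ (μ.restrict (ball x t)) := by
      refine memLp_top_of_bound hu.aestronglyMeasurable (‖u x‖ + S.toReal) ?_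
      filter_upwards [ENNReal.ae_le_essSup fun y => ‖u x - u y‖ₑ] with y hy
      have h4 : ‖u x - u y‖ ≤ S.toReal := by
        rw [← toReal_enorm]; exact ENNReal.toReal_mono hS.ne hy
      have h5 : u y = u x - (u x - u y) := by ring
      calc ‖u y‖ = ‖u x - (u x - u y)‖ := by rw [← h5]
        _ ≤ ‖u x‖ + ‖u x - u y‖ := norm_sub_le _ _
        _ ≤ _ := by gcongr
    exact h3.mono_measure (Measure.restrict_mono hsub le_rfl)
  · have hP : 0 < p.toReal := ENNReal.toReal_pos hp hpt
    have h1 := hμ.oscSeminorm_le_besovNorm_of_le s hP (ENNReal.ofReal_toReal_le) hq hu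
    have h2 := hμ.memLpLoc_of_oscSeminorm_lt_top hP hp hq hu (h1.trans_lt
      (ENNReal.mul_lt_top (ENNReal.rpow_lt_top_of_nonneg (by positivity) (two_rpow_ne_top _)) h))
    rwa [ENNReal.ofReal_toReal hpt] at h2

theorem IsDoubling.spaceI_embeds_besovSpace (hμ : IsDoubling μ C₁ n) (hs : 0 < s) (hp : p ≠ 0)
    (hq : 0 < q) (hσ : 0 < σ) : (spaceI s σ p q μ).Embeds (besovSpace s p q μ) := by
  obtain ⟨K, hK, h⟩ := hμ.exists_besovNorm_le_oscSeminorm hσ hs hp hq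
  refine FunctionSpace.embeds_of_le (ENNReal.mul_ne_top hK (ENNReal.rpow_ne_top_of_nonneg
    (by positivity) (two_rpow_ne_top (σ + 1))) : K * (2 ^ (σ + 1)) ^ (1 / σ) ≠ ∞)
    (fun u hu => hu.2) fun u hu => ?_
  have hae := hu.1.aestronglyMeasurable
  obtain ⟨v, hv, huv⟩ := hae.aemeasurable
  refine ⟨fun hfin => ⟨?_, hfin⟩, ?_⟩
  · have hfin' : besovNorm s p q μ v < ∞ := besovNorm_congr huv s p q ▸ hfin
    exact (hμ.memLpLoc_of_besovNorm_lt_top hp hq hv hfin').congr huv.symm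
  · simp only [besovSpace, spaceI]
    rw [besovNorm_congr huv, functionalI_congr huv, mul_assoc]
    refine (h v hv (hu.1.congr huv)).trans ?_
    gcongr
    exact hμ.oscSeminorm_le_functionalI s hσ hp hq hv

theorem IsDoubling.besovSpace_embeds_spaceI (hμ : IsDoubling μ C₁ n) (hs : 0 < s) (hp : p ≠ 0)
    (hq : 0 < q) (hσ : 0 < σ) (hσp : ENNReal.ofReal σ < pStar n s p) :
    (besovSpace s p q μ).Embeds (spaceI s σ p q μ) := by
  obtain ⟨K, hK, h⟩ := hμ.exists_oscSeminorm_le_besovNorm hσ hs hp hq hσp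
  refine FunctionSpace.embeds_of_le hK (fun u hu => hu.2) fun u hu => ?_
  have hae := hu.1.aestronglyMeasurable
  obtain ⟨v, hv, huv⟩ := hae.aemeasurable
  have h1 : oscSeminorm s σ p q μ v ≤ K * besovNorm s p q μ u := by
    rw [besovNorm_congr huv]; exact h v hv (hu.1.congr huv)
  refine ⟨fun hfin => ⟨?_, hfin⟩, ?_⟩
  · exact (hμ.memLpLoc_of_oscSeminorm_lt_top hσ hp hq hv
      (h1.trans_lt (ENNReal.mul_lt_top hK.lt_top hu.2))).congr huv.symm
  · simp only [besovSpace, spaceI]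
    rw [functionalI_congr huv]
    exact (hμ.functionalI_seminorm_le s hσ hp q v).trans h1

theorem IsDoubling.besovSpace_equivalent_spaceI (hμ : IsDoubling μ C₁ n) (hs : 0 < s)
    (hp : p ≠ 0) (hq : 0 < q) (hσ : 0 < σ) (hσp : ENNReal.ofReal σ < pStar n s p) :
    (besovSpace s p q μ).Equivalent (spaceI s σ p q μ) :=
  ⟨hμ.besovSpace_embeds_spaceI hs hp hq hσ hσp, hμ.spaceI_embeds_besovSpace hs hp hq hσ⟩

theorem IsDoubling.besovSpace_equivalent_spaceC (hμ : IsDoubling μ C₁ n) (hs : 0 < s)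
    (hq : 0 < q) (hσ : 0 < σ) (hσp : ENNReal.ofReal σ ≤ p) :
    (besovSpace s p q μ).Equivalent (spaceC s σ p q μ) := by
  have hp : p ≠ 0 := fun h => by simp [h, hσ.not_ge] at hσp
  refine ⟨FunctionSpace.embeds_of_le ENNReal.one_ne_top (fun _ hu => hu.2) fun u hu =>
    ⟨fun hfin => ⟨hu.1.mono_exponent hμ hσp, hfin⟩, ?_⟩,
    (spaceC_embeds_spaceI hσ).trans (hμ.spaceI_embeds_besovSpace hs hp hq hσ)⟩
  have hae := hu.1.aestronglyMeasurable
  obtain ⟨v, hv, huv⟩ := hae.aemeasurable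
  simp only [besovSpace, spaceC]
  rw [one_mul, besovNorm_congr huv, besovTypeNorm_functionalC_congr huv]
  exact hμ.functionalC_seminorm_le s hσ hσp q hv

theorem IsDoubling.spaceI_embeds_spaceS (hμ : IsDoubling μ C₁ n) {ε : ℝ} (hε : 0 ≤ ε)
    (hεs : ε < s) (hp : p ≠ 0) (hq : 0 < q) (hσ : 0 < σ) :
    (spaceI s σ p q μ).Embeds (spaceS s ε σ p q μ) := by
  obtain ⟨K, hK, h⟩ := hμ.exists_scaleNorm_functionalS_le hσ hε hεs hp hq
  refine FunctionSpace.embeds_of_le (ENNReal.mul_ne_top hK (ENNReal.rpow_ne_top_of_nonneg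
    (by positivity) (two_rpow_ne_top (σ + 1))) : K * (2 ^ (σ + 1)) ^ (1 / σ) ≠ ∞)
    (fun u hu => hu.2) fun u hu => ⟨fun hfin => ⟨hu.1, hfin⟩, ?_⟩
  have hae := hu.1.aestronglyMeasurable
  obtain ⟨v, hv, huv⟩ := hae.aemeasurable
  simp only [spaceS, spaceI]
  rw [functionalS_congr huv, functionalI_congr huv, mul_assoc]
  refine (h v hv).trans ?_
  gcongr
  exact hμ.oscSeminorm_le_functionalI s hσ hp hq hv

theorem IsDoubling.besovSpace_equivalent_spaceS (hμ : IsDoubling μ C₁ n) {ε : ℝ} (hε : 0 ≤ ε)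
    (hεs : ε < s) (hp : p ≠ 0) (hq : 0 < q) (hσ : 0 < σ)
    (hσp : ENNReal.ofReal σ < pStar n s p) :
    (besovSpace s p q μ).Equivalent (spaceS s ε σ p q μ) :=
  ⟨(hμ.besovSpace_embeds_spaceI (hε.trans_lt hεs) hp hq hσ hσp).trans
    (hμ.spaceI_embeds_spaceS hε hεs hp hq hσ),
    (spaceS_embeds_spaceI ε).trans (hμ.spaceI_embeds_besovSpace (hε.trans_lt hεs) hp hq hσ)⟩

theorem IsDoubling.besovSpace_equivalent_spaceA (hμ : IsDoubling μ C₁ n) (hs : 0 < s)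
    (hp : ENNReal.ofReal (n / (n + s)) < p) (hq : 0 < q) (hσ : 0 < σ)
    (hσp : ENNReal.ofReal σ < pStar n s p) :
    (besovSpace s p q μ).Equivalent (spaceA s σ p q μ) := by
  have hp0 : p ≠ 0 := (bot_le.trans_lt hp).ne'
  -- Since p_*(s) > 1, the order may be raised to at least 1 without leaving the admissible range.
  have hmax : ENNReal.ofReal (max σ 1) < pStar n s p := by
    rcases le_total σ 1 with h | h
    · rw [max_eq_right h, ENNReal.ofReal_one]; exact one_lt_pStar hμ.exponent_pos hs hp
    · rwa [max_eq_left h]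
  exact ⟨(hμ.besovSpace_embeds_spaceI hs hp0 hq (one_pos.trans_le (le_max_right _ _)) hmax).trans
    (hμ.spaceI_embeds_spaceA hσ (le_max_left _ _) (le_max_right _ _) hp0 hq),
    (spaceA_embeds_spaceI hσ).trans (hμ.spaceI_embeds_besovSpace hs hp0 hq hσ)⟩

end Spaces

/-! ### Besov membership from fractional gradients -/

section Gradient

variable {X : Type*} [MetricSpace X] [MeasurableSpace X] [BorelSpace X] {μ : Measure X}
  {C₁ n : ℝ}

/-- The function is t^(s'-s) near 0 and t^(-s) near ∞, so one membership proof covers every q. -/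
theorem scaleNorm_min_lt_top {s s' : ℝ} (hs : 0 < s) (hss' : s < s') {q : ℝ≥0∞} (hq : 0 < q) :
    scaleNorm q (fun t => ENNReal.ofReal (t ^ (-s)) * ENNReal.ofReal (min (t ^ s') 1)) < ∞ := by
  unfold scaleNorm
  split_ifs with hqt
  · refine lt_of_le_of_lt (iSup₂_le fun t (ht : 0 < t) => ?_) ENNReal.one_lt_top
    beta_reduce
    rw [← ENNReal.ofReal_mul (by positivity), ENNReal.ofReal_le_one]
    rcases le_total t 1 with h | h
    · calc t ^ (-s) * min (t ^ s') 1 ≤ t ^ (-s) * t ^ s' := by gcongr; exact min_le_left _ _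
        _ = t ^ (-s + s') := (Real.rpow_add ht _ _).symm
        _ ≤ 1 := Real.rpow_le_one ht.le h (by linarith)
    · calc t ^ (-s) * min (t ^ s') 1 ≤ t ^ (-s) * 1 := by gcongr; exact min_le_right _ _
        _ ≤ 1 := by rw [mul_one]; exact Real.rpow_le_one_of_one_le_of_nonpos h (by linarith)
  · have hQ : 0 < q.toReal := ENNReal.toReal_pos hq.ne' hqt
    set Q := q.toReal
    refine ENNReal.rpow_lt_top_of_nonneg (by positivity) ?_
    have h0 : IntegrableOn (fun t : ℝ => t ^ ((s' - s) * Q - 1)) (Ioo 0 1) :=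
      (intervalIntegral.integrableOn_Ioo_rpow_iff one_pos).2
        (by nlinarith [mul_pos (sub_pos.2 hss') hQ])
    have h1 : IntegrableOn (fun t : ℝ => t ^ (-(s * Q) - 1)) (Ioi 1) :=
      integrableOn_Ioi_rpow_of_lt (by nlinarith [mul_pos hs hQ]) one_pos
    rw [← Ioc_union_Ioi_eq_Ioi zero_le_one]
    refine ne_top_of_le_ne_top ?_ (lintegral_union_le _ _ _)
    refine ENNReal.add_ne_top.2 ⟨?_, ?_⟩
    · rw [restrict_Ioo_eq_restrict_Ioc.symm]
      refine ne_top_of_le_ne_top h0.lintegral_lt_top.ne (lintegral_mono_ae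
        ((ae_restrict_iff' measurableSet_Ioo).2 (Eventually.of_forall fun t ht => ?_)))
      beta_reduce
      rw [← ENNReal.ofReal_mul (by have := ht.1; positivity),
        ENNReal.ofReal_rpow_of_nonneg (by have := ht.1; positivity) hQ.le,
        ← ENNReal.ofReal_mul (by have := ht.1; positivity)]
      refine ENNReal.ofReal_le_ofReal ?_
      have ht0 := ht.1
      calc (t ^ (-s) * min (t ^ s') 1) ^ Q * t⁻¹ ≤ (t ^ (-s) * t ^ s') ^ Q * t⁻¹ := by
            gcongr; exact min_le_left _ _
        _ = t ^ ((s' - s) * Q - 1) := by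
            rw [← Real.rpow_add ht0, ← Real.rpow_mul ht0.le, ← Real.rpow_neg_one t,
              ← Real.rpow_add ht0]
            congr 1; ring
    · refine ne_top_of_le_ne_top h1.lintegral_lt_top.ne (lintegral_mono_ae
        ((ae_restrict_iff' measurableSet_Ioi).2 (Eventually.of_forall fun t (ht : 1 < t) => ?_)))
      have ht0 : 0 < t := one_pos.trans ht
      beta_reduce
      rw [← ENNReal.ofReal_mul (by positivity),
        ENNReal.ofReal_rpow_of_nonneg (by positivity) hQ.le, ← ENNReal.ofReal_mul (by positivity)]
      refine ENNReal.ofReal_le_ofReal ?_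
      calc (t ^ (-s) * min (t ^ s') 1) ^ Q * t⁻¹ ≤ (t ^ (-s) * 1) ^ Q * t⁻¹ := by
            gcongr; exact min_le_right _ _
        _ = t ^ (-(s * Q) - 1) := by
            rw [mul_one, ← Real.rpow_mul ht0.le, ← Real.rpow_neg_one t, ← Real.rpow_add ht0]
            congr 1; ring

theorem IsDoubling.lintegral_laverage_add_le (hμ : IsDoubling μ C₁ n) {t : ℝ} (ht : 0 < t)
    {h : X → ℝ≥0∞} (hh : Measurable h) :
    ∫⁻ x, ⨍⁻ y in ball x t, (h x + h y) ∂μ ∂μ ≤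
      (1 + doublingFactor C₁ n 2) * ∫⁻ x, h x ∂μ := by
  have : ∀ x, ⨍⁻ y in ball x t, (h x + h y) ∂μ = h x + ⨍⁻ y in ball x t, h y ∂μ := fun x => by
    rw [laverage_add_left measurable_const, hμ.laverage_ball_const x ht]
  simp only [this]
  rw [lintegral_add_left hh, add_mul, one_mul]
  gcongr
  exact hμ.lintegral_laverage_le ht hh

/-- Functions in `L^p` with a fractional upper gradient of a higher order in `L^p` belong to all
homogeneous Besov spaces of lower order. -/
theorem IsDoubling.mem_besovSpace_of_gradient (hμ : IsDoubling μ C₁ n) {s s' P : ℝ} (hs : 0 < s)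
    (hss' : s < s') (hP : 0 < P) {u : X → ℝ} (hu : Measurable u)
    (hint : ∫⁻ x, ‖u x‖ₑ ^ P ∂μ ≠ ∞) {g : X → ℝ≥0∞} (hg : Measurable g)
    (hgint : ∫⁻ x, g x ^ P ∂μ ≠ ∞)
    (hug : ∀ x y, ‖u x - u y‖ₑ ≤ ENNReal.ofReal (dist x y ^ s') * (g x + g y))
    {q : ℝ≥0∞} (hq : 0 < q) : u ∈ (besovSpace s (ENNReal.ofReal P) q μ).carrier := by
  have hp0 : ENNReal.ofReal P ≠ 0 := by simpa using hP
  have hs' : 0 < s' := hs.trans hss'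
  refine ⟨fun x r _ => ⟨hu.aestronglyMeasurable, ?_⟩, ?_⟩
  · rw [eLpNorm_eq_lintegral_rpow_enorm_toReal hp0 ENNReal.ofReal_ne_top,
      ENNReal.toReal_ofReal hP.le]
    exact ENNReal.rpow_lt_top_of_nonneg (by positivity)
      (ne_top_of_le_ne_top hint (setLIntegral_le_lintegral _ _))
  · set D := 1 + doublingFactor C₁ n 2
    have hD : D ≠ ∞ := ENNReal.add_ne_top.2 ⟨ENNReal.one_ne_top, doublingFactor_ne_top _ _ _⟩
    set M := 2 ^ P * (D * (∫⁻ x, g x ^ P ∂μ + ∫⁻ x, ‖u x‖ₑ ^ P ∂μ))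
    have hM : M ≠ ∞ := ENNReal.mul_ne_top (two_rpow_ne_top _)
      (ENNReal.mul_ne_top hD (ENNReal.add_ne_top.2 ⟨hgint, hint⟩))
    have hM' : M ^ (1 / P) ≠ ∞ := ENNReal.rpow_ne_top_of_nonneg (by positivity) hM
    -- The gradient gives t^(s') for small t; for large t the L^P norm of u alone suffices.
    have hmod : ∀ t : ℝ, 0 < t → differenceModulus u (ENNReal.ofReal P) μ t ≤
        M ^ (1 / P) * ENNReal.ofReal (min (t ^ s') 1) := by
      intro t ht
      have hm1 : ∫⁻ x, ⨍⁻ y in ball x t, ‖u x - u y‖ₑ ^ P ∂μ ∂μ ≤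
          ENNReal.ofReal (t ^ s') ^ P * M := by
        calc ∫⁻ x, ⨍⁻ y in ball x t, ‖u x - u y‖ₑ ^ P ∂μ ∂μ
            ≤ ∫⁻ x, ⨍⁻ y in ball x t, (ENNReal.ofReal (t ^ s') ^ P * 2 ^ P) *
                (g x ^ P + g y ^ P) ∂μ ∂μ := by
              refine lintegral_mono fun x => setLAverage_mono_on measurableSet_ball fun y hy => ?_
              rw [mem_ball, dist_comm] at hy
              calc ‖u x - u y‖ₑ ^ P ≤ (ENNReal.ofReal (t ^ s') * (g x + g y)) ^ P := by
                    gcongr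
                    refine (hug x y).trans ?_
                    gcongr
                _ ≤ _ := by
                    rw [ENNReal.mul_rpow_of_nonneg _ _ hP.le, mul_assoc]
                    gcongr
                    exact rpow_add_le_two_rpow hP.le _ _
          _ = (ENNReal.ofReal (t ^ s') ^ P * 2 ^ P) *
                ∫⁻ x, ⨍⁻ y in ball x t, (g x ^ P + g y ^ P) ∂μ ∂μ := by
              have hK : ENNReal.ofReal (t ^ s') ^ P * 2 ^ P ≠ ∞ := ENNReal.mul_ne_top
                (ENNReal.rpow_ne_top_of_nonneg hP.le ENNReal.ofReal_ne_top) (two_rpow_ne_top _)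
              simp only [laverage_const_mul hK]
              rw [lintegral_const_mul' _ _ hK]
          _ ≤ _ := by
              rw [mul_assoc]
              refine mul_le_mul' le_rfl (mul_le_mul' le_rfl ?_)
              refine (hμ.lintegral_laverage_add_le ht (hg.pow_const P)).trans ?_
              gcongr
              exact le_self_add
      have hm2 : ∫⁻ x, ⨍⁻ y in ball x t, ‖u x - u y‖ₑ ^ P ∂μ ∂μ ≤ M := by
        calc ∫⁻ x, ⨍⁻ y in ball x t, ‖u x - u y‖ₑ ^ P ∂μ ∂μ
            ≤ ∫⁻ x, ⨍⁻ y in ball x t, 2 ^ P * (‖u x‖ₑ ^ P + ‖u y‖ₑ ^ P) ∂μ ∂μ := by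
              refine lintegral_mono fun x => laverage_mono fun y => ?_
              have := enorm_sub_rpow_le hP.le (u x) (u y) 0
              simpa using this
          _ = 2 ^ P * ∫⁻ x, ⨍⁻ y in ball x t, (‖u x‖ₑ ^ P + ‖u y‖ₑ ^ P) ∂μ ∂μ := by
              simp only [laverage_const_mul (two_rpow_ne_top P)]
              rw [lintegral_const_mul' _ _ (two_rpow_ne_top _)]
          _ ≤ _ := by
              refine mul_le_mul' le_rfl ?_
              refine (hμ.lintegral_laverage_add_le ht (h := fun x => ‖u x‖ₑ ^ P)
                (by fun_prop)).trans ?_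
              gcongr
              exact le_add_self
      rw [differenceModulus, if_neg ENNReal.ofReal_ne_top, ENNReal.toReal_ofReal hP.le]
      rcases le_total (t ^ s') 1 with h | h
      · rw [min_eq_left h]
        calc _ ≤ (ENNReal.ofReal (t ^ s') ^ P * M) ^ (1 / P) := by gcongr
          _ = _ := by
            rw [ENNReal.mul_rpow_of_nonneg _ _ (by positivity), ← ENNReal.rpow_mul,
              mul_one_div_cancel hP.ne', ENNReal.rpow_one, mul_comm]
      · rw [min_eq_right h, ENNReal.ofReal_one, mul_one]
        gcongr
    change besovNorm s (ENNReal.ofReal P) q μ u < ∞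
    rw [besovNorm_eq_scaleNorm]
    refine (scaleNorm_mono (ψ := fun t => M ^ (1 / P) * (ENNReal.ofReal (t ^ (-s)) *
      ENNReal.ofReal (min (t ^ s') 1))) fun t ht => ?_).trans_lt
      ((scaleNorm_const_mul_le hq hM' _).trans_lt
        (ENNReal.mul_lt_top hM'.lt_top (scaleNorm_min_lt_top hs hss' hq)))
    rw [mul_left_comm]
    gcongr
    exact hmod t ht

end Gradient

/-! ### Counterexamples on Euclidean space -/

section Euclidean

variable {n : ℕ}

/-- Volume scales exactly by λ^n; the constant 2 only meets the requirement C₁ > 1. -/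
theorem isDoubling_volume (hn : 1 ≤ n) :
    IsDoubling (volume : Measure (EuclideanSpace ℝ (Fin n))) 2 n where
  one_lt := one_lt_two
  exponent_pos := by exact_mod_cast hn
  ball_pos x r hr := measure_ball_pos _ _ hr
  ball_lt_top x r _ := measure_ball_lt_top
  doubling x r lam hr hlam := by
    have hl : 0 < lam := one_pos.trans hlam
    rw [Measure.addHaar_ball_of_pos _ _ (mul_pos hl hr), Measure.addHaar_ball_of_pos _ _ hr,
      ← mul_assoc, ← ENNReal.ofReal_mul (by positivity), finrank_euclideanSpace_fin, mul_pow,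
      Real.rpow_natCast]
    gcongr
    have := pow_pos hl n
    linarith

theorem integrableOn_ball_norm_rpow_iff (hn : 1 ≤ n) (β : ℝ) :
    IntegrableOn (fun x : EuclideanSpace ℝ (Fin n) => ‖x‖ ^ (-β)) (ball 0 1) ↔ β < n := by
  have : Nonempty (Fin n) := ⟨⟨0, hn⟩⟩
  rw [integrableOn_fun_norm_addHaar volume (f := fun t : ℝ => t ^ (-β)) (r := 1),
    finrank_euclideanSpace_fin, integrableOn_congr_fun (g := fun t : ℝ => t ^ ((n : ℝ) - 1 - β))
      (fun t ht => ?_) measurableSet_Ioo, intervalIntegral.integrableOn_Ioo_rpow_iff one_pos]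
  · constructor <;> intro h <;> linarith
  · change t ^ (n - 1) * t ^ (-β) = _
    rw [← Real.rpow_natCast, ← Real.rpow_add ht.1, Nat.cast_sub hn, Nat.cast_one]
    rfl

/-- A function with a power singularity at the origin, supported in the unit ball. -/
noncomputable def truncatedPower (α : ℝ) (x : EuclideanSpace ℝ (Fin n)) : ℝ :=
  max (‖x‖ ^ (-α) - 1) 0

theorem measurable_truncatedPower (α : ℝ) :
    Measurable (truncatedPower α : EuclideanSpace ℝ (Fin n) → ℝ) := by
  unfold truncatedPower
  fun_prop

/-- With z = (b - a)/b in [0,1], 1 - (1 - z)^α ≤ max(α,1) z, by Bernoulli when α ≥ 1, and z ≤ z^κ ≤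
((b - a)/a)^κ. -/
theorem rpow_neg_sub_rpow_neg_le {α κ a b : ℝ} (hα : 0 < α) (hκ0 : 0 ≤ κ) (hκ : κ ≤ 1)
    (ha : 0 < a) (hab : a ≤ b) :
    a ^ (-α) - b ^ (-α) ≤ max α 1 * ((b - a) ^ κ * a ^ (-(α + κ))) := by
  have hb : 0 < b := ha.trans_le hab
  set z := (b - a) / b with hz
  have hz0 : 0 ≤ z := div_nonneg (sub_nonneg.2 hab) hb.le
  have hz1 : z ≤ 1 := by rw [hz, div_le_one hb]; linarith
  have habz : a / b = 1 - z := by rw [hz]; field_simp; ring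
  have h1 : 1 - (a / b) ^ α ≤ max α 1 * z := by
    rw [habz]
    rcases le_total 1 α with h | h
    · rw [max_eq_left h]
      have := one_add_mul_self_le_rpow_one_add (s := -z) (by linarith) h
      rw [← sub_eq_add_neg] at this
      linarith
    · rw [max_eq_right h]
      have := Real.rpow_le_rpow_of_exponent_ge' (x := 1 - z) (by linarith) (by linarith) hα.le h
      rw [Real.rpow_one] at this
      linarith
  have h2 : z ≤ ((b - a) / a) ^ κ := by
    calc z = z ^ (1 : ℝ) := (Real.rpow_one z).symm
      _ ≤ z ^ κ := Real.rpow_le_rpow_of_exponent_ge' hz0 hz1 hκ0 hκ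
      _ ≤ _ := by
          refine Real.rpow_le_rpow hz0 ?_ hκ0
          exact div_le_div_of_nonneg_left (sub_nonneg.2 hab) ha hab
  have e : a ^ (-α) - b ^ (-α) = a ^ (-α) * (1 - (a / b) ^ α) := by
    rw [Real.div_rpow ha.le hb.le, Real.rpow_neg ha.le, Real.rpow_neg hb.le]
    have := (Real.rpow_pos_of_pos ha α).ne'
    field_simp
  calc _ = a ^ (-α) * (1 - (a / b) ^ α) := e
    _ ≤ a ^ (-α) * (max α 1 * ((b - a) / a) ^ κ) := by
        gcongr; exact h1.trans (by gcongr)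
    _ = _ := by
        rw [Real.div_rpow (sub_nonneg.2 hab) ha.le, neg_add, Real.rpow_add ha,
          Real.rpow_neg ha.le κ]
        ring

/-- The point nearer the origin carries the whole gradient, a multiple of |x|^(-(α+κ)) on the unit
ball. -/
theorem enorm_truncatedPower_sub_le {α κ : ℝ} (hα : 0 < α) (hκ0 : 0 < κ) (hκ : κ ≤ 1)
    {x y : EuclideanSpace ℝ (Fin n)} (hxy : ‖x‖ ≤ ‖y‖) :
    ‖truncatedPower α x - truncatedPower α y‖ₑ ≤ ENNReal.ofReal (dist x y ^ κ) *
      (ball 0 1).indicator (fun z => ENNReal.ofReal (max α 1) * ‖z‖ₑ ^ (-(α + κ))) x := by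
  by_cases hx1 : ‖x‖ < 1
  · rw [indicator_of_mem (by simpa using hx1)]
    -- At the origin the real power takes a default value, but the extended gradient is ∞ and the
    -- bound is trivial.
    by_cases hx0 : x = 0
    · by_cases hy0 : y = 0
      · simp [hx0, hy0]
      · have h1 : 0 < dist x y := dist_pos.2 (by rw [hx0]; exact Ne.symm hy0)
        have h2 : 0 < max α 1 := by positivity
        rw [hx0, enorm_zero, ENNReal.zero_rpow_of_neg (by linarith), ENNReal.mul_top (by simp),
          ENNReal.mul_top]
        · exact le_top
        · rw [← hx0, ENNReal.ofReal_ne_zero_iff]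
          exact Real.rpow_pos_of_pos h1 κ
    · have ha : 0 < ‖x‖ := norm_pos_iff.2 hx0
      rw [← ofReal_norm (x := x), ENNReal.ofReal_rpow_of_pos ha,
        ← ENNReal.ofReal_mul (by positivity), ← ENNReal.ofReal_mul (by positivity),
        ← ofReal_norm (x := truncatedPower α x - truncatedPower α y)]
      refine ENNReal.ofReal_le_ofReal ?_
      have h1 : ‖truncatedPower α x - truncatedPower α y‖ ≤ ‖x‖ ^ (-α) - ‖y‖ ^ (-α) := by
        have h2 := abs_max_sub_max_le_abs (‖x‖ ^ (-α) - 1) (‖y‖ ^ (-α) - 1) 0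
        have h3 : ‖y‖ ^ (-α) ≤ ‖x‖ ^ (-α) :=
          Real.rpow_le_rpow_of_nonpos ha hxy (by linarith)
        rw [sub_sub_sub_cancel_right, abs_of_nonneg (sub_nonneg.2 h3)] at h2
        exact h2
      refine h1.trans ((rpow_neg_sub_rpow_neg_le hα hκ0.le hκ ha hxy).trans ?_)
      rw [mul_left_comm]
      have h4 : ‖y‖ - ‖x‖ ≤ dist x y := by
        rw [dist_comm, dist_eq_norm]; exact norm_sub_norm_le y x
      have := sub_nonneg.2 hxy
      gcongr
  · have hle : ∀ z : EuclideanSpace ℝ (Fin n), 1 ≤ ‖z‖ → truncatedPower α z = 0 := fun z hz =>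
      max_eq_right (sub_nonpos.2 (Real.rpow_le_one_of_one_le_of_nonpos hz (by linarith)))
    rw [hle x (not_lt.1 hx1), hle y ((not_lt.1 hx1).trans hxy)]
    simp

theorem setLIntegral_ball_enorm_rpow_ne_top (hn : 1 ≤ n) {β : ℝ} (hβ : β < n) :
    ∫⁻ x in ball (0 : EuclideanSpace ℝ (Fin n)) 1, ‖x‖ₑ ^ (-β) ≠ ∞ := by
  have : Nonempty (Fin n) := ⟨⟨0, hn⟩⟩
  refine ne_top_of_le_ne_top ((integrableOn_ball_norm_rpow_iff hn β).2 hβ).lintegral_lt_top.ne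
    (lintegral_mono_ae (ae_restrict_of_ae ?_))
  have h0 : ∀ᵐ x : EuclideanSpace ℝ (Fin n), x ≠ 0 := by simp [ae_iff]
  filter_upwards [h0] with x hx
  rw [← ofReal_norm (x := x), ENNReal.ofReal_rpow_of_pos (norm_pos_iff.2 hx)]

theorem truncatedPower_mem_besovSpace (hn : 1 ≤ n) {s p α : ℝ} (hs : 0 < s) (hs1 : s < 1)
    (hp : 0 < p) (hα : 0 < α) (hαs : α < n / p - s) {q : ℝ≥0∞} (hq : 0 < q) :
    (truncatedPower α : EuclideanSpace ℝ (Fin n) → ℝ) ∈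
      (besovSpace s (ENNReal.ofReal p) q volume).carrier := by
  -- The gradient order κ must exceed s, be at most 1, and satisfy (α + κ)p < n for p-integrability
  -- of |x|^(-(α+κ)).
  obtain ⟨κ, hκ1, hκ2⟩ := exists_between (lt_min hs1 (lt_sub_comm.1 hαs))
  rw [lt_min_iff] at hκ2
  have hκ0 : 0 < κ := hs.trans hκ1
  have hακ : (α + κ) * p < n := by
    have : α + κ < n / p := by linarith [hκ2.2]
    rwa [lt_div_iff₀ hp] at this
  refine (isDoubling_volume hn).mem_besovSpace_of_gradient hs hκ1 hp (measurable_truncatedPower α)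
    ?_ (g := (ball 0 1).indicator fun z => ENNReal.ofReal (max α 1) * ‖z‖ₑ ^ (-(α + κ)))
    ((by fun_prop : Measurable fun z : EuclideanSpace ℝ (Fin n) =>
      ENNReal.ofReal (max α 1) * ‖z‖ₑ ^ (-(α + κ))).indicator measurableSet_ball) ?_ ?_ hq
  · have hle : ∀ x : EuclideanSpace ℝ (Fin n), ‖truncatedPower α x‖ₑ ^ p ≤
        (ball 0 1).indicator (fun z => ‖z‖ₑ ^ (-(α * p))) x := by
      intro x
      by_cases hx1 : ‖x‖ < 1
      · rw [indicator_of_mem (by simpa using hx1)]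
        by_cases hx0 : x = 0
        · rw [hx0, enorm_zero, ENNReal.zero_rpow_of_neg (by have := mul_pos hα hp; linarith)]
          exact le_top
        · have ha : 0 < ‖x‖ := norm_pos_iff.2 hx0
          have h1 : ‖truncatedPower α x‖ₑ ≤ ‖x‖ₑ ^ (-α) := by
            rw [← ofReal_norm (x := x), ENNReal.ofReal_rpow_of_pos ha,
              ← ofReal_norm (x := truncatedPower α x)]
            refine ENNReal.ofReal_le_ofReal ?_
            rw [truncatedPower, Real.norm_of_nonneg (le_max_right _ _)]
            exact max_le (by linarith) (by positivity)
          calc _ ≤ (‖x‖ₑ ^ (-α)) ^ p := by gcongr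
            _ = _ := by rw [← ENNReal.rpow_mul, neg_mul]
      · rw [truncatedPower, max_eq_right (sub_nonpos.2
          (Real.rpow_le_one_of_one_le_of_nonpos (not_lt.1 hx1) (by linarith)))]
        simp [hp]
    refine ne_top_of_le_ne_top ?_ (lintegral_mono hle)
    rw [lintegral_indicator measurableSet_ball]
    exact setLIntegral_ball_enorm_rpow_ne_top hn (by nlinarith)
  · have e : ∀ x : EuclideanSpace ℝ (Fin n),
        (ball 0 1).indicator (fun z => ENNReal.ofReal (max α 1) * ‖z‖ₑ ^ (-(α + κ))) x ^ p =
        (ball 0 1).indicator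
          (fun z => ENNReal.ofReal (max α 1) ^ p * ‖z‖ₑ ^ (-((α + κ) * p))) x := by
      intro x
      by_cases hx : x ∈ ball (0 : EuclideanSpace ℝ (Fin n)) 1
      · rw [indicator_of_mem hx, indicator_of_mem hx, ENNReal.mul_rpow_of_nonneg _ _ hp.le,
          ← ENNReal.rpow_mul, neg_mul]
      · rw [indicator_of_notMem hx, indicator_of_notMem hx, ENNReal.zero_rpow_of_pos hp]
    have hK : ENNReal.ofReal (max α 1) ^ p ≠ ∞ :=
      ENNReal.rpow_ne_top_of_nonneg hp.le ENNReal.ofReal_ne_top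
    rw [lintegral_congr e, lintegral_indicator measurableSet_ball, lintegral_const_mul' _ _ hK]
    exact ENNReal.mul_ne_top hK (setLIntegral_ball_enorm_rpow_ne_top hn hακ)
  · intro x y
    rcases le_total ‖x‖ ‖y‖ with h | h
    · refine (enorm_truncatedPower_sub_le hα hκ0 hκ2.1.le h).trans ?_
      gcongr
      exact le_self_add
    · rw [enorm_sub_comm, dist_comm]
      refine (enorm_truncatedPower_sub_le hα hκ0 hκ2.1.le h).trans ?_
      gcongr
      exact le_add_self

theorem not_memLpLoc_truncatedPower (hn : 1 ≤ n) {σ α : ℝ} (hσ : 0 < σ) (hα : 0 < α)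
    (hασ : n ≤ α * σ) :
    ¬ MemLpLoc (truncatedPower α : EuclideanSpace ℝ (Fin n) → ℝ) (ENNReal.ofReal σ) volume := by
  have : Nonempty (Fin n) := ⟨⟨0, hn⟩⟩
  intro h
  have : IsFiniteMeasure (volume.restrict (ball (0 : EuclideanSpace ℝ (Fin n)) 1)) :=
    isFiniteMeasure_restrict.2 measure_ball_lt_top.ne
  -- Adding 1 back recovers |x|^(-α) on the punctured unit ball.
  have h1 := ((h 0 1 one_pos).add (memLp_const 1)).integrable_norm_rpow
    (by simpa using hσ) ENNReal.ofReal_ne_top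
  rw [ENNReal.toReal_ofReal hσ.le] at h1
  have h2 : IntegrableOn (fun x : EuclideanSpace ℝ (Fin n) => ‖x‖ ^ (-(α * σ))) (ball 0 1) := by
    refine h1.congr ?_
    have h0 : ∀ᵐ x : EuclideanSpace ℝ (Fin n), x ≠ 0 := by simp [ae_iff]
    filter_upwards [ae_restrict_of_ae h0, ae_restrict_mem measurableSet_ball] with x hx hx1
    have ha : 0 < ‖x‖ := norm_pos_iff.2 hx
    have hx1' : ‖x‖ < 1 := by simpa using hx1
    have h3 : 1 ≤ ‖x‖ ^ (-α) :=
      Real.one_le_rpow_of_pos_of_le_one_of_nonpos ha hx1'.le (by linarith)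
    have h4 : truncatedPower α x + 1 = ‖x‖ ^ (-α) := by
      rw [truncatedPower, max_eq_left (sub_nonneg.2 h3), sub_add_cancel]
    change ‖truncatedPower α x + 1‖ ^ σ = _
    rw [h4, Real.norm_of_nonneg (by positivity), ← Real.rpow_mul ha.le, neg_mul]
  exact absurd ((integrableOn_ball_norm_rpow_iff hn _).1 h2) (not_lt.2 hασ)

/-- A Lipschitz function supported in the unit ball. -/
noncomputable def coneFunction (x : EuclideanSpace ℝ (Fin n)) : ℝ := max (1 - ‖x‖) 0

theorem coneFunction_mem_besovSpace (hn : 1 ≤ n) {s p : ℝ} (hs : 0 < s) (hs1 : s < 1)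
    (hp : 0 < p) {q : ℝ≥0∞} (hq : 0 < q) :
    (coneFunction : EuclideanSpace ℝ (Fin n) → ℝ) ∈
      (besovSpace s (ENNReal.ofReal p) q volume).carrier := by
  have hzero : ∀ z : EuclideanSpace ℝ (Fin n), z ∉ ball 0 1 → coneFunction z = 0 := fun z hz =>
    max_eq_right (sub_nonpos.2 (by simpa using hz))
  have hone : ∫⁻ x : EuclideanSpace ℝ (Fin n), (ball 0 1).indicator (fun _ => (1 : ℝ≥0∞)) x ^ p
      ≠ ∞ := by
    have e : ∀ x : EuclideanSpace ℝ (Fin n), (ball 0 1).indicator (fun _ => (1 : ℝ≥0∞)) x ^ p =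
        (ball 0 1).indicator (fun _ => (1 : ℝ≥0∞)) x := by
      intro x
      by_cases hx : x ∈ ball (0 : EuclideanSpace ℝ (Fin n)) 1
      · rw [indicator_of_mem hx, ENNReal.one_rpow]
      · rw [indicator_of_notMem hx, ENNReal.zero_rpow_of_pos hp]
    rw [lintegral_congr e, lintegral_indicator measurableSet_ball, setLIntegral_one]
    exact measure_ball_lt_top.ne
  -- The cone is 1-Lipschitz and vanishes off the unit ball, so the indicator of that ball is a
  -- gradient of order 1 > s.
  refine (isDoubling_volume hn).mem_besovSpace_of_gradient hs hs1 hp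
    (by unfold coneFunction; fun_prop) ?_ (g := (ball 0 1).indicator fun _ => 1)
    (measurable_const.indicator measurableSet_ball) hone ?_ hq
  · refine ne_top_of_le_ne_top hone (lintegral_mono fun x => ?_)
    gcongr
    by_cases hx : x ∈ ball (0 : EuclideanSpace ℝ (Fin n)) 1
    · rw [indicator_of_mem hx, ← ofReal_norm, ENNReal.ofReal_le_one, coneFunction,
        Real.norm_of_nonneg (le_max_right _ _)]
      exact max_le (by linarith [norm_nonneg x]) zero_le_one
    · rw [hzero x hx]; simp
  · intro x y
    by_cases hxy : x ∈ ball 0 1 ∨ y ∈ ball 0 1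
    · have h1 : 1 ≤ (ball 0 1).indicator (fun _ => (1 : ℝ≥0∞)) x +
          (ball 0 1).indicator (fun _ => (1 : ℝ≥0∞)) y := by
        rcases hxy with h | h
        · rw [indicator_of_mem h]; exact le_self_add
        · rw [indicator_of_mem h]; exact le_add_self
      refine le_trans ?_ (le_mul_of_one_le_right zero_le h1)
      rw [Real.rpow_one, ← ofReal_norm]
      refine ENNReal.ofReal_le_ofReal ?_
      refine (abs_max_sub_max_le_abs (1 - ‖x‖) (1 - ‖y‖) 0).trans ?_
      rw [sub_sub_sub_cancel_left, abs_sub_comm, dist_eq_norm]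
      exact abs_norm_sub_norm_le x y
    · rw [not_or] at hxy
      rw [hzero x hxy.1, hzero y hxy.2]
      simp

/-- No constant fits both parts of B(x,3): if |c| < 1/4 it misses the values ≥ 1/2 on B(0,1/2);
otherwise it misses the value 0 on a ball of radius 1/2 centred at norm 3/2. -/
theorem bestConst_coneFunction_ge (hn : 1 ≤ n) {p : ℝ} (hp : 0 < p)
    {x : EuclideanSpace ℝ (Fin n)} (hx : x ∈ ball 0 1) :
    ENNReal.ofReal (1 / 4) ^ p * volume (ball (0 : EuclideanSpace ℝ (Fin n)) (1 / 2)) /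
      volume (ball (0 : EuclideanSpace ℝ (Fin n)) 3) ≤ bestConst p volume coneFunction 3 x := by
  have : Nonempty (Fin n) := ⟨⟨0, hn⟩⟩
  rw [mem_ball, dist_zero_right] at hx
  refine le_iInf fun c => ?_
  rw [setLAverage_eq, Measure.addHaar_ball_center volume x]
  gcongr
  have key : ∀ y : EuclideanSpace ℝ (Fin n), ‖y‖ ≤ 3 / 2 →
      (∀ z ∈ ball y (1 / 2), 1 / 4 ≤ |coneFunction z - c|) →
      ENNReal.ofReal (1 / 4) ^ p * volume (ball (0 : EuclideanSpace ℝ (Fin n)) (1 / 2)) ≤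
        ∫⁻ z in ball x 3, ‖coneFunction z - c‖ₑ ^ p := by
    intro y hy hyc
    have hsub : ball y (1 / 2) ⊆ ball x 3 := by
      refine ball_subset_ball' ?_
      have := dist_le_norm_add_norm y x
      linarith
    refine le_trans ?_ (lintegral_mono_set hsub)
    rw [← Measure.addHaar_ball_center volume y, ← setLIntegral_const]
    refine setLIntegral_mono' measurableSet_ball fun z hz => ?_
    gcongr
    rw [← ofReal_norm]
    exact ENNReal.ofReal_le_ofReal (hyc z hz)
  by_cases hc : |c| < 1 / 4
  · refine key 0 (by norm_num) fun z hz => ?_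
    have hz' : ‖z‖ < 1 / 2 := by simpa using hz
    have h1 : 1 / 2 ≤ coneFunction z := le_max_of_le_left (by linarith)
    rw [abs_lt] at hc
    exact (by linarith : 1 / 4 ≤ coneFunction z - c).trans (le_abs_self _)
  · obtain ⟨y, hy⟩ := exists_norm_eq (EuclideanSpace ℝ (Fin n)) (c := 3 / 2) (by norm_num)
    refine key y hy.le fun z hz => ?_
    have h1 : 1 ≤ ‖z‖ := by
      have h2 := norm_sub_norm_le y z
      rw [mem_ball, dist_comm, dist_eq_norm] at hz
      linarith
    have h3 : coneFunction z = 0 := max_eq_right (sub_nonpos.2 h1)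
    rw [h3, zero_sub, abs_neg]
    exact not_lt.1 hc

theorem lintegral_Ioi_ofReal_inv {a : ℝ} (ha : 0 ≤ a) :
    ∫⁻ t in Ioi a, ENNReal.ofReal t⁻¹ = ∞ := by
  by_contra h
  refine not_integrableOn_Ioi_inv (a := a) ?_
  refine (lintegral_ofReal_ne_top_iff_integrable (by fun_prop) ?_).1 h
  filter_upwards [ae_restrict_mem measurableSet_Ioi] with t ht
  exact inv_nonneg.2 (ha.trans (le_of_lt ht))

/-- For ε = s the prefactor t^(ε-s) is 1, so the competitor r = 3 bounds S from below on the unit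
ball for all t ≥ 3, and ∫ dt/t diverges at infinity. -/
theorem coneFunction_notMem_spaceS (hn : 1 ≤ n) (s : ℝ) {p : ℝ} (hp : 0 < p) :
    (coneFunction : EuclideanSpace ℝ (Fin n) → ℝ) ∉
      (spaceS s s p (ENNReal.ofReal p) (ENNReal.ofReal p) volume).carrier := by
  intro hmem
  have hfin := hmem.2
  have hp0 : ENNReal.ofReal p ≠ 0 := by simpa using hp
  set m : ℝ≥0∞ := ENNReal.ofReal (1 / 4) ^ p *
    volume (ball (0 : EuclideanSpace ℝ (Fin n)) (1 / 2)) /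
      volume (ball (0 : EuclideanSpace ℝ (Fin n)) 3)
  have hm : m ≠ 0 := by
    refine ENNReal.div_ne_zero.2 ⟨mul_ne_zero ?_ (measure_ball_pos _ _ (by norm_num)).ne',
      measure_ball_lt_top.ne⟩
    rw [ENNReal.ofReal_rpow_of_pos (by norm_num)]
    simpa using Real.rpow_pos_of_pos (by norm_num : (0 : ℝ) < 4⁻¹) p
  set c : ℝ≥0∞ := ENNReal.ofReal (3 ^ (-s)) * m ^ (1 / p)
  have hc : c ≠ 0 := by
    refine mul_ne_zero ?_ ?_
    · simpa using Real.rpow_pos_of_pos (by norm_num : (0 : ℝ) < 3) (-s)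
    · simp [ENNReal.rpow_eq_zero_iff, hm, hp.le]
  have hS : ∀ t : ℝ, 3 ≤ t → ∀ x : EuclideanSpace ℝ (Fin n), x ∈ ball 0 1 →
      c ≤ functionalS s s p volume coneFunction t x := by
    intro t ht x hx
    unfold functionalS
    rw [sub_self, Real.rpow_zero, ENNReal.ofReal_one, one_mul]
    refine le_trans ?_ (le_iSup₂ (f := fun r (_ : r ∈ Ioc (0 : ℝ) t) => ENNReal.ofReal (r ^ (-s)) *
      bestConst p volume coneFunction r x ^ (1 / p)) 3 ⟨by norm_num, ht⟩)
    exact mul_le_mul' le_rfl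
      (ENNReal.rpow_le_rpow (bestConst_coneFunction_ge hn hp hx) (by positivity))
  have hnorm : ∀ t : ℝ, 3 ≤ t → c ^ p * volume (ball (0 : EuclideanSpace ℝ (Fin n)) 1) ≤
      eLpNorm (functionalS s s p volume (coneFunction : EuclideanSpace ℝ (Fin n) → ℝ) t)
        (ENNReal.ofReal p) volume ^ p := by
    intro t ht
    have h1 := eLpNorm_rpow_eq_lintegral (μ := volume) hp0 ENNReal.ofReal_ne_top
      (functionalS s s p volume (coneFunction : EuclideanSpace ℝ (Fin n) → ℝ) t)
    rw [ENNReal.toReal_ofReal hp.le] at h1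
    rw [h1, ← setLIntegral_const]
    refine le_trans (setLIntegral_mono' measurableSet_ball fun x hx => ?_)
      (setLIntegral_le_lintegral (ball 0 1) _)
    exact ENNReal.rpow_le_rpow (hS t ht x hx) hp.le
  refine hfin.ne (top_le_iff.1 ?_)
  change ∞ ≤ besovTypeNorm _ _ _ _
  unfold besovTypeNorm
  rw [if_neg ENNReal.ofReal_ne_top, ENNReal.toReal_ofReal hp.le]
  have hinf : ∞ ≤ ∫⁻ t in Ioi (0 : ℝ),
      eLpNorm (functionalS s s p volume (coneFunction : EuclideanSpace ℝ (Fin n) → ℝ) t)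
        (ENNReal.ofReal p) volume ^ p * ENNReal.ofReal t⁻¹ := by
    calc ∞ = c ^ p * volume (ball (0 : EuclideanSpace ℝ (Fin n)) 1) *
          ∫⁻ t in Ioi (3 : ℝ), ENNReal.ofReal t⁻¹ := by
          rw [lintegral_Ioi_ofReal_inv (by norm_num), ENNReal.mul_top]
          refine mul_ne_zero ?_ (measure_ball_pos _ _ one_pos).ne'
          simp [ENNReal.rpow_eq_zero_iff, hc, hp.le]
      _ = ∫⁻ t in Ioi (3 : ℝ), c ^ p * volume (ball (0 : EuclideanSpace ℝ (Fin n)) 1) *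
          ENNReal.ofReal t⁻¹ := (lintegral_const_mul _ (by fun_prop)).symm
      _ ≤ ∫⁻ t in Ioi (3 : ℝ),
          eLpNorm (functionalS s s p volume (coneFunction : EuclideanSpace ℝ (Fin n) → ℝ) t)
            (ENNReal.ofReal p) volume ^ p * ENNReal.ofReal t⁻¹ := by
          refine lintegral_mono_ae ((ae_restrict_iff' measurableSet_Ioi).2
            (Eventually.of_forall fun t ht => ?_))
          gcongr
          exact hnorm t (le_of_lt ht)
      _ ≤ _ := lintegral_mono_set (Ioi_subset_Ioi (by norm_num))
  rw [top_le_iff.1 hinf, ENNReal.top_rpow_of_pos (by positivity)]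

end Euclidean

end BesovMMS

/-! ### Assembly of the theorem -/

open BesovMMS
theorem theorem1p1 :
    -- (i)-(iv): the characterizations on doubling metric measure spaces
    (∀ (X : Type*) [MetricSpace X] [MeasurableSpace X] [BorelSpace X] (μ : Measure X)
      (C₁ n : ℝ), IsDoubling μ C₁ n →
      ∀ (s : ℝ) (p q : ℝ≥0∞), 0 < s → 0 < p → 0 < q →
        (∀ σ : ℝ, 0 < σ → ENNReal.ofReal σ ≤ p →
          (besovSpace s p q μ).Equivalent (spaceC s σ p q μ)) ∧
        (∀ σ : ℝ, 0 < σ → ENNReal.ofReal σ < pStar n s p →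
          (besovSpace s p q μ).Equivalent (spaceI s σ p q μ)) ∧
        (∀ ε σ : ℝ, 0 ≤ ε → ε < s → 0 < σ → ENNReal.ofReal σ < pStar n s p →
          (besovSpace s p q μ).Equivalent (spaceS s ε σ p q μ)) ∧
        (ENNReal.ofReal (n / (n + s)) < p →
          ∀ σ : ℝ, 0 < σ → ENNReal.ofReal σ < pStar n s p →
            (besovSpace s p q μ).Equivalent (spaceA s σ p q μ))) ∧
    -- (v)-(vii): optimality of the ranges on Euclidean spaces
    (∀ n : ℕ, 1 ≤ n →
      (∀ s p σ : ℝ, 0 < s → s < 1 → 0 < p → p < n / s → 0 < σ →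
        pStar n s (ENNReal.ofReal p) < ENNReal.ofReal σ →
        ∃ u : EuclideanSpace ℝ (Fin n) → ℝ, ∀ q : ℝ≥0∞, 0 < q →
          u ∈ (besovSpace s (ENNReal.ofReal p) q volume).carrier ∧
          ¬ MemLpLoc u (ENNReal.ofReal σ) volume ∧
          u ∉ (spaceA s σ (ENNReal.ofReal p) q volume).carrier ∧
          u ∉ (spaceI s σ (ENNReal.ofReal p) q volume).carrier ∧
          ∀ ε : ℝ, 0 ≤ ε → ε ≤ s →
            u ∉ (spaceS s ε σ (ENNReal.ofReal p) q volume).carrier) ∧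
      (∀ s p σ : ℝ, 0 < p → p < σ → 0 < s → s < n / p - n / σ → s < 1 →
        ∃ u : EuclideanSpace ℝ (Fin n) → ℝ, ∀ q : ℝ≥0∞, 0 < q →
          u ∈ (besovSpace s (ENNReal.ofReal p) q volume).carrier ∧
          u ∉ (spaceC s σ (ENNReal.ofReal p) q volume).carrier) ∧
      (∀ s p : ℝ, 0 < s → s < 1 → 0 < p →
        ∃ u : EuclideanSpace ℝ (Fin n) → ℝ,
          u ∈ (besovSpace s (ENNReal.ofReal p) (ENNReal.ofReal p) volume).carrier ∧
          u ∉ (spaceS s s p (ENNReal.ofReal p) (ENNReal.ofReal p) volume).carrier)) := by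
  -- One singular function refutes both ranges of σ. The exponent α = n/σ is borderline: |x|^(-ασ) =
  -- |x|^(-n) just fails to be integrable.
  have hsing : ∀ n : ℕ, 1 ≤ n → ∀ s p σ : ℝ, 0 < s → s < 1 → 0 < p → 0 < σ →
      n / σ < n / p - s →
      ∃ u : EuclideanSpace ℝ (Fin n) → ℝ, (∀ q : ℝ≥0∞, 0 < q →
        u ∈ (besovSpace s (ENNReal.ofReal p) q volume).carrier) ∧
        ¬ MemLpLoc u (ENNReal.ofReal σ) volume := by
    intro n hn s p σ hs hs1 hp hσ h
    have hn0 : (0 : ℝ) < n := by exact_mod_cast hn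
    have hα : 0 < n / σ := by positivity
    exact ⟨truncatedPower (n / σ),
      fun q hq => truncatedPower_mem_besovSpace hn hs hs1 hp hα h hq,
      not_memLpLoc_truncatedPower hn hσ hα (div_mul_cancel₀ _ hσ.ne').ge⟩
  refine ⟨fun X _ _ _ μ C₁ n hμ s p q hs hp hq => ⟨fun σ hσ h => ?_, fun σ hσ h => ?_,
    fun ε σ hε hεs hσ h => ?_, fun hps σ hσ h => ?_⟩, fun n hn => ⟨?_, ?_, ?_⟩⟩
  · exact hμ.besovSpace_equivalent_spaceC hs hq hσ h
  · exact hμ.besovSpace_equivalent_spaceI hs hp.ne' hq hσ h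
  · exact hμ.besovSpace_equivalent_spaceS hε hεs hp.ne' hq hσ h
  · exact hμ.besovSpace_equivalent_spaceA hs hps hq hσ h
  · intro s p σ hs hs1 hp hpn hσ hσp
    have hn0 : (0 : ℝ) < n := by exact_mod_cast hn
    have hd : 0 < n - p * s := by rw [lt_div_iff₀ hs] at hpn; linarith
    rw [pStar, if_pos ((ENNReal.ofReal_lt_ofReal_iff (by positivity)).2 hpn),
      ENNReal.toReal_ofReal hp.le, ENNReal.ofReal_lt_ofReal_iff hσ, div_lt_iff₀ hd] at hσp
    -- This is σ > np/(n - ps) rearranged.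
    have h : n / σ < n / p - s := by
      rw [div_sub' hp.ne', div_lt_div_iff₀ hσ hp]
      linarith
    obtain ⟨u, hu, hloc⟩ := hsing n hn s p σ hs hs1 hp hσ h
    exact ⟨u, fun q hq => ⟨hu q hq, hloc, fun h => hloc h.1, fun h => hloc h.1,
      fun _ _ _ h => hloc h.1⟩⟩
  · intro s p σ hp hpσ hs hsn hs1
    have hσ : 0 < σ := hp.trans hpσ
    obtain ⟨u, hu, hloc⟩ := hsing n hn s p σ hs hs1 hp hσ (by linarith)
    exact ⟨u, fun q hq => ⟨hu q hq, fun h => hloc h.1⟩⟩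
  · intro s p hs hs1 hp
    exact ⟨coneFunction, coneFunction_mem_besovSpace hn hs hs1 hp (by simpa using hp),
      coneFunction_notMem_spaceS hn s hp⟩
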